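/- Let $X$ be a smooth scheme over a field $k$ of characteristic zero (for instance a smooth $\mathcal{D}$-affine variety). A \emph{derived $\mathcal{D}$-algebra} on $X$ is a sheaf $\mathcal{A}=\mathcal{A}^{\bullet}$ of commutative differential graded algebras in left $\mathcal{D}_X$-modules, with terms quasi-coherent over $\mathcal{O}_X$, cohomologically graded, with $\mathcal{A}^i=0$ for $i>0$. (Finiteness conditions on the cohomology are allowed but not needed.) Write $\mathcal{H}^i_{\mathcal{D}}(\mathcal{A})$ for its cohomology sheaves; $\mathcal{H}^0_{\mathcal{D}}(\mathcal{A})=\mathcal{A}^0/d\mathcal{A}^{-1}$ is an ordinary commutative $\mathcal{D}_X$-algebra, and there is a projection $\mathcal{A}\to\mathcal{H}^0_{\mathcal{D}}(\mathcal{A})$. A morphism $f:\mathcal{A}\to\mathcal{B}$ of derived $\mathcal{D}$-algebras is called \emph{$\mathcal{D}$-flat} if $\mathcal{H}^0_{\mathcal{D}}(\mathcal{B})$ is flat over $\mathcal{H}^0_{\mathcal{D}}(\mathcal{A})$ (with respect to $\otimes_{\mathcal{H}^0_{\mathcal{D}}(\mathcal{A})}$) and the natural map $$\mathcal{H}^0_{\mathcal{D}}(\mathcal{B})\otimes_{\mathcal{H}^0_{\mathcal{D}}(\mathcal{A})}\mathcal{H}^j_{\mathcal{D}}(\mathcal{A})\longrightarrow\mathcal{H}^j_{\mathcal{D}}(\mathcal{B})$$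 is an isomorphism for every $j$. The derived tensor product $\mathcal{B}\otimes^{\mathbb{L}}_{\mathcal{A}}\mathcal{H}^0_{\mathcal{D}}(\mathcal{A})$ is $\mathcal{Q}\otimes_{\mathcal{A}}\mathcal{H}^0_{\mathcal{D}}(\mathcal{A})$, where $\mathcal{A}\to\mathcal{Q}\to\mathcal{B}$ is any factorization of $f$ in derived $\mathcal{D}$-algebras with $\mathcal{Q}\to\mathcal{B}$ a quasi-isomorphism and $\mathcal{Q}$ K-flat over $\mathcal{A}$ (on every affine open set, $\mathcal{Q}\otimes_{\mathcal{A}}-$ preserves acyclic dg modules). It is an algebra over $\mathcal{H}^0_{\mathcal{D}}(\mathcal{A})$ in dg $\mathcal{D}_X$-modules. Two such algebras are weakly equivalent if they are connected by a zigzag of quasi-isomorphisms of $\mathcal{H}^0_{\mathcal{D}}(\mathcal{A})$-algebras in dg $\mathcal{D}_X$-modules; such an algebra is discrete if it is concentrated in degree $0$. \textbf{Proposition.} Let $f:\mathcal{A}\to\mathcal{B}$ be a morphism of derived $\mathcal{D}$-algebras on $X$. For every choice of the resolution $\mathcal{Q}$ as above, the morphism $f$ is $\mathcal{D}$-flat if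 and only if $\mathcal{B}\otimes^{\mathbb{L}}_{\mathcal{A}}\mathcal{H}^0_{\mathcal{D}}(\mathcal{A})$ is weakly equivalent to a discrete flat $\mathcal{H}^0_{\mathcal{D}}(\mathcal{A})$-algebra in $\mathcal{D}_X$-modules. -/

import Mathlib

open CategoryTheory AlgebraicGeometry
open scoped TensorProduct DirectSum

universe u

namespace DGeom

noncomputable section

/-! ## Derived D-algebras on an affine piece -/

/-- A commutative differential graded algebra in left `D`-modules over the `k`-algebra `R`
(for `R` smooth over a field `k` of characteristic zero), cohomologically graded and connective,
that is, zero in positive degrees. The left `D`-module structure on each degree is an integrable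
connection: an action `nabla` of the `k`-derivations of `R`; the product and the differential
are `D`-linear, the derivations acting on products by the Leibniz rule. -/
structure DAlg (k R : Type u) [CommRing k] [CommRing R] [Algebra k R] where
  deg : ℤ → Type u
  [addCommGroup : ∀ i, AddCommGroup (deg i)]
  [module : ∀ i, Module R (deg i)]
  subsingleton_of_pos : ∀ i, 0 < i → Subsingleton (deg i)
  d {i j : ℤ} (h : i + 1 = j) : deg i →ₗ[R] deg j
  d_d : ∀ {i j l : ℤ} (h : i + 1 = j) (h' : j + 1 = l) (x : deg i), d h' (d h x) = 0
  mul {i j n : ℤ} (h : i + j = n) : deg i →ₗ[R] deg j →ₗ[R] deg n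
  one : deg 0
  one_mul : ∀ {i : ℤ} (h : 0 + i = i) (x : deg i), mul h one x = x
  mul_comm : ∀ {i j n : ℤ} (h : i + j = n) (h' : j + i = n) (x : deg i) (y : deg j),
    mul h x y = (i * j).negOnePow • mul h' y x
  mul_assoc : ∀ {i j l m m' n : ℤ} (h₁ : i + j = m) (h₂ : m + l = n) (h₃ : j + l = m')
    (h₄ : i + m' = n) (x : deg i) (y : deg j) (z : deg l),
    mul h₂ (mul h₁ x y) z = mul h₄ x (mul h₃ y z)
  leibniz : ∀ {i j n i' j' n' : ℤ} (h : i + j = n) (hn : n + 1 = n') (hi : i + 1 = i')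
    (hj : j + 1 = j') (h₁ : i' + j = n') (h₂ : i + j' = n') (x : deg i) (y : deg j),
    d hn (mul h x y) = mul h₁ (d hi x) y + i.negOnePow • mul h₂ x (d hj y)
  nabla (θ : Derivation k R R) {i : ℤ} : deg i →+ deg i
  nabla_add : ∀ (θ η : Derivation k R R) {i : ℤ} (x : deg i),
    nabla (θ + η) x = nabla θ x + nabla η x
  nabla_smul : ∀ (r : R) (θ : Derivation k R R) {i : ℤ} (x : deg i),
    nabla (r • θ) x = r • nabla θ x
  nabla_leibniz : ∀ (θ : Derivation k R R) (r : R) {i : ℤ} (x : deg i),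
    nabla θ (r • x) = θ r • x + r • nabla θ x
  nabla_lie : ∀ (θ η : Derivation k R R) {i : ℤ} (x : deg i),
    nabla ⁅θ, η⁆ x = nabla θ (nabla η x) - nabla η (nabla θ x)
  nabla_mul : ∀ (θ : Derivation k R R) {i j n : ℤ} (h : i + j = n) (x : deg i) (y : deg j),
    nabla θ (mul h x y) = mul h (nabla θ x) y + mul h x (nabla θ y)
  nabla_d : ∀ (θ : Derivation k R R) {i j : ℤ} (h : i + 1 = j) (x : deg i),
    nabla θ (d h x) = d h (nabla θ x)

attribute [instance] DAlg.addCommGroup DAlg.module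

namespace DAlg

section Basic

variable {k R S : Type u} [CommRing k] [CommRing R] [Algebra k R] [CommRing S] [Algebra k S]

/-- The degree zero part is a commutative ring. -/
instance commRing (A : DAlg k R) : CommRing (A.deg 0) where
  __ := A.addCommGroup 0
  mul x y := A.mul (by ring) x y
  one := A.one
  mul_assoc x y z := A.mul_assoc _ _ _ _ x y z
  one_mul x := A.one_mul _ x
  mul_one x := by
    change A.mul _ x A.one = x
    rw [A.mul_comm _ (by ring)]
    simp [A.one_mul]
  mul_comm x y := by
    change A.mul _ x y = A.mul _ y x
    rw [A.mul_comm _ (by ring)]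
    simp
  left_distrib x y z := map_add (A.mul (by ring) x) y z
  right_distrib x y z := LinearMap.map_add₂ (A.mul (by ring)) x y z
  zero_mul x := LinearMap.map_zero₂ (A.mul (by ring)) x
  mul_zero x := map_zero (A.mul (by ring) x)

/-- A map of dg `D`-algebras lying over a ring homomorphism `φ : R → S`. For `φ = id` this is a
morphism of dg `D`-algebras over `R`; for `φ` the restriction of functions to a smaller open set
it is a restriction map. The last field is `D`-linearity. -/
structure Hom (φ : R →+* S) (A : DAlg k R) (B : DAlg k S) where
  app (i : ℤ) : A.deg i →ₛₗ[φ] B.deg i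
  map_d : ∀ {i j : ℤ} (h : i + 1 = j) (x : A.deg i), app j (A.d h x) = B.d h (app i x)
  map_mul : ∀ {i j n : ℤ} (h : i + j = n) (x : A.deg i) (y : A.deg j),
    app n (A.mul h x y) = B.mul h (app i x) (app j y)
  map_one : app 0 A.one = B.one
  map_nabla : ∀ (θ : Derivation k R R) (η : Derivation k S S), (∀ r, η (φ r) = φ (θ r)) →
    ∀ (i : ℤ) (x : A.deg i), app i (A.nabla θ x) = B.nabla η (app i x)

namespace Hom

@[ext]
theorem ext {φ : R →+* S} {A : DAlg k R} {B : DAlg k S} {f g : Hom φ A B}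
    (h : ∀ i x, f.app i x = g.app i x) : f = g := by
  cases f; cases g
  congr
  funext i
  exact LinearMap.ext (h i)

/-- The induced ring homomorphism in degree zero. -/
def ringHom {φ : R →+* S} {A : DAlg k R} {B : DAlg k S} (f : Hom φ A B) :
    A.deg 0 →+* B.deg 0 where
  toFun := f.app 0
  map_one' := f.map_one
  map_mul' x y := f.map_mul _ x y
  map_zero' := map_zero _
  map_add' := map_add _

/-- The identity morphism. -/
def id (A : DAlg k R) : Hom (RingHom.id R) A A where
  app _ := LinearMap.id
  map_d _ _ := rfl
  map_mul _ _ _ := rfl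
  map_one := rfl
  map_nabla θ η h i x := by
    have : η = θ := Derivation.ext h
    rw [this]; rfl

/-- Composition of morphisms over `R`. -/
def comp {A B C : DAlg k R} (f : Hom (RingHom.id R) A B) (g : Hom (RingHom.id R) B C) :
    Hom (RingHom.id R) A C where
  app i := (g.app i).comp (f.app i)
  map_d h x := by simp [f.map_d, g.map_d]
  map_mul h x y := by simp [f.map_mul, g.map_mul]
  map_one := by simp [f.map_one, g.map_one]
  map_nabla θ η h i x := by
    have : η = θ := Derivation.ext h
    subst this
    simp only [LinearMap.comp_apply]
    rw [f.map_nabla η η (fun _ => rfl), g.map_nabla η η (fun _ => rfl)]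

end Hom

/-! ### Cohomology -/

/-- The cocycles of degree `i`. -/
def cocycles (A : DAlg k R) (i : ℤ) : Submodule R (A.deg i) :=
  LinearMap.ker (A.d (rfl : i + 1 = i + 1))

/-- The coboundaries of degree `i`. -/
def boundaries (A : DAlg k R) (i : ℤ) : Submodule R (A.deg i) :=
  LinearMap.range (A.d (sub_add_cancel i 1))

/-- The cohomology module `H^i(A)`. -/
abbrev Coh (A : DAlg k R) (i : ℤ) : Type u :=
  A.cocycles i ⧸ (A.boundaries i).comap (A.cocycles i).subtype

/-- The map induced on cocycles. -/
def Hom.cocyclesMap {φ : R →+* S} {A : DAlg k R} {B : DAlg k S} (f : Hom φ A B) (i : ℤ) :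
    A.cocycles i →ₛₗ[φ] B.cocycles i :=
  (f.app i).restrict (by
    intro x hx
    simp only [cocycles, LinearMap.mem_ker] at hx ⊢
    rw [← f.map_d, hx, map_zero])

/-- The map induced on cohomology. -/
def Hom.cohMap {φ : R →+* S} {A : DAlg k R} {B : DAlg k S} (f : Hom φ A B) (i : ℤ) :
    A.Coh i →ₛₗ[φ] B.Coh i :=
  Submodule.mapQ _ _ (f.cocyclesMap i) (by
    rintro x ⟨y, hy⟩
    refine ⟨f.app _ y, ?_⟩
    rw [← f.map_d, hy]
    rfl)

/-! ### Quotients by dg `D`-ideals -/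

/-- A dg `D`-ideal. -/
structure DIdeal (A : DAlg k R) where
  sub (i : ℤ) : Submodule R (A.deg i)
  mul_mem : ∀ {i j n : ℤ} (h : i + j = n) (x : A.deg i) {y : A.deg j}, y ∈ sub j →
    A.mul h x y ∈ sub n
  d_mem : ∀ {i j : ℤ} (h : i + 1 = j) {x : A.deg i}, x ∈ sub i → A.d h x ∈ sub j
  nabla_mem : ∀ (θ : Derivation k R R) {i : ℤ} {x : A.deg i}, x ∈ sub i → A.nabla θ x ∈ sub i

theorem DIdeal.mul_mem' {A : DAlg k R} (I : A.DIdeal) {i j n : ℤ} (h : i + j = n)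
    {x : A.deg i} (y : A.deg j) (hx : x ∈ I.sub i) : A.mul h x y ∈ I.sub n := by
  rw [A.mul_comm h (by omega), Units.smul_def]
  exact zsmul_mem (I.mul_mem _ y hx) _

/-- The product on the quotient by a dg `D`-ideal. -/
def DIdeal.quotMul {A : DAlg k R} (I : A.DIdeal) {i j n : ℤ} (h : i + j = n) :
    (A.deg i ⧸ I.sub i) →ₗ[R] (A.deg j ⧸ I.sub j) →ₗ[R] (A.deg n ⧸ I.sub n) :=
  Submodule.liftQ _
    { toFun := fun x => Submodule.mapQ _ _ (A.mul h x) (fun _ hy => I.mul_mem h x hy)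
      map_add' := fun x y => by
        refine LinearMap.ext fun z => ?_
        obtain ⟨z, rfl⟩ := Submodule.Quotient.mk_surjective _ z
        simp
      map_smul' := fun r x => by
        refine LinearMap.ext fun z => ?_
        obtain ⟨z, rfl⟩ := Submodule.Quotient.mk_surjective _ z
        simp }
    (by
      intro x hx
      rw [LinearMap.mem_ker]
      refine LinearMap.ext fun z => ?_
      obtain ⟨z, rfl⟩ := Submodule.Quotient.mk_surjective _ z
      exact (Submodule.Quotient.mk_eq_zero _).2 (I.mul_mem' h z hx))

/-- The quotient of a dg `D`-algebra by a dg `D`-ideal. -/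
def quot (A : DAlg k R) (I : A.DIdeal) : DAlg k R where
  deg i := A.deg i ⧸ I.sub i
  subsingleton_of_pos i hi := by
    have := A.subsingleton_of_pos i hi
    infer_instance
  d h := Submodule.mapQ _ _ (A.d h) (fun _ hx => I.d_mem h hx)
  d_d h h' x := by
    obtain ⟨x, rfl⟩ := Submodule.Quotient.mk_surjective _ x
    simp [A.d_d]
  mul h := I.quotMul h
  one := Submodule.Quotient.mk A.one
  one_mul h x := by
    obtain ⟨x, rfl⟩ := Submodule.Quotient.mk_surjective _ x
    exact congrArg _ (A.one_mul h x)
  mul_comm h h' x y := by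
    obtain ⟨x, rfl⟩ := Submodule.Quotient.mk_surjective _ x
    obtain ⟨y, rfl⟩ := Submodule.Quotient.mk_surjective _ y
    exact congrArg (Submodule.Quotient.mk (p := I.sub _)) (A.mul_comm h h' x y)
  mul_assoc h₁ h₂ h₃ h₄ x y z := by
    obtain ⟨x, rfl⟩ := Submodule.Quotient.mk_surjective _ x
    obtain ⟨y, rfl⟩ := Submodule.Quotient.mk_surjective _ y
    obtain ⟨z, rfl⟩ := Submodule.Quotient.mk_surjective _ z
    exact congrArg (Submodule.Quotient.mk (p := I.sub _)) (A.mul_assoc h₁ h₂ h₃ h₄ x y z)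
  leibniz h hn hi hj h₁ h₂ x y := by
    obtain ⟨x, rfl⟩ := Submodule.Quotient.mk_surjective _ x
    obtain ⟨y, rfl⟩ := Submodule.Quotient.mk_surjective _ y
    exact congrArg (Submodule.Quotient.mk (p := I.sub _)) (A.leibniz h hn hi hj h₁ h₂ x y)
  nabla θ {i} := QuotientAddGroup.map (I.sub i).toAddSubgroup (I.sub i).toAddSubgroup (A.nabla θ)
    (fun _ hx => I.nabla_mem θ hx)
  nabla_add θ η {i} x := by
    obtain ⟨x, rfl⟩ := Submodule.Quotient.mk_surjective _ x
    exact congrArg (Submodule.Quotient.mk (p := I.sub _)) (A.nabla_add θ η x)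
  nabla_smul r θ {i} x := by
    obtain ⟨x, rfl⟩ := Submodule.Quotient.mk_surjective _ x
    exact congrArg (Submodule.Quotient.mk (p := I.sub _)) (A.nabla_smul r θ x)
  nabla_leibniz θ r {i} x := by
    obtain ⟨x, rfl⟩ := Submodule.Quotient.mk_surjective _ x
    exact congrArg (Submodule.Quotient.mk (p := I.sub _)) (A.nabla_leibniz θ r x)
  nabla_lie θ η {i} x := by
    obtain ⟨x, rfl⟩ := Submodule.Quotient.mk_surjective _ x
    exact congrArg (Submodule.Quotient.mk (p := I.sub _)) (A.nabla_lie θ η x)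
  nabla_mul θ {i j n} h x y := by
    obtain ⟨x, rfl⟩ := Submodule.Quotient.mk_surjective _ x
    obtain ⟨y, rfl⟩ := Submodule.Quotient.mk_surjective _ y
    exact congrArg (Submodule.Quotient.mk (p := I.sub _)) (A.nabla_mul θ h x y)
  nabla_d θ {i j} h x := by
    obtain ⟨x, rfl⟩ := Submodule.Quotient.mk_surjective _ x
    exact congrArg (Submodule.Quotient.mk (p := I.sub _)) (A.nabla_d θ h x)

/-- The projection to a quotient. -/
def toQuot (A : DAlg k R) (I : A.DIdeal) : Hom (RingHom.id R) A (A.quot I) where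
  app i := (I.sub i).mkQ
  map_d _ _ := rfl
  map_mul _ _ _ := rfl
  map_one := rfl
  map_nabla θ η h i x := by
    have : η = θ := Derivation.ext h
    rw [this]; rfl

/-- The morphism out of a quotient. -/
def Hom.quotDesc {A B : DAlg k R} (f : Hom (RingHom.id R) A B) (I : A.DIdeal)
    (hf : ∀ i x, x ∈ I.sub i → f.app i x = 0) : Hom (RingHom.id R) (A.quot I) B where
  app i := (I.sub i).liftQ (f.app i) (hf i)
  map_d h x := by
    obtain ⟨x, rfl⟩ := Submodule.Quotient.mk_surjective _ x
    exact f.map_d h x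
  map_mul h x y := by
    obtain ⟨x, rfl⟩ := Submodule.Quotient.mk_surjective _ x
    obtain ⟨y, rfl⟩ := Submodule.Quotient.mk_surjective _ y
    exact f.map_mul h x y
  map_one := f.map_one
  map_nabla θ η h i x := by
    obtain ⟨x, rfl⟩ := Submodule.Quotient.mk_surjective _ x
    exact f.map_nabla θ η h i x

/-- The map induced on quotients. -/
def Hom.quotMap {φ : R →+* S} {A : DAlg k R} {B : DAlg k S} (f : Hom φ A B)
    (I : A.DIdeal) (J : B.DIdeal) (hf : ∀ i x, x ∈ I.sub i → f.app i x ∈ J.sub i) :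
    Hom φ (A.quot I) (B.quot J) where
  app i := Submodule.mapQ (I.sub i) (J.sub i) (f.app i) (hf i)
  map_d h x := by
    obtain ⟨x, rfl⟩ := Submodule.Quotient.mk_surjective _ x
    exact congrArg (Submodule.Quotient.mk (p := J.sub _)) (f.map_d h x)
  map_mul h x y := by
    obtain ⟨x, rfl⟩ := Submodule.Quotient.mk_surjective _ x
    obtain ⟨y, rfl⟩ := Submodule.Quotient.mk_surjective _ y
    exact congrArg (Submodule.Quotient.mk (p := J.sub _)) (f.map_mul h x y)
  map_one := congrArg (Submodule.Quotient.mk (p := J.sub _)) f.map_one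
  map_nabla θ η h i x := by
    obtain ⟨x, rfl⟩ := Submodule.Quotient.mk_surjective _ x
    exact congrArg (Submodule.Quotient.mk (p := J.sub _)) (f.map_nabla θ η h i x)

/-- The kernel of `A → H^0(A) = A^0 / d A^{-1}`: everything in negative degrees, and the
coboundaries in degree zero. -/
def trunc (A : DAlg k R) : A.DIdeal where
  sub i := if i < 0 then ⊤ else A.boundaries i
  mul_mem {i j n} h x y hy := by
    split_ifs with hn
    · trivial
    · rcases lt_or_ge 0 i with hi | hi
      · have := A.subsingleton_of_pos i hi
        rw [Subsingleton.elim x 0]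
        simp
      · rw [if_neg (by omega)] at hy
        obtain ⟨z, rfl⟩ := hy
        rcases lt_or_ge 0 j with hj | hj
        · have := A.subsingleton_of_pos j hj
          rw [Subsingleton.elim (A.d _ z) 0]
          simp
        · refine ⟨A.mul (by omega) x z, ?_⟩
          have := A.subsingleton_of_pos (i + 1) (by omega)
          rw [A.leibniz _ _ (rfl : i + 1 = i + 1) (sub_add_cancel j 1) (by omega) h,
            Subsingleton.elim (A.d (rfl : i + 1 = i + 1) x) 0]
          have hi0 : i = 0 := by omega
          subst hi0
          simp
  d_mem {i j} h x hx := by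
    split_ifs with hj
    · trivial
    · obtain rfl : i = j - 1 := by omega
      exact ⟨x, rfl⟩
  nabla_mem θ {i} x hx := by
    split_ifs with hi
    · trivial
    · rw [if_neg hi] at hx
      obtain ⟨y, rfl⟩ := hx
      exact ⟨A.nabla θ y, (A.nabla_d θ _ y).symm⟩

/-- The discrete `D`-algebra `H^0(A) = A^0 / d A^{-1}`. -/
abbrev H0 (A : DAlg k R) : DAlg k R := A.quot A.trunc

theorem Hom.map_trunc {φ : R →+* S} {A : DAlg k R} {B : DAlg k S} (f : Hom φ A B) (i : ℤ)
    (x : A.deg i) (hx : x ∈ A.trunc.sub i) : f.app i x ∈ B.trunc.sub i := by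
  simp only [trunc] at hx ⊢
  split_ifs at hx ⊢ with hi
  · trivial
  · obtain ⟨y, rfl⟩ := hx
    exact ⟨f.app _ y, (f.map_d _ y).symm⟩

/-- The induced morphism `H^0(A) → H^0(B)`. -/
abbrev Hom.H0Map {φ : R →+* S} {A : DAlg k R} {B : DAlg k S} (f : Hom φ A B) :
    Hom φ A.H0 B.H0 :=
  f.quotMap A.trunc B.trunc f.map_trunc

theorem mul_mem_cocycles (A : DAlg k R) {i : ℤ} (a : A.deg 0) {x : A.deg i}
    (hx : x ∈ A.cocycles i) : A.mul (zero_add i) a x ∈ A.cocycles i := by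
  have := A.subsingleton_of_pos (0 + 1) (by omega)
  have ha : A.d (rfl : (0 : ℤ) + 1 = 0 + 1) a = 0 := Subsingleton.elim _ _
  rw [cocycles, LinearMap.mem_ker] at hx ⊢
  rw [A.leibniz (zero_add i) rfl rfl rfl (by omega) (by omega), hx, ha]
  simp

theorem mul_mem_boundaries (A : DAlg k R) {i : ℤ} (a : A.deg 0) {x : A.deg i}
    (hx : x ∈ A.boundaries i) : A.mul (zero_add i) a x ∈ A.boundaries i := by
  have := A.subsingleton_of_pos (0 + 1) (by omega)
  have ha : A.d (rfl : (0 : ℤ) + 1 = 0 + 1) a = 0 := Subsingleton.elim _ _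
  obtain ⟨y, rfl⟩ := hx
  refine ⟨A.mul (by omega) a y, ?_⟩
  rw [A.leibniz _ _ rfl (sub_add_cancel i 1) (by omega) (zero_add i), ha]
  simp

/-- Multiplication `A^0 × H^i(A) → H^i(A)`. -/
def zeroCoh (A : DAlg k R) (i : ℤ) : A.deg 0 →ₗ[R] A.Coh i →ₗ[R] A.Coh i where
  toFun a := Submodule.mapQ _ _ ((A.mul (zero_add i) a).restrict (p := A.cocycles i)
      (q := A.cocycles i) (fun _ hx => A.mul_mem_cocycles a hx))
    (fun _ hx => A.mul_mem_boundaries a hx)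
  map_add' a b := by
    refine LinearMap.ext fun z => ?_
    obtain ⟨z, rfl⟩ := Submodule.Quotient.mk_surjective _ z
    refine congrArg (Submodule.Quotient.mk (p := (A.boundaries i).comap (A.cocycles i).subtype))
      (Subtype.ext ?_)
    simp [LinearMap.restrict_apply]
  map_smul' r a := by
    refine LinearMap.ext fun z => ?_
    obtain ⟨z, rfl⟩ := Submodule.Quotient.mk_surjective _ z
    refine congrArg (Submodule.Quotient.mk (p := (A.boundaries i).comap (A.cocycles i).subtype))
      (Subtype.ext ?_)
    simp [LinearMap.restrict_apply]

/-- Multiplication `H^0(A) × H^i(A) → H^i(A)`. -/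
def H0Coh (A : DAlg k R) (i : ℤ) : A.H0.deg 0 →ₗ[R] A.Coh i →ₗ[R] A.Coh i :=
  Submodule.liftQ (A.trunc.sub 0) (A.zeroCoh i) (by
    intro a ha
    obtain ⟨b, rfl⟩ : a ∈ A.boundaries 0 := by simpa [trunc] using ha
    rw [LinearMap.mem_ker]
    refine LinearMap.ext fun z => ?_
    obtain ⟨⟨z, hz⟩, rfl⟩ := Submodule.Quotient.mk_surjective _ z
    refine (Submodule.Quotient.mk_eq_zero _).2 ?_
    refine ⟨A.mul (by omega) b z, ?_⟩
    rw [A.leibniz _ _ (sub_add_cancel 0 1) (rfl : i + 1 = i + 1) (zero_add i) (by omega)]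
    rw [cocycles, LinearMap.mem_ker] at hz
    rw [hz]
    simp [LinearMap.restrict_apply])

/-- `H^i(A)` is a module over the ring `H^0(A)`. -/
instance cohModule (A : DAlg k R) (i : ℤ) : Module (A.H0.deg 0) (A.Coh i) where
  smul a x := A.H0Coh i a x
  one_smul x := by
    obtain ⟨x, rfl⟩ := Submodule.Quotient.mk_surjective _ x
    exact congrArg (Submodule.Quotient.mk (p := (A.boundaries i).comap (A.cocycles i).subtype))
      (Subtype.ext (A.one_mul _ x.1))
  mul_smul a b x := by
    obtain ⟨a, rfl⟩ := Submodule.Quotient.mk_surjective _ a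
    obtain ⟨b, rfl⟩ := Submodule.Quotient.mk_surjective _ b
    obtain ⟨x, rfl⟩ := Submodule.Quotient.mk_surjective _ x
    exact congrArg (Submodule.Quotient.mk (p := (A.boundaries i).comap (A.cocycles i).subtype))
      (Subtype.ext (A.mul_assoc _ _ _ _ a b x.1))
  smul_zero a := map_zero (A.H0Coh i a)
  smul_add a := map_add (A.H0Coh i a)
  add_smul a b x := LinearMap.map_add₂ (A.H0Coh i) a b x
  zero_smul x := LinearMap.map_zero₂ (A.H0Coh i) x

/-- The map `H^i(A) → H^i(B)` is linear over the ring homomorphism `H^0(A) → H^0(B)`. -/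
def Hom.cohMapH0 {φ : R →+* S} {A : DAlg k R} {B : DAlg k S} (f : Hom φ A B) (i : ℤ) :
    A.Coh i →ₛₗ[f.H0Map.ringHom] B.Coh i where
  toFun := f.cohMap i
  map_add' := map_add _
  map_smul' a x := by
    obtain ⟨a, rfl⟩ := Submodule.Quotient.mk_surjective _ a
    obtain ⟨x, rfl⟩ := Submodule.Quotient.mk_surjective _ x
    exact congrArg (Submodule.Quotient.mk (p := (B.boundaries i).comap (B.cocycles i).subtype))
      (Subtype.ext (f.map_mul _ a x.1))

end Basic

/-! ### Modules, tensor products and K-flatness -/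

section Modules

variable {k R : Type u} [CommRing k] [CommRing R] [Algebra k R]

/-- A differential graded module over (the dg algebra underlying) `A`. -/
structure DGMod (A : DAlg k R) where
  deg : ℤ → Type u
  [addCommGroup : ∀ i, AddCommGroup (deg i)]
  [module : ∀ i, Module R (deg i)]
  d {i j : ℤ} (h : i + 1 = j) : deg i →ₗ[R] deg j
  d_d : ∀ {i j l : ℤ} (h : i + 1 = j) (h' : j + 1 = l) (x : deg i), d h' (d h x) = 0
  act {i j n : ℤ} (h : i + j = n) : A.deg i →ₗ[R] deg j →ₗ[R] deg n
  one_act : ∀ {i : ℤ} (h : 0 + i = i) (x : deg i), act h A.one x = x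
  mul_act : ∀ {i j l m m' n : ℤ} (h₁ : i + j = m) (h₂ : m + l = n) (h₃ : j + l = m')
    (h₄ : i + m' = n) (a : A.deg i) (b : A.deg j) (x : deg l),
    act h₂ (A.mul h₁ a b) x = act h₄ a (act h₃ b x)
  leibniz : ∀ {i j n i' j' n' : ℤ} (h : i + j = n) (hn : n + 1 = n') (hi : i + 1 = i')
    (hj : j + 1 = j') (h₁ : i' + j = n') (h₂ : i + j' = n') (a : A.deg i) (x : deg j),
    d hn (act h a x) = act h₁ (A.d hi a) x + i.negOnePow • act h₂ a (d hj x)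

attribute [instance] DGMod.addCommGroup DGMod.module

/-- A dg module is acyclic if its cohomology vanishes. -/
def DGMod.IsAcyclic {A : DAlg k R} (N : DGMod A) : Prop :=
  ∀ {i j l : ℤ} (h : i + 1 = j) (h' : j + 1 = l) (y : N.deg j), N.d h' y = 0 →
    ∃ x, N.d h x = y

variable {A Q : DAlg k R} (f : Hom (RingHom.id R) A Q) (N : DGMod A)

/-- The degree `n` part of `Q ⊗_R N`. -/
abbrev PreTensor (Q : DAlg k R) {A : DAlg k R} (N : DGMod A) (n : ℤ) : Type u :=
  ⨁ p : {p : ℤ × ℤ // p.1 + p.2 = n}, (Q.deg p.1.1 ⊗[R] N.deg p.1.2)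

/-- Homogeneous pure tensors. -/
def tmul (Q : DAlg k R) {A : DAlg k R} (N : DGMod A) {i j n : ℤ} (h : i + j = n) :
    Q.deg i →ₗ[R] N.deg j →ₗ[R] PreTensor Q N n :=
  (TensorProduct.mk R (Q.deg i) (N.deg j)).compr₂
    (DirectSum.lof R {p : ℤ × ℤ // p.1 + p.2 = n}
      (fun p => (Q.deg p.1.1 ⊗[R] N.deg p.1.2)) ⟨(i, j), h⟩)

/-- The differential `d (q ⊗ x) = d q ⊗ x + (-1)^{|q|} q ⊗ d x` on `Q ⊗_R N`. -/
def preD (Q : DAlg k R) {A : DAlg k R} (N : DGMod A) {n n' : ℤ} (h : n + 1 = n') :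
    PreTensor Q N n →ₗ[R] PreTensor Q N n' :=
  DirectSum.toModule R _ _ fun p => TensorProduct.lift
    ((tmul Q N (i := p.1.1 + 1) (j := p.1.2) (n := n') (by have := p.2; omega)).comp (Q.d rfl) +
      (p.1.1.negOnePow : ℤ) •
        (tmul Q N (i := p.1.1) (j := p.1.2 + 1) (n := n') (by have := p.2; omega)).compl₂ (N.d rfl))

theorem preD_tmul (Q : DAlg k R) {A : DAlg k R} (N : DGMod A) {i j n i' j' n' : ℤ}
    (h : i + j = n) (hn : n + 1 = n') (hi : i + 1 = i') (hj : j + 1 = j')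
    (h₁ : i' + j = n') (h₂ : i + j' = n') (q : Q.deg i) (x : N.deg j) :
    preD Q N hn (tmul Q N h q x) =
      tmul Q N h₁ (Q.d hi q) x + i.negOnePow • tmul Q N h₂ q (N.d hj x) := by
  subst hi hj
  simp only [preD, tmul, LinearMap.compr₂_apply, TensorProduct.mk_apply, DirectSum.toModule_lof,
    TensorProduct.lift.tmul, LinearMap.add_apply, LinearMap.comp_apply, LinearMap.smul_apply,
    LinearMap.compl₂_apply, Units.smul_def]

/-- The relations `q a ⊗ x = q ⊗ a x` that define `Q ⊗_A N` as a quotient of `Q ⊗_R N`. -/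
def tensorRel (n : ℤ) : Submodule R (PreTensor Q N n) :=
  Submodule.span R {z | ∃ (i m j l l' : ℤ) (h₁ : i + m = l) (h₂ : l + j = n) (h₃ : m + j = l')
    (h₄ : i + l' = n) (q : Q.deg i) (a : A.deg m) (x : N.deg j),
    z = tmul Q N h₂ (Q.mul h₁ q (f.app m a)) x - tmul Q N h₄ q (N.act h₃ a x)}

theorem preD_mem_tensorRel {n n' : ℤ} (hn : n + 1 = n') :
    tensorRel f N n ≤ (tensorRel f N n').comap (preD Q N hn) := by
  rw [tensorRel, Submodule.span_le]
  rintro _ ⟨i, m, j, l, l', h₁, h₂, h₃, h₄, q, a, x, rfl⟩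
  have key : preD Q N hn (tmul Q N h₂ (Q.mul h₁ q (f.app m a)) x
        - tmul Q N h₄ q (N.act h₃ a x)) =
      (tmul Q N (i := l + 1) (j := j) (by omega)
          (Q.mul (i := i + 1) (j := m) (by omega) (Q.d rfl q) (f.app m a)) x
        - tmul Q N (i := i + 1) (j := l') (by omega) (Q.d rfl q) (N.act h₃ a x))
      + i.negOnePow • (tmul Q N (i := l + 1) (j := j) (by omega)
          (Q.mul (i := i) (j := m + 1) (by omega) q (f.app (m + 1) (A.d rfl a))) x
        - tmul Q N (i := i) (j := l' + 1) (by omega) q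
          (N.act (i := m + 1) (j := j) (by omega) (A.d rfl a) x))
      + l.negOnePow • (tmul Q N (i := l) (j := j + 1) (by omega)
          (Q.mul h₁ q (f.app m a)) (N.d rfl x)
        - tmul Q N (i := i) (j := l' + 1) (by omega) q
          (N.act (i := m) (j := j + 1) (by omega) a (N.d rfl x))) := by
    rw [map_sub, preD_tmul Q N h₂ hn rfl rfl (by omega) (by omega),
      preD_tmul Q N h₄ hn rfl rfl (by omega) (by omega),
      Q.leibniz h₁ rfl rfl rfl (by omega) (by omega),
      N.leibniz h₃ rfl rfl rfl (by omega) (by omega), f.map_d]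
    subst h₁
    simp only [Int.negOnePow_add, map_add, LinearMap.add_apply, smul_sub, mul_smul, Units.smul_def,
      map_zsmul, LinearMap.smul_apply, smul_add]
    abel
  rw [SetLike.mem_coe, Submodule.mem_comap, key, Units.smul_def, Units.smul_def]
  refine add_mem (add_mem ?_ (zsmul_mem ?_ _)) (zsmul_mem ?_ _)
  · exact Submodule.subset_span ⟨i + 1, m, j, l + 1, l', _, _, h₃, _, _, _, _, rfl⟩
  · exact Submodule.subset_span ⟨i, m + 1, j, l + 1, l' + 1, _, _, _, _, _, _, _, rfl⟩
  · exact Submodule.subset_span ⟨i, m, j + 1, l, l' + 1, h₁, _, _, _, _, _, _, rfl⟩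

/-- The degree `n` part of `Q ⊗_A N`. -/
abbrev Tensor (n : ℤ) : Type u := PreTensor Q N n ⧸ tensorRel f N n

/-- The differential of `Q ⊗_A N`. -/
def tensorD {n n' : ℤ} (hn : n + 1 = n') : Tensor f N n →ₗ[R] Tensor f N n' :=
  Submodule.mapQ _ _ (preD Q N hn) (preD_mem_tensorRel f N hn)

/-- `Q` is K-flat over `A`: the functor `Q ⊗_A -` preserves acyclic dg modules. -/
def IsKFlat {A Q : DAlg k R} (f : Hom (RingHom.id R) A Q) : Prop :=
  ∀ N : DGMod A, N.IsAcyclic → ∀ {i j l : ℤ} (h : i + 1 = j) (h' : j + 1 = l)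
    (y : Tensor f N j), tensorD f N h' y = 0 → ∃ x, tensorD f N h x = y

/-- The dg `D`-ideal of `Q` generated by the image of a dg `D`-ideal of `A`. -/
def Hom.ideal (I : A.DIdeal) : Q.DIdeal where
  sub n := Submodule.span R {z | ∃ (i j : ℤ) (h : i + j = n) (a : A.deg i) (q : Q.deg j),
    a ∈ I.sub i ∧ z = Q.mul h (f.app i a) q}
  mul_mem {i j n} h x y hy := by
    induction hy using Submodule.span_induction with
    | mem z hz =>
      obtain ⟨i', j', h', a, q, ha, rfl⟩ := hz
      refine Submodule.subset_span ⟨i', i + j', by omega, a,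
        (i * i').negOnePow • Q.mul rfl x q, ha, ?_⟩
      rw [← Q.mul_assoc (m := i + i') rfl (by omega) h' h x, Q.mul_comm rfl (add_comm i' i) x,
        Units.smul_def, Units.smul_def, map_zsmul, map_zsmul, LinearMap.smul_apply,
        Q.mul_assoc (m' := i + j') _ _ rfl (by omega)]
    | zero => rw [map_zero]; exact zero_mem _
    | add z w _ _ hz hw => rw [map_add]; exact add_mem hz hw
    | smul r z _ hz => rw [map_smul]; exact Submodule.smul_mem _ _ hz
  d_mem {i j} h y hy := by
    induction hy using Submodule.span_induction with
    | mem z hz =>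
      obtain ⟨i', j', h', a, q, ha, rfl⟩ := hz
      rw [Q.leibniz h' h rfl rfl (by omega) (by omega), ← f.map_d, Units.smul_def]
      refine add_mem (Submodule.subset_span ?_) (zsmul_mem (Submodule.subset_span ?_) _)
      · exact ⟨_, _, _, _, _, I.d_mem _ ha, rfl⟩
      · exact ⟨_, _, _, _, _, ha, rfl⟩
    | zero => rw [map_zero]; exact zero_mem _
    | add z w _ _ hz hw => rw [map_add]; exact add_mem hz hw
    | smul r z _ hz => rw [map_smul]; exact Submodule.smul_mem _ _ hz
  nabla_mem θ {i} y hy := by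
    induction hy using Submodule.span_induction with
    | mem z hz =>
      obtain ⟨i', j', h', a, q, ha, rfl⟩ := hz
      rw [Q.nabla_mul, ← f.map_nabla θ θ (fun _ => rfl)]
      refine add_mem (Submodule.subset_span ?_) (Submodule.subset_span ?_)
      · exact ⟨_, _, _, _, _, I.nabla_mem θ ha, rfl⟩
      · exact ⟨_, _, _, _, _, ha, rfl⟩
    | zero => rw [map_zero]; exact zero_mem _
    | add z w _ _ hz hw => rw [map_add]; exact add_mem hz hw
    | smul r z hz' hz =>
      rw [Q.nabla_leibniz]
      exact add_mem (Submodule.smul_mem _ _ hz') (Submodule.smul_mem _ _ hz)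

end Modules

end DAlg

/-! ## Derived D-algebras on a smooth variety -/

section Global

/-- The functions on an open subset of a `k`-scheme form a `k`-algebra. -/
instance sectionsAlgebra (k : Type u) [Field k] (X : Scheme.{u}) [X.Over (Spec (.of k))]
    (U : X.Opens) : Algebra k Γ(X, U) :=
  ((Scheme.ΓSpecIso (.of k)).inv ≫ (X ↘ Spec (.of k)).appTop ≫
    X.presheaf.map (homOfLE le_top).op).hom.toAlgebra

/-- Restriction of functions. -/
abbrev restr {X : Scheme.{u}} {U V : X.affineOpens} (h : V ≤ U) : Γ(X, U.1) →+* Γ(X, V.1) :=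
  (X.presheaf.map (homOfLE (show V.1 ≤ U.1 from h)).op).hom

theorem exists_restr_eq {X : Scheme.{u}} {U V : X.affineOpens} (h : V ≤ U) (f : Γ(X, U.1))
    (hf : V.1 = X.basicOpen f) (r : Γ(X, V.1)) :
    ∃ (n : ℕ) (r' : Γ(X, U.1)), restr h r' = restr h f ^ n * r := by
  obtain ⟨V, hV⟩ := V
  obtain rfl : V = X.basicOpen f := hf
  have := U.2.isLocalization_basicOpen f
  obtain ⟨⟨r', ⟨_, n, rfl⟩⟩, e⟩ := IsLocalization.surj (Submonoid.powers f) r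
  refine ⟨n, r', ?_⟩
  rw [mul_comm, ← map_pow]
  exact e.symm

/-- A sheaf of connective commutative dg `D_X`-algebras on the smooth `k`-scheme `X`, with
quasi-coherent terms. As usual, quasi-coherent sheaves are given by their sections over
the affine open subsets: the restriction from an affine `U` to `D(f)` is the
localization at `f` (fields `res_torsion` and `res_surj`). -/
structure DGDAlgebra (k : Type u) [Field k] (X : Scheme.{u}) [X.Over (Spec (.of k))] where
  obj (U : X.affineOpens) : DAlg k Γ(X, U.1)
  res {U V : X.affineOpens} (h : V ≤ U) : DAlg.Hom (restr h) (obj U) (obj V)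
  res_refl : ∀ (U : X.affineOpens) (i : ℤ) (x : (obj U).deg i), (res (le_refl U)).app i x = x
  res_res : ∀ {U V W : X.affineOpens} (h : V ≤ U) (h' : W ≤ V) (i : ℤ) (x : (obj U).deg i),
    (res h').app i ((res h).app i x) = (res (h'.trans h)).app i x
  res_torsion : ∀ {U V : X.affineOpens} (h : V ≤ U) (f : Γ(X, U.1)), V.1 = X.basicOpen f →
    ∀ (i : ℤ) (x : (obj U).deg i), (res h).app i x = 0 → ∃ n : ℕ, f ^ n • x = 0
  res_surj : ∀ {U V : X.affineOpens} (h : V ≤ U) (f : Γ(X, U.1)), V.1 = X.basicOpen f →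
    ∀ (i : ℤ) (y : (obj V).deg i), ∃ (n : ℕ) (x : (obj U).deg i),
      (res h).app i x = restr h f ^ n • y

namespace DGDAlgebra

variable {k : Type u} [Field k] {X : Scheme.{u}} [X.Over (Spec (.of k))]

/-- A morphism of dg `D_X`-algebras. -/
@[ext]
structure Hom (A B : DGDAlgebra k X) where
  app (U : X.affineOpens) : DAlg.Hom (RingHom.id _) (A.obj U) (B.obj U)
  naturality : ∀ {U V : X.affineOpens} (h : V ≤ U) (i : ℤ) (x : (A.obj U).deg i),
    (app V).app i ((A.res h).app i x) = (B.res h).app i ((app U).app i x)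

instance : Category (DGDAlgebra k X) where
  Hom := Hom
  id A := { app := fun U => DAlg.Hom.id (A.obj U), naturality := fun _ _ _ => rfl }
  comp f g :=
    { app := fun U => (f.app U).comp (g.app U)
      naturality := fun {U V} h i x => by
        change (g.app V).app i ((f.app V).app i _) = _
        rw [f.naturality, g.naturality]
        rfl }

/-- A quasi-coherent dg `D_X`-ideal. -/
structure DIdeal (A : DGDAlgebra k X) where
  obj (U : X.affineOpens) : (A.obj U).DIdeal
  res_mem : ∀ {U V : X.affineOpens} (h : V ≤ U) (i : ℤ) (x : (A.obj U).deg i),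
    x ∈ (obj U).sub i → (A.res h).app i x ∈ (obj V).sub i
  res_surj : ∀ {U V : X.affineOpens} (h : V ≤ U) (f : Γ(X, U.1)), V.1 = X.basicOpen f →
    ∀ (i : ℤ) (y : (A.obj V).deg i), y ∈ (obj V).sub i →
      ∃ (n : ℕ) (x : (A.obj U).deg i), x ∈ (obj U).sub i ∧ (A.res h).app i x = restr h f ^ n • y

/-- The quotient of a dg `D_X`-algebra by a dg `D_X`-ideal. -/
def quot (A : DGDAlgebra k X) (I : A.DIdeal) : DGDAlgebra k X where
  obj U := (A.obj U).quot (I.obj U)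
  res h := (A.res h).quotMap _ _ (I.res_mem h)
  res_refl U i x := by
    obtain ⟨x, rfl⟩ := Submodule.Quotient.mk_surjective _ x
    exact congrArg (Submodule.Quotient.mk (p := (I.obj U).sub i)) (A.res_refl U i x)
  res_res {U V W} h h' i x := by
    obtain ⟨x, rfl⟩ := Submodule.Quotient.mk_surjective _ x
    exact congrArg (Submodule.Quotient.mk (p := (I.obj W).sub i)) (A.res_res h h' i x)
  res_torsion {U V} h f hf i x hx := by
    obtain ⟨x, rfl⟩ := Submodule.Quotient.mk_surjective _ x
    have hx' : (A.res h).app i x ∈ (I.obj V).sub i := (Submodule.Quotient.mk_eq_zero _).1 hx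
    obtain ⟨n, z, hz, e⟩ := I.res_surj h f hf i _ hx'
    obtain ⟨m, hm⟩ := A.res_torsion h f hf i (f ^ n • x - z) (by
      rw [map_sub, e, LinearMap.map_smulₛₗ, map_pow, sub_self])
    refine ⟨m + n, (Submodule.Quotient.mk_eq_zero _).2 ?_⟩
    rw [smul_sub, sub_eq_zero, ← mul_smul, ← pow_add] at hm
    change f ^ (m + n) • x ∈ _
    rw [hm]
    exact Submodule.smul_mem _ _ hz
  res_surj {U V} h f hf i y := by
    obtain ⟨y, rfl⟩ := Submodule.Quotient.mk_surjective _ y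
    obtain ⟨n, x, e⟩ := A.res_surj h f hf i y
    exact ⟨n, Submodule.Quotient.mk x, congrArg (Submodule.Quotient.mk (p := (I.obj V).sub i)) e⟩

/-- The projection to a quotient. -/
def toQuot (A : DGDAlgebra k X) (I : A.DIdeal) : A ⟶ A.quot I where
  app U := (A.obj U).toQuot (I.obj U)
  naturality _ _ _ := rfl

/-- The morphism out of a quotient. -/
def Hom.quotDesc {A B : DGDAlgebra k X} (f : A ⟶ B) (I : A.DIdeal)
    (hf : ∀ U i x, x ∈ (I.obj U).sub i → (f.app U).app i x = 0) : A.quot I ⟶ B where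
  app U := (f.app U).quotDesc _ (hf U)
  naturality {U V} h i x := by
    obtain ⟨x, rfl⟩ := Submodule.Quotient.mk_surjective _ x
    exact f.naturality h i x

/-- The morphism induced on quotients. -/
def Hom.quotMap {A B : DGDAlgebra k X} (f : A ⟶ B) (I : A.DIdeal) (J : B.DIdeal)
    (hf : ∀ U i x, x ∈ (I.obj U).sub i → (f.app U).app i x ∈ (J.obj U).sub i) :
    A.quot I ⟶ B.quot J where
  app U := (f.app U).quotMap _ _ (hf U)
  naturality {U V} h i x := by
    obtain ⟨x, rfl⟩ := Submodule.Quotient.mk_surjective _ x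
    exact congrArg (Submodule.Quotient.mk (p := (J.obj V).sub i)) (f.naturality h i x)

/-- The kernel of `A → H^0(A)`. -/
def trunc (A : DGDAlgebra k X) : A.DIdeal where
  obj U := (A.obj U).trunc
  res_mem h i x hx := (A.res h).map_trunc i x hx
  res_surj {U V} h f hf i y hy := by
    simp only [DAlg.trunc] at hy ⊢
    split_ifs at hy ⊢ with hi
    · obtain ⟨n, x, e⟩ := A.res_surj h f hf i y
      exact ⟨n, x, trivial, e⟩
    · obtain ⟨z, rfl⟩ := hy
      obtain ⟨n, x, e⟩ := A.res_surj h f hf _ z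
      refine ⟨n, (A.obj U).d _ x, ⟨x, rfl⟩, ?_⟩
      rw [(A.res h).map_d, e, map_smul]

/-- The discrete `D_X`-algebra `H^0(A)`. -/
def H0 (A : DGDAlgebra k X) : DGDAlgebra k X := A.quot A.trunc

/-- The dg `D_X`-ideal of `B` generated by the image of a dg `D_X`-ideal of `A`. -/
def Hom.ideal {A B : DGDAlgebra k X} (f : A ⟶ B) (I : A.DIdeal) : B.DIdeal where
  obj U := (f.app U).ideal (I.obj U)
  res_mem {U V} h i x hx := by
    induction hx using Submodule.span_induction with
    | mem z hz =>
      obtain ⟨i', j', h', a, q, ha, rfl⟩ := hz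
      rw [(B.res h).map_mul, ← f.naturality]
      exact Submodule.subset_span ⟨_, _, _, _, _, I.res_mem h _ _ ha, rfl⟩
    | zero => rw [map_zero]; exact zero_mem _
    | add z w _ _ hz hw => rw [map_add]; exact add_mem hz hw
    | smul r z _ hz => rw [LinearMap.map_smulₛₗ]; exact Submodule.smul_mem _ _ hz
  res_surj {U V} h g hg i y hy := by
    induction hy using Submodule.span_induction with
    | mem z hz =>
      obtain ⟨i', j', h', a, q, ha, rfl⟩ := hz
      obtain ⟨n, a', ha', ea⟩ := I.res_surj h g hg _ a ha
      obtain ⟨m, q', eq⟩ := B.res_surj h g hg _ q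
      refine ⟨n + m, (B.obj U).mul h' ((f.app U).app i' a') q',
        Submodule.subset_span ⟨_, _, h', a', q', ha', rfl⟩, ?_⟩
      rw [(B.res h).map_mul, ← f.naturality, ea, eq, map_smul, map_smul, map_smul,
        LinearMap.smul_apply, ← mul_smul, add_comm n m, pow_add]
    | zero => exact ⟨0, 0, zero_mem _, by simp⟩
    | add z w _ _ hz hw =>
      obtain ⟨n, x, hx, ex⟩ := hz
      obtain ⟨m, x', hx', ex'⟩ := hw
      refine ⟨n + m, g ^ m • x + g ^ n • x',
        add_mem (Submodule.smul_mem _ _ hx) (Submodule.smul_mem _ _ hx'), ?_⟩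
      rw [map_add, LinearMap.map_smulₛₗ, LinearMap.map_smulₛₗ, ex, ex', map_pow, map_pow,
        ← mul_smul, ← mul_smul, ← pow_add, ← pow_add, add_comm m n, smul_add]
    | smul r z _ hz =>
      obtain ⟨n, x, hx, ex⟩ := hz
      obtain ⟨m, r', er⟩ : ∃ (m : ℕ) (r' : Γ(X, U.1)), restr h r' = restr h g ^ m * r :=
        exists_restr_eq h g hg r
      refine ⟨n + m, r' • x, Submodule.smul_mem _ _ hx, ?_⟩
      rw [LinearMap.map_smulₛₗ, ex, er, ← mul_smul, ← mul_smul, pow_add]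
      congr 1
      ring

/-- The projection `A → H^0(A)`. -/
def toH0 (A : DGDAlgebra k X) : A ⟶ A.H0 := A.toQuot A.trunc

/-- The `H^0(A)`-algebra `B ⊗_A H^0(A)`. Since `A → H^0(A)` is surjective with kernel `A.trunc`,
it is the quotient of `B` by the ideal generated by the image of `A.trunc`; see `isPushout`. -/
def baseChangeH0 {A B : DGDAlgebra k X} (f : A ⟶ B) : Under A.H0 :=
  Under.mk (Hom.quotMap f A.trunc (Hom.ideal f A.trunc) (fun U i x hx =>
    Submodule.subset_span ⟨i, 0, add_zero i, x, (B.obj U).one, hx, by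
      rw [(B.obj U).mul_comm _ (zero_add i), (B.obj U).one_mul]
      simp⟩))

/-- `B ⊗_A H^0(A)` is the pushout of `B` and `H^0(A)` under `A`. -/
theorem isPushout {A B : DGDAlgebra k X} (f : A ⟶ B) :
    IsPushout f A.toH0 (B.toQuot (Hom.ideal f A.trunc)) (baseChangeH0 f).hom := by
  refine ⟨⟨rfl⟩, ⟨Limits.PushoutCocone.IsColimit.mk _
    (fun s => Hom.quotDesc s.inl (Hom.ideal f A.trunc) ?_) (fun s => rfl) (fun s => ?_)
    (fun s m h _ => ?_)⟩⟩
  · intro U i x hx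
    induction hx using Submodule.span_induction with
    | mem z hz =>
      obtain ⟨i', j', h', a, q, ha, rfl⟩ := hz
      have e : (Hom.app s.inl U).app i' ((f.app U).app i' a) =
          (Hom.app s.inr U).app i' ((A.toH0.app U).app i' a) :=
        congrArg (fun g : A ⟶ s.pt => (Hom.app g U).app i' a) s.condition
      have e' : (A.toH0.app U).app i' a = 0 := (Submodule.Quotient.mk_eq_zero _).2 ha
      rw [(Hom.app s.inl U).map_mul, e, e', map_zero, LinearMap.map_zero₂]
    | zero => exact map_zero _
    | add z w _ _ hz hw => rw [map_add, hz, hw, add_zero]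
    | smul r z _ hz => rw [map_smul, hz, smul_zero]
  · refine Hom.ext (funext fun U => DAlg.Hom.ext fun i x => ?_)
    obtain ⟨x, rfl⟩ := Submodule.Quotient.mk_surjective _ x
    exact congrArg (fun g : A ⟶ s.pt => (Hom.app g U).app i x) s.condition
  · refine Hom.ext (funext fun U => DAlg.Hom.ext fun i x => ?_)
    obtain ⟨x, rfl⟩ := Submodule.Quotient.mk_surjective _ x
    exact congrArg (fun g : B ⟶ s.pt => (Hom.app g U).app i x) h

/-- A morphism is a quasi-isomorphism (weak equivalence) if it induces isomorphisms on all
cohomology sheaves. -/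
def IsQuasiIso {A B : DGDAlgebra k X} (f : A ⟶ B) : Prop :=
  ∀ (U : X.affineOpens) (i : ℤ), Function.Bijective ((f.app U).cohMap i)

/-- A resolution of `B` which is flat over `A`: a factorization `A → Q → B` of `f` in dg
`D_X`-algebras, with `Q → B` a quasi-isomorphism and `Q` K-flat over `A`. -/
structure FlatResolution {A B : DGDAlgebra k X} (f : A ⟶ B) where
  alg : DGDAlgebra k X
  ι : A ⟶ alg
  π : alg ⟶ B
  fac : ι ≫ π = f
  quasiIso : IsQuasiIso π
  kFlat : ∀ U : X.affineOpens, DAlg.IsKFlat (ι.app U)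

/-- The derived tensor product `B ⊗^L_A H^0(A)`, that is, `Q ⊗_A H^0(A)` for the flat
resolution `Q` of `B`, as an `H^0(A)`-algebra in dg `D_X`-modules. -/
def FlatResolution.derivedBaseChange {A B : DGDAlgebra k X} {f : A ⟶ B}
    (Q : FlatResolution f) : Under A.H0 :=
  baseChangeH0 Q.ι

/-- Weak equivalence of `S`-algebras in dg `D_X`-modules: being connected by a zigzag of
quasi-isomorphisms of `S`-algebras. -/
def WeaklyEquivalent {S : DGDAlgebra k X} (C C' : Under S) : Prop :=
  Relation.EqvGen (fun C C' : Under S => ∃ g : C ⟶ C', IsQuasiIso g.right) C C'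

/-- An `S`-algebra in dg `D_X`-modules is discrete if it is concentrated in degree `0`. -/
def IsDiscrete {S : DGDAlgebra k X} (C : Under S) : Prop :=
  ∀ (U : X.affineOpens) (i : ℤ), i ≠ 0 → Subsingleton ((C.right.obj U).deg i)

/-- A discrete algebra `C` over a discrete `D_X`-algebra `S` is flat. -/
def IsFlat {S : DGDAlgebra k X} (C : Under S) : Prop :=
  ∀ U : X.affineOpens, ((Hom.app C.hom U).ringHom).Flat

/-- For a ring homomorphism `φ : S → T` and a `φ`-linear map `g : M → N`, the natural map
`T ⊗_S M → N` is an isomorphism. -/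
def IsBaseChangeAlong {S T M N : Type u} [CommRing S] [CommRing T] (φ : S →+* T)
    [AddCommGroup M] [Module S M] [AddCommGroup N] [Module T N] (g : M →ₛₗ[φ] N) : Prop :=
  letI : Algebra S T := φ.toAlgebra
  letI : Module S N := Module.compHom N φ
  haveI : IsScalarTower S T N := ⟨fun s t n => mul_smul (φ s) t n⟩
  IsBaseChange T ({ toFun := g, map_add' := map_add g, map_smul' := g.map_smulₛₗ } : M →ₗ[S] N)

/-- A morphism `A → B` is `D`-flat if `H^0(B)` is flat over `H^0(A)` and the natural maps
`H^0(B) ⊗_{H^0(A)} H^j(A) → H^j(B)` are isomorphisms for all `j`. -/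
def IsDFlat {A B : DGDAlgebra k X} (f : A ⟶ B) : Prop :=
  ∀ U : X.affineOpens, (f.app U).H0Map.ringHom.Flat ∧
    ∀ j : ℤ, IsBaseChangeAlong (f.app U).H0Map.ringHom ((f.app U).cohMapH0 j)

end DGDAlgebra

end Global

end

end DGeom

namespace DGeom

noncomputable section

/-! ## Complexes of modules and their cohomology -/

/-! Everything is local: over an affine open, let `A → Q → B` be the resolution. For a dg `A`-module
`N` there is a natural comparison map `H^0(Q) ⊗_{H^0(A)} H^j(N) → H^j(Q ⊗_A N)` (`comparison`). For
`N = A` it is the map in the definition of `D`-flatness, because `Q → B` is a quasi-isomorphism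
(`isBaseChangeAlong_comp_iff`). For `N = H^0(A)` the source vanishes when `j ≠ 0`, and in degree `0`
the map is always bijective (`comparison_H0_zero`). So bijectivity there in all degrees says that `Q
⊗_A H^0(A)` has cohomology in degree zero only. The theorem amounts to passing between these two
modules.

Suppose `H^0(Q)` is flat over `H^0(A)`. Both sides of the comparison map then turn cones into long
exact sequences, and both commute with direct sums and shifts. K-flatness makes `Q ⊗_A -` preserve
upper bounds on cohomology. The five lemma and descending induction on degree give two dévissages.
First, bijectivity for a generator `E` passes to every bounded above module in the class it
generates, by attaching copies of `E` that kill the top cohomology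
(`comparison_bijective_of_generator`). Second, bijectivity for bounded above modules over `H^0(A)`
implies it for all bounded above modules, by splitting off the top cohomology, which is a module
over `H^0(A)` (`comparison_bijective_of_isTruncated`).

With generator `A`, the first dévissage goes from `A` to `H^0(A)`. With generator `H^0(A)` it
reaches the bounded above modules over `H^0(A)`, and the second then returns to `A`. This is
`flat_and_isBaseChangeAlong_iff`.

It remains to see that `H^0(Q)` and `H^0(Q ⊗_A H^0(A))` agree (`H0Map_toQuot_bijective`), and that
an algebra is weakly equivalent to a discrete flat one exactly when its cohomology is flat and in
degree zero, the discrete model being its `H^0` (`hasFlatCohomology_iff_exists`). -/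

theorem map_negOnePow_smul {M N F : Type*} [AddCommGroup M] [AddCommGroup N] [FunLike F M N]
    [AddMonoidHomClass F M N] (f : F) (s : ℤ) (x : M) :
    f (s.negOnePow • x) = s.negOnePow • f x := by
  rw [Units.smul_def, Units.smul_def, map_zsmul]

/-- A cochain complex of `R`-modules. -/
structure Cpx (R : Type u) [CommRing R] where
  deg : ℤ → Type u
  [addCommGroup : ∀ i, AddCommGroup (deg i)]
  [module : ∀ i, Module R (deg i)]
  d {i j : ℤ} (h : i + 1 = j) : deg i →ₗ[R] deg j
  d_d : ∀ {i j l : ℤ} (h : i + 1 = j) (h' : j + 1 = l) (x : deg i), d h' (d h x) = 0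

attribute [instance] Cpx.addCommGroup Cpx.module

namespace Cpx

variable {R : Type u} [CommRing R]

/-- The cocycles of degree `i`. -/
def Z (C : Cpx R) (i : ℤ) : Submodule R (C.deg i) :=
  LinearMap.ker (C.d (rfl : i + 1 = i + 1))

/-- Degrees are linked by equations such as `i + 1 = j` rather than by literal sums. Restating
membership for any such `j` avoids transport between equal degrees. -/
theorem mem_Z (C : Cpx R) {i j : ℤ} (h : i + 1 = j) {x : C.deg i} :
    x ∈ C.Z i ↔ C.d h x = 0 := by
  subst h; rfl

/-- The coboundaries of degree `i`. -/
def boundaries (C : Cpx R) (i : ℤ) : Submodule R (C.deg i) :=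
  LinearMap.range (C.d (sub_add_cancel i 1))

/-- The cohomology of degree `i`. -/
abbrev H (C : Cpx R) (i : ℤ) : Type u :=
  C.Z i ⧸ (C.boundaries i).comap (C.Z i).subtype

/-- The class of a cocycle. -/
def cls (C : Cpx R) {i : ℤ} (x : C.Z i) : C.H i := Submodule.Quotient.mk x

theorem cls_surjective (C : Cpx R) {i : ℤ} (x : C.H i) : ∃ z, C.cls z = x :=
  Submodule.Quotient.mk_surjective _ x

theorem mem_boundaries (C : Cpx R) {j i : ℤ} (h : j + 1 = i) {x : C.deg i} :
    x ∈ C.boundaries i ↔ ∃ y, C.d h y = x := by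
  obtain rfl : j = i - 1 := by omega
  rfl

theorem cls_eq_zero (C : Cpx R) {j i : ℤ} (h : j + 1 = i) {x : C.Z i} :
    C.cls x = 0 ↔ ∃ y, C.d h y = x.1 := by
  rw [← mem_boundaries]
  exact Submodule.Quotient.mk_eq_zero _

theorem cls_eq (C : Cpx R) {j i : ℤ} (h : j + 1 = i) {x x' : C.Z i} (y : C.deg j)
    (e : x.1 = x'.1 + C.d h y) : C.cls x = C.cls x' := by
  rw [← sub_eq_zero]
  exact (C.cls_eq_zero (x := x - x') h).2 ⟨y, by simp [e]⟩

theorem subsingleton_H (C : Cpx R) {j i : ℤ} (h : j + 1 = i)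
    (hC : ∀ x ∈ C.Z i, ∃ y, C.d h y = x) : Subsingleton (C.H i) := by
  refine subsingleton_of_forall_eq 0 fun x => ?_
  obtain ⟨x, rfl⟩ := C.cls_surjective x
  exact (C.cls_eq_zero h).2 (hC _ x.2)

theorem subsingleton_H_of_deg (C : Cpx R) {i : ℤ} (hC : Subsingleton (C.deg i)) :
    Subsingleton (C.H i) :=
  C.subsingleton_H (sub_add_cancel i 1) fun _ _ => ⟨0, Subsingleton.elim _ _⟩

/-- A closed map of degree `s` between complexes. -/
structure Map (s : ℤ) (C D : Cpx R) where
  app {i j : ℤ} (h : i + s = j) : C.deg i →ₗ[R] D.deg j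
  comm : ∀ {i j i' j' : ℤ} (hi : i + 1 = i') (h : i + s = j) (h' : i' + s = j')
    (hj : j + 1 = j') (x : C.deg i), D.d hj (app h x) = s.negOnePow • app h' (C.d hi x)

namespace Map

variable {C D : Cpx R} {s : ℤ}

theorem mem_Z (g : Map s C D) {i j : ℤ} (h : i + s = j) {x : C.deg i} (hx : x ∈ C.Z i) :
    g.app h x ∈ D.Z j := by
  rw [Cpx.mem_Z _ rfl] at hx ⊢
  rw [g.comm rfl h (by omega) rfl, hx, map_zero, smul_zero]

/-- The map induced on cohomology. -/
def H (g : Map s C D) {i j : ℤ} (h : i + s = j) : C.H i →ₗ[R] D.H j :=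
  Submodule.mapQ _ _ ((g.app h).restrict (p := C.Z i) (q := D.Z j) fun _ hx => g.mem_Z h hx) (by
    rintro ⟨x, hx⟩ hx'
    obtain ⟨y, rfl⟩ := (C.mem_boundaries (sub_add_cancel i 1)).1 hx'
    refine (D.mem_boundaries (sub_add_cancel j 1)).2
      ⟨s.negOnePow • g.app (by omega) y, ?_⟩
    rw [map_negOnePow_smul, g.comm (sub_add_cancel i 1) _ h, smul_smul]
    simp [LinearMap.restrict_apply])

theorem H_cls (g : Map s C D) {i j : ℤ} (h : i + s = j) (x : C.Z i) :
    g.H h (C.cls x) = D.cls ⟨g.app h x, g.mem_Z h x.2⟩ := rfl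

end Map

/-- A distinguished triangle given by a degreewise split short exact sequence: `C` is the cone
of `g : X → Y`, and the projection `p : C → X` has degree one. -/
structure Triangle (X Y C : Cpx R) where
  g : Map 0 X Y
  i : Map 0 Y C
  p : Map 1 C X
  -- The section of `p` is not closed; its defect in `d_s` makes `g` the connecting map. A triangle
  -- is recorded by such identities because an additive dg functor preserves them, whereas it need
  -- not preserve exact sequences.
  s {n m : ℤ} (h : n + 1 = m) : X.deg m →ₗ[R] C.deg n
  i_inj : ∀ {n : ℤ}, Function.Injective (i.app (add_zero n))
  p_i : ∀ {n m : ℤ} (h : n + 1 = m) (y : Y.deg n), p.app h (i.app (add_zero n) y) = 0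
  exact : ∀ {n m : ℤ} (h : n + 1 = m) (c : C.deg n), p.app h c = 0 →
    ∃ y, i.app (add_zero n) y = c
  p_s : ∀ {n m : ℤ} (h : n + 1 = m) (x : X.deg m), p.app h (s h x) = x
  d_s : ∀ {n m l : ℤ} (h : n + 1 = m) (h' : m + 1 = l) (x : X.deg m),
    C.d h (s h x) = i.app (add_zero m) (g.app (add_zero m) x) - s h' (X.d h' x)

/-! ### The long exact cohomology sequence of a triangle. -/

namespace Triangle

variable {X Y C : Cpx R} (t : Triangle X Y C)

theorem d_i {n m : ℤ} (h : n + 1 = m) (y : Y.deg n) :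
    C.d h (t.i.app (add_zero n) y) = t.i.app (add_zero m) (Y.d h y) := by
  simpa using t.i.comm h (add_zero n) (add_zero m) h y

theorem d_p {n m l : ℤ} (h : n + 1 = m) (h' : m + 1 = l) (c : C.deg n) :
    X.d h' (t.p.app h c) = - t.p.app h' (C.d h c) := by
  simpa using t.p.comm h h h' h' c

/-- If `i y = d c`, then `p c` is a cocycle and `c - s (p c) = i y'` for some `y'`. Applying `d`
gives `y = g (p c) + d y'`. Conversely `i (g x) = d (s x)` for a cocycle `x`. -/
theorem exact_Y (n : ℤ) :
    Function.Exact (t.g.H (add_zero n)) (t.i.H (add_zero n)) := by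
  intro y
  obtain ⟨y, rfl⟩ := Y.cls_surjective y
  constructor
  · intro hy
    rw [Map.H_cls, C.cls_eq_zero (sub_add_cancel n 1)] at hy
    obtain ⟨c, hc⟩ := hy
    dsimp only at hc
    have hp : t.p.app (sub_add_cancel n 1) c ∈ X.Z n := by
      rw [X.mem_Z rfl, t.d_p, hc, t.p_i, neg_zero]
    obtain ⟨y', hy'⟩ := t.exact (sub_add_cancel n 1)
      (c - t.s (sub_add_cancel n 1) (t.p.app (sub_add_cancel n 1) c)) (by
        rw [map_sub, t.p_s, sub_self])
    refine ⟨X.cls ⟨_, hp⟩, ?_⟩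
    rw [Map.H_cls]
    refine (Y.cls_eq (sub_add_cancel n 1) y' (t.i_inj ?_)).symm
    rw [map_add, ← t.d_i, hy', map_sub, hc, t.d_s _ rfl, (X.mem_Z rfl).1 hp, map_zero]
    simp
  · rintro ⟨x, hx⟩
    obtain ⟨x, rfl⟩ := X.cls_surjective x
    rw [← hx, Map.H_cls, Map.H_cls, C.cls_eq_zero (sub_add_cancel n 1)]
    refine ⟨t.s (sub_add_cancel n 1) x.1, ?_⟩
    rw [t.d_s _ rfl, (X.mem_Z rfl).1 x.2, map_zero, sub_zero]

/-- If `p c = d x`, then `c + d (s x)` is cohomologous to `c` and is killed by `p`, hence comes from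
`Y`. -/
theorem exact_C {n m : ℤ} (h : n + 1 = m) :
    Function.Exact (t.i.H (add_zero n)) (t.p.H h) := by
  intro c
  obtain ⟨c, rfl⟩ := C.cls_surjective c
  constructor
  · intro hc
    rw [Map.H_cls, X.cls_eq_zero h] at hc
    obtain ⟨x, hx⟩ := hc
    dsimp only at hx
    obtain ⟨y, hy⟩ := t.exact h (c.1 + C.d (sub_add_cancel n 1) (t.s (sub_add_cancel n 1) x)) (by
      rw [t.d_s _ h, map_add, map_sub, t.p_i, t.p_s, hx]; simp)
    have hy' : y ∈ Y.Z n := by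
      rw [Y.mem_Z rfl]
      apply t.i_inj
      rw [← t.d_i rfl, hy, map_add, (C.mem_Z rfl).1 c.2, C.d_d, map_zero, add_zero]
    refine ⟨Y.cls ⟨y, hy'⟩, ?_⟩
    rw [Map.H_cls]
    exact C.cls_eq (sub_add_cancel n 1) _ hy
  · rintro ⟨y, hy⟩
    obtain ⟨y, rfl⟩ := Y.cls_surjective y
    rw [← hy, Map.H_cls, Map.H_cls, X.cls_eq_zero h]
    exact ⟨0, (map_zero _).trans (t.p_i h y.1).symm⟩

/-- If `g x = d y`, then `s x - i y` is a cocycle lifting `x`. Conversely, for a cocycle `c` write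
`c - s (p c) = i y'`; then `g (p c) = d (-y')`. -/
theorem exact_X {n m : ℤ} (h : n + 1 = m) :
    Function.Exact (t.p.H h) (t.g.H (add_zero m)) := by
  intro x
  obtain ⟨x, rfl⟩ := X.cls_surjective x
  constructor
  · intro hx
    rw [Map.H_cls, Y.cls_eq_zero h] at hx
    obtain ⟨y, hy⟩ := hx
    dsimp only at hy
    have hc : t.s h x.1 - t.i.app (add_zero n) y ∈ C.Z n := by
      rw [C.mem_Z h, map_sub, t.d_s h rfl, (X.mem_Z rfl).1 x.2, t.d_i, hy]
      simp
    refine ⟨C.cls ⟨_, hc⟩, ?_⟩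
    rw [Map.H_cls]
    refine congrArg X.cls (Subtype.ext ?_)
    dsimp only
    rw [map_sub, t.p_s, t.p_i, sub_zero]
  · rintro ⟨c, hc⟩
    obtain ⟨c, rfl⟩ := C.cls_surjective c
    rw [← hc, Map.H_cls, Map.H_cls, Y.cls_eq_zero h]
    obtain ⟨y', hy'⟩ := t.exact h (c.1 - t.s h (t.p.app h c.1)) (by
        rw [map_sub, t.p_s, sub_self])
    refine ⟨-y', t.i_inj ?_⟩
    dsimp only
    rw [map_neg, map_neg, ← t.d_i, hy', map_sub, (C.mem_Z h).1 c.2, t.d_s _ rfl,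
      (X.mem_Z rfl).1 (t.p.mem_Z h c.2)]
    simp

/-- If `g` is a quasi-isomorphism, then its cone is acyclic. -/
theorem subsingleton_C {n m : ℤ} (h : n + 1 = m)
    (hn : Function.Surjective (t.g.H (add_zero n))) (hm : Function.Injective (t.g.H (add_zero m))) :
    Subsingleton (C.H n) := by
  refine subsingleton_of_forall_eq 0 fun c => ?_
  -- Vanishing of the cone in degree `n` needs only surjectivity in degree `n` and injectivity in
  -- degree `n + 1`. The dévissages rely on this at the edge of the range of degrees.
  have hc : t.p.H h c = 0 := hm (by
    rw [map_zero]
    exact (t.exact_X h).apply_apply_eq_zero c)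
  obtain ⟨y, rfl⟩ := (t.exact_C h c).1 hc
  obtain ⟨x, rfl⟩ := hn y
  exact (t.exact_Y n).apply_apply_eq_zero x

end Triangle

end Cpx

namespace DAlg

variable {k R : Type u} [CommRing k] [CommRing R] [Algebra k R] {A : DAlg k R}

/-! ## The dg category of dg modules -/

namespace DGMod

/-- The complex underlying a dg module. -/
abbrev cpx (N : DGMod A) : Cpx R where
  deg := N.deg
  d := N.d
  d_d := N.d_d

/-- A homogeneous `A`-linear map of degree `s`, not necessarily closed. -/
structure GHom (s : ℤ) (N N' : DGMod A) where
  app {i j : ℤ} (h : i + s = j) : N.deg i →ₗ[R] N'.deg j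
  app_act : ∀ {i j n j' n' : ℤ} (h : i + j = n) (hj : j + s = j') (hn : n + s = n')
    (h' : i + j' = n') (a : A.deg i) (x : N.deg j),
    app hn (N.act h a x) = (s * i).negOnePow • N'.act h' a (app hj x)

/-- A homogeneous map is closed if it commutes with the differential up to the Koszul sign. -/
structure GHom.Closed {s : ℤ} {N N' : DGMod A} (g : GHom s N N') : Prop where
  comm : ∀ {i j i' j' : ℤ} (hi : i + 1 = i') (h : i + s = j) (h' : i' + s = j')
    (hj : j + 1 = j') (x : N.deg i), N'.d hj (g.app h x) = s.negOnePow • g.app h' (N.d hi x)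

/-- The map of complexes underlying a closed map. -/
def GHom.Closed.map {s : ℤ} {N N' : DGMod A} {g : GHom s N N'} (hg : g.Closed) :
    Cpx.Map s N.cpx N'.cpx where
  app := g.app
  comm := hg.comm

/-! ### Submodules and quotients -/

/-- A dg submodule. -/
structure Sub (N : DGMod A) where
  sub (i : ℤ) : Submodule R (N.deg i)
  act_mem : ∀ {i j n : ℤ} (h : i + j = n) (a : A.deg i) {x : N.deg j}, x ∈ sub j →
    N.act h a x ∈ sub n
  d_mem : ∀ {i j : ℤ} (h : i + 1 = j) {x : N.deg i}, x ∈ sub i → N.d h x ∈ sub j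

/-- A dg submodule as a dg module. -/
def ofSub (N : DGMod A) (P : N.Sub) : DGMod A where
  deg i := P.sub i
  d h := (N.d h).restrict fun _ hx => P.d_mem h hx
  d_d h h' x := Subtype.ext (N.d_d h h' x.1)
  act {i j n} h := LinearMap.mk₂ R (fun a (x : P.sub j) => ⟨N.act h a x.1, P.act_mem h a x.2⟩)
    (fun a b x => Subtype.ext (by simp)) (fun r a x => Subtype.ext (by simp))
    (fun a x y => Subtype.ext (by simp)) (fun r a x => Subtype.ext (by simp))
  one_act h x := Subtype.ext (N.one_act h x.1)
  mul_act h₁ h₂ h₃ h₄ a b x := Subtype.ext (N.mul_act h₁ h₂ h₃ h₄ a b x.1)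
  leibniz h hn hi hj h₁ h₂ a x := Subtype.ext (N.leibniz h hn hi hj h₁ h₂ a x.1)

/-- The inclusion of a dg submodule. -/
def incl (N : DGMod A) (P : N.Sub) : GHom 0 (N.ofSub P) N where
  app {i j} h := (by simpa using h : i = j) ▸ (P.sub i).subtype
  app_act {i j n j' n'} h hj hn h' a x := by
    obtain rfl : j = j' := by omega
    obtain rfl : n = n' := by omega
    simp
    rfl

theorem incl_closed (N : DGMod A) (P : N.Sub) : (N.incl P).Closed := by
  refine ⟨fun {i j i' j'} hi h h' hj x => ?_⟩
  obtain rfl : i = j := by omega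
  obtain rfl : i' = j' := by omega
  simp
  rfl

/-- The action on a quotient dg module. -/
def quotAct (N : DGMod A) (P : N.Sub) {i j n : ℤ} (h : i + j = n) :
    A.deg i →ₗ[R] (N.deg j ⧸ P.sub j) →ₗ[R] (N.deg n ⧸ P.sub n) where
  toFun a := Submodule.mapQ _ _ (N.act h a) (fun _ hx => P.act_mem h a hx)
  map_add' a b := by
    refine LinearMap.ext fun z => ?_
    obtain ⟨z, rfl⟩ := Submodule.Quotient.mk_surjective _ z
    simp
  map_smul' r a := by
    refine LinearMap.ext fun z => ?_
    obtain ⟨z, rfl⟩ := Submodule.Quotient.mk_surjective _ z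
    simp

/-- The quotient by a dg submodule. -/
def quot (N : DGMod A) (P : N.Sub) : DGMod A where
  deg i := N.deg i ⧸ P.sub i
  d h := Submodule.mapQ _ _ (N.d h) (fun _ hx => P.d_mem h hx)
  d_d h h' x := by
    obtain ⟨x, rfl⟩ := Submodule.Quotient.mk_surjective _ x
    simp [N.d_d]
  act h := N.quotAct P h
  one_act h x := by
    obtain ⟨x, rfl⟩ := Submodule.Quotient.mk_surjective _ x
    exact congrArg _ (N.one_act h x)
  mul_act h₁ h₂ h₃ h₄ a b x := by
    obtain ⟨x, rfl⟩ := Submodule.Quotient.mk_surjective _ x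
    exact congrArg (Submodule.Quotient.mk (p := P.sub _)) (N.mul_act h₁ h₂ h₃ h₄ a b x)
  leibniz h hn hi hj h₁ h₂ a x := by
    obtain ⟨x, rfl⟩ := Submodule.Quotient.mk_surjective _ x
    exact congrArg (Submodule.Quotient.mk (p := P.sub _)) (N.leibniz h hn hi hj h₁ h₂ a x)

/-- The projection to a quotient. -/
def proj (N : DGMod A) (P : N.Sub) : GHom 0 N (N.quot P) where
  app {i j} h := (by simpa using h : i = j) ▸ (P.sub i).mkQ
  app_act {i j n j' n'} h hj hn h' a x := by
    obtain rfl : j = j' := by omega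
    obtain rfl : n = n' := by omega
    simp
    rfl

theorem proj_closed (N : DGMod A) (P : N.Sub) : (N.proj P).Closed := by
  refine ⟨fun {i j i' j'} hi h h' hj x => ?_⟩
  obtain rfl : i = j := by omega
  obtain rfl : i' = j' := by omega
  simp
  rfl

/-- A homogeneous map vanishing on a dg submodule factors through the quotient. -/
def GHom.desc {N N' : DGMod A} {s : ℤ} (g : GHom s N N') (P : N.Sub)
    (hg : ∀ {i j : ℤ} (h : i + s = j), ∀ x ∈ P.sub i, g.app h x = 0) : GHom s (N.quot P) N' where
  app {i j} h := (P.sub i).liftQ (g.app h) (hg h)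
  app_act h hj hn h' a x := by
    obtain ⟨x, rfl⟩ := Submodule.Quotient.mk_surjective _ x
    exact g.app_act h hj hn h' a x

theorem GHom.desc_closed {N N' : DGMod A} {s : ℤ} {g : GHom s N N'} (hc : g.Closed) (P : N.Sub)
    (hg : ∀ {i j : ℤ} (h : i + s = j), ∀ x ∈ P.sub i, g.app h x = 0) : (g.desc P hg).Closed := by
  refine ⟨fun {i j i' j'} hi h h' hj x => ?_⟩
  obtain ⟨x, rfl⟩ := Submodule.Quotient.mk_surjective _ x
  exact hc.comm hi h h' hj x

/-! ### Cones -/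

/-- The cone of a closed map of degree zero. -/
def cone {N N' : DGMod A} {g : GHom 0 N N'} (hg : g.Closed) : DGMod A where
  deg n := N'.deg n × N.deg (n + 1)
  d {n m} h := LinearMap.prod
    ((N'.d h).comp (LinearMap.fst _ _ _) +
      (g.app (by omega)).comp (LinearMap.snd R (N'.deg n) (N.deg (n + 1))))
    (-((N.d (by omega)).comp (LinearMap.snd _ _ _)))
  d_d {i j l} h h' x := by
    refine Prod.ext ?_ ?_
    · simp [N'.d_d, hg.comm (i := i + 1) (i' := j + 1) (j := j) (j' := l) (by omega) (by omega)
        (by omega) h']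
    · simp [N.d_d]
  act {i j n} h := LinearMap.mk₂ R
    -- The second summand is a shift of `N`. The Koszul sign from moving `a` past the shift
    -- compensates the minus sign in the differential, and the Leibniz rule requires it.
    (fun a x => (N'.act h a x.1, i.negOnePow • N.act (by omega) a x.2))
    (fun a b x => by simp) (fun r a x => by simp [smul_comm r])
    (fun a x y => by simp) (fun r a x => by simp [smul_comm r])
  one_act h x := by simp [N.one_act, N'.one_act]
  mul_act {i j l m m' n} h₁ h₂ h₃ h₄ a b x := by
    refine Prod.ext (N'.mul_act h₁ h₂ h₃ h₄ a b x.1) ?_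
    simp only [LinearMap.mk₂_apply]
    rw [map_negOnePow_smul, smul_smul, ← Int.negOnePow_add, h₁,
      N.mul_act h₁ (by omega) (m' := m' + 1) (by omega) (by omega)]
  leibniz {i j n i' j' n'} h hn hi hj h₁ h₂ a x := by
    refine Prod.ext ?_ ?_
    · simp [N'.leibniz h hn hi hj h₁ h₂,
        g.app_act (i := i) (j := j + 1) (n := n + 1) (by omega) (j' := j') (by omega) (n' := n')
          (by omega) h₂, add_assoc]
    · have e := N.leibniz (i := i) (j := j + 1) (n := n + 1) (n' := n' + 1) (by omega) (by omega)
        hi (j' := j' + 1) (by omega) (by omega) (by omega) a x.2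
      change -(N.d (by omega) (i.negOnePow • N.act (n := n + 1) (by omega) a x.2)) =
        i'.negOnePow • N.act (n := n' + 1) (by omega) (A.d hi a) x.2 +
          i.negOnePow • i.negOnePow • N.act (j := j' + 1) (n := n' + 1) (by omega) a
            (-N.d (by omega) x.2)
      have hi' : i'.negOnePow = (i + 1).negOnePow := by rw [hi]
      rw [map_negOnePow_smul, e, hi', Int.negOnePow_succ, map_neg, smul_add, smul_neg, smul_neg,
        Units.neg_smul, neg_add]

variable {N N' : DGMod A} {g : GHom 0 N N'} (hg : g.Closed)

theorem cone_d {n m : ℤ} (h : n + 1 = m) (x : N'.deg n) (y : N.deg (n + 1)) :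
    (cone hg).d h (x, y) = (N'.d h x + g.app (by omega) y, - N.d (by omega) y) := rfl

theorem cone_act {i j n : ℤ} (h : i + j = n) (a : A.deg i) (x : N'.deg j) (y : N.deg (j + 1)) :
    (cone hg).act h a (x, y) = (N'.act h a x, i.negOnePow • N.act (by omega) a y) := rfl

/-- The inclusion into a cone. -/
def coneInl : GHom 0 N' (cone hg) where
  app {i j} h := (by simpa using h : i = j) ▸ LinearMap.inl R (N'.deg i) (N.deg (i + 1))
  app_act {i j n j' n'} h hj hn h' a x := by
    obtain rfl : j = j' := by omega
    obtain rfl : n = n' := by omega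
    simp only [zero_mul, Int.negOnePow_zero, one_smul]
    change (N'.act h a x, 0) = (cone hg).act h' a (x, 0)
    rw [cone_act, map_zero, smul_zero]

theorem coneInl_app {i : ℤ} (y : N'.deg i) : (coneInl hg).app (add_zero i) y = (y, 0) := rfl

theorem coneInl_closed : (coneInl hg).Closed := by
  refine ⟨fun {i j i' j'} hi h h' hj x => ?_⟩
  obtain rfl : i = j := by omega
  obtain rfl : i' = j' := by omega
  rw [coneInl_app, coneInl_app, cone_d, map_zero, map_zero,
    neg_zero, add_zero]
  exact (one_smul ℤˣ ((N'.d hi x, 0) : N'.deg i' × N.deg (i' + 1))).symm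

/-- The projection from a cone, of degree one. -/
def coneSnd : GHom 1 (cone hg) N where
  app {i j} h := h ▸ LinearMap.snd R (N'.deg i) (N.deg (i + 1))
  app_act {i j n j' n'} h hj hn h' a x := by
    subst hj hn
    have hi : (1 * i).negOnePow = i.negOnePow := by rw [_root_.one_mul]
    rw [hi]
    rfl

theorem coneSnd_app {i : ℤ} (c : N'.deg i × N.deg (i + 1)) : (coneSnd hg).app rfl c = c.2 := rfl

theorem coneSnd_closed : (coneSnd hg).Closed := by
  refine ⟨fun {i j i' j'} hi h h' hj x => ?_⟩
  subst h h'
  obtain ⟨x, y⟩ := x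
  rw [cone_d, coneSnd_app, coneSnd_app]
  simp

/-- The retraction of a cone, not closed. -/
def coneFst : GHom 0 (cone hg) N' where
  app {i j} h := (by simpa using h : i = j) ▸ LinearMap.fst R (N'.deg i) (N.deg (i + 1))
  app_act {i j n j' n'} h hj hn h' a x := by
    obtain rfl : j = j' := by omega
    obtain rfl : n = n' := by omega
    simp only [zero_mul, Int.negOnePow_zero, one_smul]
    rfl

theorem coneFst_app {i : ℤ} (c : N'.deg i × N.deg (i + 1)) :
    (coneFst hg).app (add_zero i) c = c.1 := rfl

/-- The section of the projection from a cone, not closed. -/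
def coneInr : GHom (-1) N (cone hg) where
  app {i j} h := (by omega : j + 1 = i) ▸ LinearMap.inr R (N'.deg j) (N.deg (j + 1))
  app_act {i j n j' n'} h hj hn h' a x := by
    obtain rfl : j' + 1 = j := by omega
    obtain rfl : n' + 1 = n := by omega
    change (0, N.act h a x) = (-1 * i).negOnePow • (cone hg).act h' a (0, x)
    rw [cone_act, map_zero]
    refine Prod.ext (smul_zero (-1 * i).negOnePow).symm ?_
    change N.act h a x = (-1 * i).negOnePow • i.negOnePow • N.act h a x
    rw [smul_smul, ← Int.negOnePow_add]
    simp

theorem coneInr_app {j : ℤ} (h : j + 1 + -1 = j) (x : N.deg (j + 1)) :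
    (coneInr hg).app h x = (0, x) := rfl

theorem coneFst_coneInl {n : ℤ} (y : N'.deg n) :
    (coneFst hg).app (add_zero n) ((coneInl hg).app (add_zero n) y) = y := rfl

theorem coneSnd_coneInl {n m : ℤ} (h : n + 1 = m) (y : N'.deg n) :
    (coneSnd hg).app h ((coneInl hg).app (add_zero n) y) = 0 := by
  subst h; rfl

theorem coneSnd_coneInr {n m : ℤ} (h : n + 1 = m) (h' : m + -1 = n) (x : N.deg m) :
    (coneSnd hg).app h ((coneInr hg).app h' x) = x := by
  subst h; rfl

theorem cone_decomp {n m : ℤ} (h : n + 1 = m) (h' : m + -1 = n) (c : (cone hg).deg n) :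
    (coneInl hg).app (add_zero n) ((coneFst hg).app (add_zero n) c) +
      (coneInr hg).app h' ((coneSnd hg).app h c) = c := by
  subst h
  obtain ⟨x, y⟩ := c
  rw [coneFst_app, coneSnd_app, coneInl_app, coneInr_app]
  exact Prod.ext (add_zero _) (zero_add _)

theorem d_coneInr {n m l : ℤ} (h : n + 1 = m) (h' : m + 1 = l) (h₁ : m + -1 = n) (h₂ : l + -1 = m)
    (x : N.deg m) :
    (cone hg).d h ((coneInr hg).app h₁ x) =
      (coneInl hg).app (add_zero m) (g.app (add_zero m) x) - (coneInr hg).app h₂ (N.d h' x) := by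
  subst h h'
  rw [coneInr_app, coneInr_app, coneInl_app, cone_d, map_zero, zero_add]
  exact Prod.ext (sub_zero _).symm (zero_sub _).symm

/-- The triangle of complexes of a cone. -/
def coneTriangle : Cpx.Triangle N.cpx N'.cpx (cone hg).cpx where
  g := hg.map
  i := (coneInl_closed hg).map
  p := (coneSnd_closed hg).map
  s h := (coneInr hg).app (by omega)
  i_inj {n} := Function.LeftInverse.injective (g := (coneFst hg).app (add_zero n))
    (coneFst_coneInl hg)
  p_i h := coneSnd_coneInl hg h
  exact {n m} h c hc := by
    refine ⟨(coneFst hg).app (add_zero n) c, ?_⟩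
    have hc' : (coneSnd hg).app h c = 0 := hc
    have := cone_decomp hg h (by omega) c
    rwa [hc', map_zero, add_zero] at this
  p_s h := coneSnd_coneInr hg h (by omega)
  d_s h h' := d_coneInr hg h h' (by omega) (by omega)

/-! ### Truncation -/

/-- The canonical truncation of a dg module in degrees at most `m`. -/
def tau (N : DGMod A) (m : ℤ) : N.Sub where
  sub i := if i < m then ⊤ else if i = m then N.cpx.Z i else ⊥
  -- Truncation from above is a submodule because `A` lives in nonpositive degrees, so its action
  -- never raises the degree. In degree `m` itself only elements of `A^0` act, and these are
  -- cocycles since `A^1 = 0`.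
  act_mem {i j n} h a x hx := by
    rcases lt_or_ge 0 i with hi | hi
    · have := A.subsingleton_of_pos i hi
      rw [Subsingleton.elim a 0]
      simp
    · split_ifs with hn hn'
      · trivial
      · subst hn'
        rcases hi.lt_or_eq with hi | rfl
        · rw [if_neg (by omega), if_neg (by omega)] at hx
          rw [(Submodule.mem_bot R).1 hx, map_zero]
          exact zero_mem _
        · obtain rfl : j = n := by omega
          rw [if_neg hn, if_pos rfl] at hx
          have := A.subsingleton_of_pos (0 + 1) (by omega)
          have ha : A.d (rfl : (0 : ℤ) + 1 = 0 + 1) a = 0 := Subsingleton.elim _ _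
          have hx' : N.d rfl x = 0 := hx
          refine (N.cpx.mem_Z rfl).2 ((N.leibniz h rfl rfl rfl (by omega) (by omega) a x).trans ?_)
          rw [ha, hx']
          simp
      · rw [if_neg (by omega), if_neg (by omega)] at hx
        rw [(Submodule.mem_bot R).1 hx, map_zero]
        exact zero_mem _
  d_mem {i j} h x hx := by
    split_ifs with hj hj'
    · trivial
    · exact (N.cpx.mem_Z rfl).2 (N.d_d h rfl x)
    · rcases lt_or_ge m i with hi | hi
      · rw [if_neg (by omega), if_neg (by omega)] at hx
        rw [(Submodule.mem_bot R).1 hx, map_zero]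
        exact zero_mem _
      · rw [if_neg (by omega), if_pos (by omega)] at hx
        exact (N.cpx.mem_Z h).1 hx

theorem subsingleton_tau (N : DGMod A) {m i : ℤ} (h : m < i) :
    Subsingleton ((N.ofSub (N.tau m)).deg i) := by
  have : (N.tau m).sub i = ⊥ := by
    change (if i < m then ⊤ else if i = m then N.cpx.Z i else ⊥) = ⊥
    rw [if_neg (by omega), if_neg (by omega)]
  change Subsingleton ((N.tau m).sub i)
  rw [this]
  infer_instance

theorem mem_tau_of_mem_Z (N : DGMod A) {m i : ℤ} (h : i ≤ m) {x : N.deg i} (hx : x ∈ N.cpx.Z i) :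
    x ∈ (N.tau m).sub i := by
  change x ∈ (if i < m then ⊤ else if i = m then N.cpx.Z i else ⊥ : Submodule R _)
  split_ifs with h₁ h₂
  · trivial
  · exact hx
  · omega

theorem mem_tau_of_lt (N : DGMod A) {m i : ℤ} (h : i < m) (x : N.deg i) :
    x ∈ (N.tau m).sub i := by
  change x ∈ (if i < m then ⊤ else if i = m then N.cpx.Z i else ⊥ : Submodule R _)
  rw [if_pos h]
  trivial

/-- The truncation of `N` computes the cohomology of `N` in degrees at most `m`. -/
theorem tau_bijective (N : DGMod A) {m i : ℤ} (h : i ≤ m) :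
    Function.Bijective ((N.incl_closed (N.tau m)).map.H (add_zero i)) := by
  constructor
  · refine (injective_iff_map_eq_zero _).2 fun x hx => ?_
    obtain ⟨⟨x, hx'⟩, rfl⟩ := Cpx.cls_surjective _ x
    rw [Cpx.Map.H_cls, Cpx.cls_eq_zero _ (sub_add_cancel i 1)] at hx
    obtain ⟨y, hy⟩ := hx
    -- A primitive lives in degree `i - 1 < m`, where the truncation is all of `N`.
    exact (Cpx.cls_eq_zero _ (sub_add_cancel i 1)).2
      ⟨⟨y, N.mem_tau_of_lt (by omega) y⟩, Subtype.ext hy⟩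
  · intro x
    obtain ⟨x, rfl⟩ := Cpx.cls_surjective _ x
    exact ⟨Cpx.cls _ ⟨⟨x.1, N.mem_tau_of_mem_Z h x.2⟩, Subtype.ext x.2⟩, rfl⟩

/-- If the cohomology of `N` vanishes in degrees above `m`, the truncation is quasi-isomorphic
to `N`. -/
theorem tau_bijective' (N : DGMod A) {m : ℤ} (hN : ∀ i, m < i → Subsingleton (N.cpx.H i))
    (i : ℤ) : Function.Bijective ((N.incl_closed (N.tau m)).map.H (add_zero i)) := by
  rcases le_or_gt i m with h | h
  · exact N.tau_bijective h
  · have := hN i h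
    have := Cpx.subsingleton_H_of_deg (N.ofSub (N.tau m)).cpx (N.subsingleton_tau h)
    exact ⟨fun _ _ _ => Subsingleton.elim _ _, fun x => ⟨0, Subsingleton.elim _ _⟩⟩

end DGMod

/-! ### Free dg modules -/

/-- A dg algebra as a dg module over itself. -/
abbrev asMod (A : DAlg k R) : DGMod A where
  deg := A.deg
  d := A.d
  d_d := A.d_d
  act := A.mul
  one_act := A.one_mul
  mul_act := A.mul_assoc
  leibniz := A.leibniz

/-- A dg ideal as a dg submodule. -/
def DIdeal.toSub (I : A.DIdeal) : A.asMod.Sub where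
  sub := I.sub
  act_mem := I.mul_mem
  d_mem := I.d_mem

namespace DGMod

/-- The map `a ↦ ± a x` of degree `m` determined by an element `x` of degree `m`. -/
def orbit (N : DGMod A) {m : ℤ} (x : N.deg m) : GHom m A.asMod N where
  app {i j} h := ((m * i).negOnePow : ℤ) • LinearMap.flip (N.act h) x
  app_act {i j n j' n'} h hj hn h' a b := by
    change ((m * n).negOnePow : ℤ) • N.act hn (A.mul h a b) x =
      (m * i).negOnePow • N.act h' a (((m * j).negOnePow : ℤ) • N.act hj b x)
    rw [N.mul_act h hn hj h', map_zsmul, ← Units.smul_def, ← Units.smul_def, smul_smul,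
      ← Int.negOnePow_add, ← mul_add, h]

theorem orbit_app (N : DGMod A) {m : ℤ} (x : N.deg m) {i j : ℤ} (h : i + m = j) (a : A.deg i) :
    (N.orbit x).app h a = (m * i).negOnePow • N.act h a x := rfl

theorem orbit_one (N : DGMod A) {m : ℤ} (x : N.deg m) :
    (N.orbit x).app (zero_add m) A.one = x := by
  rw [orbit_app, N.one_act, mul_zero, Int.negOnePow_zero, one_smul]

theorem orbit_closed (N : DGMod A) {m : ℤ} (x : N.deg m) (hx : x ∈ N.cpx.Z m) :
    (N.orbit x).Closed := by
  refine ⟨fun {i j i' j'} hi h h' hj a => ?_⟩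
  have hx' : N.d rfl x = 0 := hx
  have e : (m * i).negOnePow = m.negOnePow * (m * i').negOnePow := by
    rw [← hi, mul_add, mul_one, Int.negOnePow_add, mul_left_comm, Int.units_mul_self, mul_one]
  rw [orbit_app, orbit_app, map_negOnePow_smul, N.leibniz h hj hi rfl h' (by omega), hx', map_zero,
    smul_zero, add_zero, smul_smul, e]

/-- The direct sum of copies of `E`, indexed by `V` and shifted to start in degree `m`. -/
def cell (E : DGMod A) (V : Type u) (m : ℤ) : DGMod A where
  deg n := V →₀ E.deg (n - m)
  -- The signs `(-1)^m` here and `(-1)^(m i)` in the action are those of the shift. With them the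
  -- inclusion of each summand is a closed `A`-linear map of degree `m`.
  d h := Finsupp.mapRange.linearMap ((m.negOnePow : ℤ) • E.d (by omega))
  d_d h h' x := by
    refine Finsupp.ext fun v => ?_
    simp [E.d_d]
  act {i j n} h := LinearMap.mk₂ R
    (fun a x => Finsupp.mapRange.linearMap ((((m * i).negOnePow : ℤ)) • E.act (by omega) a) x)
    (fun a b x => Finsupp.ext fun v => by simp)
    (fun r a x => Finsupp.ext fun v => by simp [smul_comm r])
    (fun a x y => LinearMap.map_add _ x y) (fun r a x => LinearMap.map_smul _ r x)
  one_act h x := by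
    refine Finsupp.ext fun v => ?_
    simp [E.one_act]
  mul_act {i j l m₁ m' n} h₁ h₂ h₃ h₄ a b x := by
    refine Finsupp.ext fun v => ?_
    change ((m * m₁).negOnePow : ℤ) • E.act (j := l - m) (n := n - m) (by omega)
        (A.mul h₁ a b) (x v) =
      ((m * i).negOnePow : ℤ) • E.act (j := m' - m) (n := n - m) (by omega) a
        (((m * j).negOnePow : ℤ) • E.act (j := l - m) (n := m' - m) (by omega) b (x v))
    rw [E.mul_act h₁ (n := n - m) (by omega) (m' := m' - m) (by omega) (by omega), map_zsmul,
      ← Units.smul_def, ← Units.smul_def, ← Units.smul_def, smul_smul, ← Int.negOnePow_add,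
      ← mul_add, h₁]
  leibniz {i j n i' j' n'} h hn hi hj h₁ h₂ a x := by
    refine Finsupp.ext fun v => ?_
    change (m.negOnePow : ℤ) • E.d (by omega) (((m * i).negOnePow : ℤ) •
        E.act (n := n - m) (by omega) a (x v)) =
      ((m * i').negOnePow : ℤ) • E.act (n := n' - m) (by omega) (A.d hi a) (x v) +
      i.negOnePow • ((m * i).negOnePow : ℤ) • E.act (n := n' - m) (by omega) a
        ((m.negOnePow : ℤ) • E.d (j := j' - m) (by omega) (x v))
    rw [map_zsmul, E.leibniz (n := n - m) (n' := n' - m) (by omega) (by omega) hi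
      (j' := j' - m) (by omega) (by omega) (by omega), map_zsmul]
    simp only [← Units.smul_def, smul_add, smul_smul, ← Int.negOnePow_add]
    congr 2
    · rw [← hi]; congr 1; ring
    · congr 1; ring

section Cell

variable (E : DGMod A) (V : Type u) (m : ℤ)

theorem subsingleton_cell (hE : ∀ i, 0 < i → Subsingleton (E.deg i)) {i : ℤ} (h : m < i) :
    Subsingleton ((cell E V m).deg i) := by
  have := hE (i - m) (by omega)
  change Subsingleton (V →₀ E.deg (i - m))
  infer_instance

/-- The inclusion of a summand. -/
def cellIncl (v : V) : GHom m E (cell E V m) where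
  app {i j} h := (by omega : j - m = i) ▸ Finsupp.lsingle (M := E.deg (j - m)) (R := R) v
  app_act {i j n j' n'} h hj hn h' a x := by
    obtain rfl : j' - m = j := by omega
    obtain rfl : n' - m = n := by omega
    change Finsupp.single v (E.act h a x) = (m * i).negOnePow • Finsupp.mapRange.linearMap
      ((((m * i).negOnePow : ℤ)) • E.act h a) (Finsupp.single v x)
    rw [Finsupp.mapRange.linearMap_apply, Finsupp.mapRange_single, LinearMap.smul_apply,
      ← Finsupp.smul_single, ← Units.smul_def, smul_smul, Int.units_mul_self, one_smul]

theorem cellIncl_app (v : V) {j : ℤ} (h : j - m + m = j) (x : E.deg (j - m)) :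
    (cellIncl E V m v).app h x = Finsupp.single v x := rfl

theorem cellIncl_closed (v : V) : (cellIncl E V m v).Closed := by
  refine ⟨fun {i j i' j'} hi h h' hj x => ?_⟩
  obtain rfl : j - m = i := by omega
  obtain rfl : j' - m = i' := by omega
  rw [cellIncl_app, cellIncl_app]
  change Finsupp.mapRange.linearMap ((m.negOnePow : ℤ) • E.d hi) (Finsupp.single v x) =
    m.negOnePow • Finsupp.single v (E.d hi x)
  rw [Finsupp.mapRange.linearMap_apply, Finsupp.mapRange_single, LinearMap.smul_apply,
      ← Finsupp.smul_single, ← Units.smul_def]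

/-- The projection to a summand. -/
def cellProj (v : V) : GHom (-m) (cell E V m) E where
  app {i j} h := h ▸ Finsupp.lapply (M := E.deg (i - m)) (R := R) v
  app_act {i j n j' n'} h hj hn h' a (x : V →₀ E.deg (j - m)) := by
    subst hj hn
    change ((m * i).negOnePow : ℤ) • E.act h' a (x v) = (-m * i).negOnePow • E.act h' a (x v)
    rw [neg_mul, Int.negOnePow_neg, Units.smul_def]

theorem cellProj_closed (v : V) : (cellProj E V m v).Closed := by
  refine ⟨fun {i j i' j'} hi h h' hj (x : V →₀ E.deg (i - m)) => ?_⟩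
  subst h h'
  change E.d hj (x v) = (-m).negOnePow • (m.negOnePow : ℤ) • E.d hj (x v)
  rw [← Units.smul_def, smul_smul, Int.negOnePow_neg, Int.units_mul_self, one_smul]

/-- Every element is the finite sum of its components. -/
theorem cell_induction {n : ℤ} {p : (cell E V m).deg n → Prop} (h0 : p 0)
    (hadd : ∀ x y, p x → p y → p (x + y))
    (hincl : ∀ v {i : ℤ} (h : i + m = n) (x : E.deg i), p ((cellIncl E V m v).app h x))
    (x : (cell E V m).deg n) : p x := by
  refine Finsupp.induction_linear (motive := p) x h0 hadd fun v x => ?_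
  exact hincl v (by omega : n - m + m = n) x

theorem cellProj_cellIncl (v : V) {i j : ℤ} (h : i + m = j) (h' : j + -m = i) (x : E.deg i) :
    (cellProj E V m v).app h' ((cellIncl E V m v).app h x) = x := by
  obtain rfl : j - m = i := by omega
  exact Finsupp.single_eq_same

theorem cellProj_cellIncl_of_ne {v w : V} (hvw : v ≠ w) {i j l : ℤ} (h : i + m = j)
    (h' : j + -m = l) (x : E.deg i) :
    (cellProj E V m w).app h' ((cellIncl E V m v).app h x) = 0 := by
  subst h'
  obtain rfl : j - m = i := by omega
  exact Finsupp.single_eq_of_ne (Ne.symm hvw)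

variable {E V m}

/-- The map out of a direct sum determined by maps out of the summands. -/
def cellDesc {N : DGMod A} (φ : V → GHom m E N) : GHom 0 (cell E V m) N where
  app {i j} h := Finsupp.lsum ℕ fun v => (φ v).app (by omega)
  app_act {i j n j' n'} h hj hn h' a x := by
    obtain rfl : j = j' := by omega
    obtain rfl : n = n' := by omega
    rw [zero_mul, Int.negOnePow_zero, one_smul]
    change Finsupp.lsum ℕ _ (Finsupp.mapRange.linearMap
        ((((m * i).negOnePow : ℤ)) • E.act (n := n - m) (by omega) a) (x : V →₀ E.deg (j - m))) =
          N.act h a (Finsupp.lsum ℕ _ (x : V →₀ E.deg (j - m)))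
    induction x using Finsupp.induction_linear with
    | zero => simp only [map_zero]
    | add x y hx hy => simp only [map_add, hx, hy]
    | single v x =>
      rw [Finsupp.mapRange.linearMap_apply, Finsupp.mapRange_single, Finsupp.lsum_single,
        Finsupp.lsum_single, LinearMap.smul_apply, map_zsmul,
        (φ v).app_act (n := n - m) (by omega) (by omega) (by omega) h, ← Units.smul_def, smul_smul,
        Int.units_mul_self, one_smul]

theorem cellDesc_cellIncl {N : DGMod A} (φ : V → GHom m E N) (v : V) {i j : ℤ} (h : i + m = j)
    (x : E.deg i) :
    (cellDesc φ).app (add_zero j) ((cellIncl E V m v).app h x) = (φ v).app h x := by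
  obtain rfl : j - m = i := by omega
  exact Finsupp.lsum_single ..

theorem cellDesc_closed {N : DGMod A} {φ : V → GHom m E N} (hφ : ∀ v, (φ v).Closed) :
    (cellDesc φ).Closed := by
  refine ⟨fun {i j i' j'} hi h h' hj x => ?_⟩
  obtain rfl : i = j := by omega
  obtain rfl : i' = j' := by omega
  rw [Int.negOnePow_zero, one_smul]
  induction x using cell_induction with
  | h0 => simp
  | hadd x y hx hy => simp only [map_add, hx, hy]
  | hincl v h₁ x =>
    rw [cellDesc_cellIncl, (hφ v).comm rfl h₁ (by omega) hj,
      (cellIncl_closed E V m v).comm rfl h₁ (by omega) hj, map_negOnePow_smul, cellDesc_cellIncl]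

end Cell

end DGMod

end DAlg

namespace DAlg

/-! ## The tensor product as a dg functor -/

section Tensor

variable {k R : Type u} [CommRing k] [CommRing R] [Algebra k R] {A Q : DAlg k R}
  (f : Hom (RingHom.id R) A Q) (N : DGMod A)

/-- Homogeneous pure tensors in `Q ⊗_A N`. -/
def tmk {i j n : ℤ} (h : i + j = n) : Q.deg i →ₗ[R] N.deg j →ₗ[R] Tensor f N n :=
  (tmul Q N h).compr₂ (tensorRel f N n).mkQ

theorem tmk_mul {i m j l l' n : ℤ} (h₁ : i + m = l) (h₂ : l + j = n) (h₃ : m + j = l')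
    (h₄ : i + l' = n) (q : Q.deg i) (a : A.deg m) (x : N.deg j) :
    tmk f N h₂ (Q.mul h₁ q (f.app m a)) x = tmk f N h₄ q (N.act h₃ a x) := by
  rw [← sub_eq_zero]
  exact (Submodule.Quotient.mk_eq_zero _).2
    (Submodule.subset_span ⟨i, m, j, l, l', h₁, h₂, h₃, h₄, q, a, x, rfl⟩)

theorem tensorD_tmk {i j n i' j' n' : ℤ}
    (h : i + j = n) (hn : n + 1 = n') (hi : i + 1 = i') (hj : j + 1 = j')
    (h₁ : i' + j = n') (h₂ : i + j' = n') (q : Q.deg i) (x : N.deg j) :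
    tensorD f N hn (tmk f N h q x) =
      tmk f N h₁ (Q.d hi q) x + i.negOnePow • tmk f N h₂ q (N.d hj x) := by
  refine (congrArg (tensorRel f N n').mkQ (preD_tmul Q N h hn hi hj h₁ h₂ q x)).trans ?_
  rw [map_add, map_negOnePow_smul]
  rfl

theorem tensor_induction {n : ℤ} {p : Tensor f N n → Prop} (h0 : p 0)
    (hadd : ∀ x y, p x → p y → p (x + y))
    (htmk : ∀ {i j : ℤ} (h : i + j = n) (q : Q.deg i) (x : N.deg j), p (tmk f N h q x))
    (z : Tensor f N n) : p z := by
  obtain ⟨z, rfl⟩ := Submodule.Quotient.mk_surjective _ z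
  change p ((tensorRel f N n).mkQ z)
  induction z using DirectSum.induction_on with
  | zero => rwa [map_zero]
  | add x y hx hy => rw [map_add]; exact hadd _ _ hx hy
  | of i x =>
    obtain ⟨⟨i, j⟩, h⟩ := i
    induction x using TensorProduct.induction_on with
    | zero => rwa [map_zero, map_zero]
    | add x y hx hy => rw [map_add, map_add]; exact hadd _ _ hx hy
    | tmul q x => exact htmk h q x

/-- The map out of the tensor product determined by a balanced bilinear map. -/
def tlift {n : ℤ} {W : Type*} [AddCommGroup W] [Module R W]
    (β : ∀ {i j : ℤ} (_ : i + j = n), Q.deg i →ₗ[R] N.deg j →ₗ[R] W)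
    (hβ : ∀ {i m j l l' : ℤ} (h₁ : i + m = l) (h₂ : l + j = n) (h₃ : m + j = l')
      (h₄ : i + l' = n) (q : Q.deg i) (a : A.deg m) (x : N.deg j),
      β h₂ (Q.mul h₁ q (f.app m a)) x = β h₄ q (N.act h₃ a x)) : Tensor f N n →ₗ[R] W :=
  (tensorRel f N n).liftQ (DirectSum.toModule R _ _ fun p => TensorProduct.lift (β p.2)) (by
    rw [tensorRel, Submodule.span_le]
    rintro _ ⟨i, m, j, l, l', h₁, h₂, h₃, h₄, q, a, x, rfl⟩
    rw [SetLike.mem_coe, LinearMap.mem_ker, map_sub, sub_eq_zero]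
    simp only [tmul, LinearMap.compr₂_apply, TensorProduct.mk_apply, DirectSum.toModule_lof,
      TensorProduct.lift.tmul]
    exact hβ h₁ h₂ h₃ h₄ q a x)

theorem tlift_tmk {n : ℤ} {W : Type*} [AddCommGroup W] [Module R W]
    (β : ∀ {i j : ℤ} (_ : i + j = n), Q.deg i →ₗ[R] N.deg j →ₗ[R] W)
    (hβ : ∀ {i m j l l' : ℤ} (h₁ : i + m = l) (h₂ : l + j = n) (h₃ : m + j = l')
      (h₄ : i + l' = n) (q : Q.deg i) (a : A.deg m) (x : N.deg j),
      β h₂ (Q.mul h₁ q (f.app m a)) x = β h₄ q (N.act h₃ a x))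
    {i j : ℤ} (h : i + j = n) (q : Q.deg i) (x : N.deg j) :
    tlift f N β hβ (tmk f N h q x) = β h q x := by
  change (DirectSum.toModule R _ _ fun p => TensorProduct.lift (β p.2)) (tmul Q N h q x) = _
  simp only [tmul, LinearMap.compr₂_apply, TensorProduct.mk_apply, DirectSum.toModule_lof,
    TensorProduct.lift.tmul]

/-- The complex `Q ⊗_A N`. -/
abbrev tensorCpx : Cpx R where
  deg := Tensor f N
  d := tensorD f N
  d_d {i j l} h h' z := by
    induction z using tensor_induction with
    | h0 => simp
    | hadd x y hx hy => rw [map_add, map_add, hx, hy, add_zero]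
    | htmk h₁ q x =>
      rename_i a b
      rw [tensorD_tmk f N h₁ h rfl rfl (by omega) (by omega), map_add, map_negOnePow_smul,
        tensorD_tmk f N _ h' rfl rfl (by omega) (by omega),
        tensorD_tmk f N _ h' rfl rfl (by omega) (by omega), Q.d_d, N.d_d, Int.negOnePow_succ]
      simp

variable {N} {N' : DGMod A}

/-- The bilinear map `(q, x) ↦ (-1)^{s |q|} q ⊗ g x` for a map `g` of degree `s`. -/
def tmapBilin {s : ℤ} (g : DGMod.GHom s N N') {n n' : ℤ} (hn : n + s = n') {i j : ℤ}
    (h : i + j = n) : Q.deg i →ₗ[R] N.deg j →ₗ[R] Tensor f N' n' :=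
  ((s * i).negOnePow : ℤ) • (tmk f N' (i := i) (j := j + s) (by omega)).compl₂ (g.app rfl)

theorem tmapBilin_apply {s : ℤ} (g : DGMod.GHom s N N') {n n' : ℤ} (hn : n + s = n') {i j j' : ℤ}
    (h : i + j = n) (hj : j + s = j') (h' : i + j' = n') (q : Q.deg i) (x : N.deg j) :
    tmapBilin f g hn h q x = (s * i).negOnePow • tmk f N' h' q (g.app hj x) := by
  subst hj
  simp only [tmapBilin, LinearMap.smul_apply, LinearMap.compl₂_apply, ← Units.smul_def]

/-- The sign `(-1)^(s i)` from passing `g` across `q` and the sign `(-1)^(s m)` from passing it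
across `a` multiply to the sign for `q a`, of degree `i + m`. -/
theorem tmapBilin_balanced {s : ℤ} (g : DGMod.GHom s N N') {n n' : ℤ} (hn : n + s = n')
    {i m j l l' : ℤ} (h₁ : i + m = l) (h₂ : l + j = n) (h₃ : m + j = l')
    (h₄ : i + l' = n) (q : Q.deg i) (a : A.deg m) (x : N.deg j) :
    tmapBilin f g hn h₂ (Q.mul h₁ q (f.app m a)) x = tmapBilin f g hn h₄ q (N.act h₃ a x) := by
  rw [tmapBilin_apply f g hn h₂ (j' := j + s) rfl (by omega),
    tmapBilin_apply f g hn h₄ (j' := l' + s) rfl (by omega), g.app_act h₃ rfl rfl (by omega),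
    map_negOnePow_smul, smul_smul, ← Int.negOnePow_add, ← mul_add, h₁,
    tmk_mul f N' h₁ _ (l' := l' + s) (by omega) (by omega)]

/-- The map `q ⊗ x ↦ (-1)^{s |q|} q ⊗ g x` induced by a map `g` of degree `s`. -/
def tmap {s : ℤ} (g : DGMod.GHom s N N') {n n' : ℤ} (hn : n + s = n') :
    Tensor f N n →ₗ[R] Tensor f N' n' :=
  tlift f N (tmapBilin f g hn) (tmapBilin_balanced f g hn)

theorem tmap_tmk {s : ℤ} (g : DGMod.GHom s N N') {n n' : ℤ} (hn : n + s = n') {i j j' : ℤ}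
    (h : i + j = n) (hj : j + s = j') (h' : i + j' = n') (q : Q.deg i) (x : N.deg j) :
    tmap f g hn (tmk f N h q x) = (s * i).negOnePow • tmk f N' h' q (g.app hj x) :=
  (tlift_tmk f N _ _ h q x).trans (tmapBilin_apply f g hn h hj h' q x)

/-- `Q ⊗_A -` applied to a closed map. -/
def DGMod.GHom.Closed.tensor {s : ℤ} {g : DGMod.GHom s N N'} (hg : g.Closed) :
    Cpx.Map s (tensorCpx f N) (tensorCpx f N') where
  app := tmap f g
  comm {i j i' j'} hi h h' hj z := by
    induction z using tensor_induction with
    | h0 => simp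
    | hadd x y hx hy => simp only [map_add, hx, hy, smul_add]
    | htmk h₁ q x =>
      rename_i a b
      rw [tmap_tmk f g h h₁ (j' := b + s) rfl (by omega), map_negOnePow_smul,
        tensorD_tmk f N' (n' := j') (by omega) hj rfl rfl (by omega) (by omega),
        tensorD_tmk f N h₁ hi rfl rfl (by omega) (by omega), map_add, map_negOnePow_smul,
        tmap_tmk f g _ _ (j' := b + s) rfl (by omega),
        tmap_tmk f g _ _ (j' := b + s + 1) (by omega) (by omega),
        hg.comm rfl rfl (by omega) rfl, map_negOnePow_smul]
      have e : (s * a).negOnePow = s.negOnePow * (s * (a + 1)).negOnePow := by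
        rw [mul_add, mul_one, Int.negOnePow_add, mul_left_comm, Int.units_mul_self, mul_one]
      simp only [smul_add, smul_smul]
      congr 2
      ac_rfl

/-- The triangle obtained by applying `Q ⊗_A -` to a cone. -/
def coneTensorTriangle {g : DGMod.GHom 0 N N'} (hg : g.Closed) :
    Cpx.Triangle (tensorCpx f N) (tensorCpx f N') (tensorCpx f (DGMod.cone hg)) where
  g := hg.tensor f
  i := (DGMod.coneInl_closed hg).tensor f
  p := (DGMod.coneSnd_closed hg).tensor f
  -- The splitting of the cone is `A`-linear though not closed, so tensoring preserves it together
  -- with the identities of the cone. No flatness is needed; each field reduces to pure tensors.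
  s h := tmap f (DGMod.coneInr hg) (by omega)
  i_inj {n} := by
    refine Function.LeftInverse.injective (g := tmap f (DGMod.coneFst hg) (add_zero n)) fun y => ?_
    change tmap f _ (add_zero n) (tmap f _ (add_zero n) y) = y
    induction y using tensor_induction with
    | h0 => simp
    | hadd x y hx hy => rw [map_add, map_add, hx, hy]
    | htmk h q x =>
      rw [tmap_tmk f _ _ _ (add_zero _) h, map_negOnePow_smul, tmap_tmk f _ _ _ (add_zero _) h,
        DGMod.coneFst_coneInl]
      simp
  p_i {n m} h y := by
    change tmap f _ h (tmap f _ (add_zero n) y) = 0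
    induction y using tensor_induction with
    | h0 => simp
    | hadd x y hx hy => rw [map_add, map_add, hx, hy, add_zero]
    | htmk h q x =>
      rw [tmap_tmk f _ _ _ (add_zero _) h, map_negOnePow_smul, tmap_tmk f _ _ _ rfl (by omega),
        DGMod.coneSnd_coneInl]
      simp
  exact {n m} h c hc := by
    refine ⟨tmap f (DGMod.coneFst hg) (add_zero n) c, ?_⟩
    have key : tmap f (DGMod.coneInl hg) (add_zero n) (tmap f (DGMod.coneFst hg) (add_zero n) c) +
        tmap f (DGMod.coneInr hg) (by omega) (tmap f (DGMod.coneSnd hg) h c) = c := by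
      clear hc
      induction c using tensor_induction with
      | h0 => simp
      | hadd x y hx hy =>
        conv_rhs => rw [← hx, ← hy]
        simp only [map_add]
        abel
      | htmk h₁ q x =>
        rename_i a b
        rw [tmap_tmk f _ _ _ (add_zero _) h₁, map_negOnePow_smul,
          tmap_tmk f _ _ _ (add_zero _) h₁, tmap_tmk f _ _ _ rfl (by omega), map_negOnePow_smul,
          tmap_tmk f _ _ _ (by omega) h₁]
        rw [smul_smul, smul_smul, ← Int.negOnePow_add, ← Int.negOnePow_add]
        conv_rhs => rw [← DGMod.cone_decomp hg rfl (by omega) x, map_add]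
        simp
    have hc' : tmap f (DGMod.coneSnd hg) h c = 0 := hc
    rwa [hc', map_zero, add_zero] at key
  p_s {n m} h y := by
    change tmap f _ h (tmap f _ (by omega : m + -1 = n) y) = y
    induction y using tensor_induction with
    | h0 => simp
    | hadd x y hx hy => rw [map_add, map_add, hx, hy]
    | htmk h₁ q x =>
      rename_i a b
      rw [tmap_tmk f _ _ _ (j' := b - 1) (by omega) (by omega), map_negOnePow_smul,
        tmap_tmk f _ _ _ (j' := b) (by omega) h₁, DGMod.coneSnd_coneInr, smul_smul,
        ← Int.negOnePow_add]
      simp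
  d_s {n m l} h h' y := by
    change tensorD f _ h (tmap f _ (by omega : m + -1 = n) y) =
      tmap f _ (add_zero m) (tmap f _ (add_zero m) y) -
        tmap f _ (by omega : l + -1 = m) (tensorD f _ h' y)
    induction y using tensor_induction with
    | h0 => simp
    | hadd x y hx hy =>
      simp only [map_add, hx, hy]
      abel
    | htmk h₁ q x =>
      rename_i a b
      rw [tmap_tmk f _ _ _ (j' := b - 1) (by omega) (by omega), map_negOnePow_smul,
        tensorD_tmk f _ _ _ rfl (j' := b) (by omega) (by omega) h₁,
        DGMod.d_coneInr hg _ rfl _ (by omega), tmap_tmk f _ _ _ (add_zero _) h₁, map_negOnePow_smul,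
        tmap_tmk f _ _ _ (add_zero _) h₁, tensorD_tmk f _ _ _ rfl rfl (by omega) (by omega),
        map_add, map_negOnePow_smul,
        tmap_tmk f _ _ _ (j' := b - 1) (by omega) (by omega),
        tmap_tmk f _ _ _ (j' := b) (by omega) (by omega)]
      simp only [map_sub, smul_sub, smul_add, smul_smul, ← Int.negOnePow_add]
      have e : (-1 * (a + 1)).negOnePow = -(-1 * a).negOnePow := by
        rw [neg_one_mul, neg_one_mul, Int.negOnePow_neg, Int.negOnePow_neg, Int.negOnePow_succ]
      have e₁ : -1 * a + a = 0 := by ring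
      have e₂ : a + -1 * a = 0 := by ring
      have e₃ : 0 * a + 0 * a = 0 := by ring
      rw [e, e₁, e₂, e₃, Units.neg_smul]
      abel

/-- If `Q` is K-flat, then `Q ⊗_A -` preserves acyclic complexes. -/
theorem IsKFlat.subsingleton_H {f : Hom (RingHom.id R) A Q} (hf : IsKFlat f)
    (hN : ∀ i, Subsingleton (N.cpx.H i)) (j : ℤ) : Subsingleton ((tensorCpx f N).H j) := by
  refine Cpx.subsingleton_H _ (sub_add_cancel j 1) fun y hy => ?_
  refine hf N (fun {i j l} h h' x hx => ?_) (sub_add_cancel j 1) rfl y hy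
  exact (N.cpx.cls_eq_zero h (x := ⟨x, (N.cpx.mem_Z h').2 hx⟩)).1 ((hN j).elim _ _)

/-- If `Q` is K-flat and `N` has no cohomology above degree `m`, neither has `Q ⊗_A N`. -/
theorem IsKFlat.subsingleton_H_of_lt {f : Hom (RingHom.id R) A Q} (hf : IsKFlat f)
    {m : ℤ} (hN : ∀ i, m < i → Subsingleton (N.cpx.H i)) {j : ℤ} (hj : m < j) :
    Subsingleton ((tensorCpx f N).H j) := by
  let hc := N.incl_closed (N.tau m)
  have h := N.tau_bijective' hN
  -- The cone of `τ N → N` is acyclic and stays so after tensoring, by K-flatness. Hence the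
  -- cohomology of `Q ⊗_A τ N` surjects onto that of `Q ⊗_A N`.
  have hC := hf.subsingleton_H (N := DGMod.cone hc)
    (fun i => (DGMod.coneTriangle hc).subsingleton_C rfl (h _).2 (h _).1) j
  have hT : Subsingleton ((tensorCpx f (N.ofSub (N.tau m))).H j) := by
    refine Cpx.subsingleton_H_of_deg _ (subsingleton_of_forall_eq 0 fun z => ?_)
    induction z using tensor_induction with
    | h0 => rfl
    | hadd x y hx hy => rw [hx, hy, add_zero]
    | htmk h q x =>
      rename_i a b
      -- As `a + b = j > m`, either `a > 0`, where `Q` vanishes, or `b > m`, where the truncation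
      -- vanishes.
      rcases lt_or_ge 0 a with ha | ha
      · have := Q.subsingleton_of_pos a ha
        rw [Subsingleton.elim q 0, LinearMap.map_zero₂]
      · have := N.subsingleton_tau (m := m) (i := b) (by omega)
        rw [Subsingleton.elim x 0, map_zero]
  refine subsingleton_of_forall_eq 0 fun z => ?_
  obtain ⟨x, rfl⟩ := ((coneTensorTriangle f hc).exact_Y j z).1 (hC.elim _ _)
  rw [hT.elim x 0, map_zero]

end Tensor

end DAlg

namespace DAlg

variable {k R : Type u} [CommRing k] [CommRing R] [Algebra k R] {A Q : DAlg k R}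

/-! ## The comparison map `H^0(Q) ⊗ H^j(N) → H^j(Q ⊗_A N)` -/

/-- The class in `H^0(A)` of an element of `A^0`. -/
def mkH0 (A : DAlg k R) (a : A.deg 0) : A.H0.deg 0 := Submodule.Quotient.mk a

theorem mkH0_surjective (A : DAlg k R) (a : A.H0.deg 0) : ∃ b, A.mkH0 b = a :=
  Submodule.Quotient.mk_surjective _ a

namespace DGMod

theorem d_zero_act (N : DGMod A) {j l : ℤ} (h : j + 1 = l) (a : A.deg 0) (x : N.deg j) :
    N.d h (N.act (zero_add j) a x) = N.act (zero_add l) a (N.d h x) := by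
  have := A.subsingleton_of_pos (0 + 1) (by omega)
  have ha : A.d (rfl : (0 : ℤ) + 1 = 0 + 1) a = 0 := Subsingleton.elim _ _
  rw [N.leibniz (zero_add j) h rfl h (by omega) (zero_add l), ha]
  simp

/-- Multiplication `A^0 × H^j(N) → H^j(N)`. -/
def zeroH (N : DGMod A) (j : ℤ) : A.deg 0 →ₗ[R] N.cpx.H j →ₗ[R] N.cpx.H j where
  toFun a := Submodule.mapQ _ _ ((N.act (zero_add j) a).restrict (p := N.cpx.Z j)
      (q := N.cpx.Z j) (fun x hx => by
        rw [N.cpx.mem_Z rfl] at hx ⊢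
        rw [N.d_zero_act, hx, map_zero]))
    (by
      rintro ⟨x, hx⟩ ⟨y, rfl⟩
      exact ⟨N.act (zero_add _) a y, N.d_zero_act _ a y⟩)
  map_add' a b := by
    refine LinearMap.ext fun z => ?_
    obtain ⟨z, rfl⟩ := Submodule.Quotient.mk_surjective _ z
    refine congrArg (Submodule.Quotient.mk (p := (N.cpx.boundaries j).comap (N.cpx.Z j).subtype))
      (Subtype.ext ?_)
    simp [LinearMap.restrict_apply]
  map_smul' r a := by
    refine LinearMap.ext fun z => ?_
    obtain ⟨z, rfl⟩ := Submodule.Quotient.mk_surjective _ z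
    refine congrArg (Submodule.Quotient.mk (p := (N.cpx.boundaries j).comap (N.cpx.Z j).subtype))
      (Subtype.ext ?_)
    simp [LinearMap.restrict_apply]

theorem mem_trunc_zero {a : A.deg 0} (ha : a ∈ A.trunc.sub 0) :
    ∃ b, A.d (sub_add_cancel 0 1) b = a := by
  simpa [trunc, boundaries] using ha

/-- If `a = d b` and `z` is a cocycle, then `a z = d (b z)`. -/
theorem zeroH_eq_zero (N : DGMod A) (j : ℤ) {a : A.deg 0} (ha : a ∈ A.trunc.sub 0) :
    N.zeroH j a = 0 := by
  obtain ⟨b, rfl⟩ := mem_trunc_zero ha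
  refine LinearMap.ext fun z => ?_
  obtain ⟨⟨z, hz⟩, rfl⟩ := N.cpx.cls_surjective z
  refine (N.cpx.cls_eq_zero (sub_add_cancel j 1)).2 ⟨N.act (by omega) b z, ?_⟩
  rw [N.cpx.mem_Z rfl] at hz
  refine (N.leibniz _ _ (sub_add_cancel 0 1) (rfl : j + 1 = j + 1) (zero_add j) (by omega) b z
    ).trans ?_
  rw [hz]
  simp [LinearMap.restrict_apply]

/-- Multiplication `H^0(A) × H^j(N) → H^j(N)`. -/
def H0H (N : DGMod A) (j : ℤ) : A.H0.deg 0 →ₗ[R] N.cpx.H j →ₗ[R] N.cpx.H j :=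
  Submodule.liftQ (A.trunc.sub 0) (N.zeroH j) fun _ ha => N.zeroH_eq_zero j ha

/-- The cohomology `H^j(N)` of a dg module, as a module over `H^0(A)`. -/
def Coh (N : DGMod A) (j : ℤ) : Type u := N.cpx.H j

instance (N : DGMod A) (j : ℤ) : AddCommGroup (N.Coh j) :=
  inferInstanceAs (AddCommGroup (N.cpx.H j))

/-- The class of a cocycle. -/
def cls (N : DGMod A) {j : ℤ} (x : N.cpx.Z j) : N.Coh j := N.cpx.cls x

theorem cls_surjective (N : DGMod A) {j : ℤ} (x : N.Coh j) : ∃ z, N.cls z = x :=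
  N.cpx.cls_surjective x

instance (N : DGMod A) (j : ℤ) : Module (A.H0.deg 0) (N.Coh j) where
  smul a x := N.H0H j a x
  one_smul x := by
    obtain ⟨x, rfl⟩ := N.cls_surjective x
    exact congrArg N.cls (Subtype.ext (N.one_act _ x.1))
  mul_smul a b x := by
    obtain ⟨a, rfl⟩ := A.mkH0_surjective a
    obtain ⟨b, rfl⟩ := A.mkH0_surjective b
    obtain ⟨x, rfl⟩ := N.cls_surjective x
    exact congrArg N.cls (Subtype.ext (N.mul_act _ _ _ _ a b x.1))
  smul_zero a := map_zero (N.H0H j a)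
  smul_add a := map_add (N.H0H j a)
  add_smul a b x := LinearMap.map_add₂ (N.H0H j) a b x
  zero_smul x := LinearMap.map_zero₂ (N.H0H j) x

theorem zero_act_mem (N : DGMod A) {j : ℤ} (a : A.deg 0) (x : N.cpx.Z j) :
    N.act (zero_add j) a x.1 ∈ N.cpx.Z j := by
  rw [N.cpx.mem_Z rfl, N.d_zero_act, (N.cpx.mem_Z rfl).1 x.2, map_zero]

theorem mk_smul_cls (N : DGMod A) {j : ℤ} (a : A.deg 0) (x : N.cpx.Z j) :
    A.mkH0 a • N.cls x =
      N.cls ⟨N.act (zero_add j) a x.1, N.zero_act_mem a x⟩ := rfl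

variable {N N' : DGMod A}

/-- The map induced on cohomology by a closed map. -/
def GHom.Closed.cohMap {s : ℤ} {g : GHom s N N'} (hg : g.Closed) {i j : ℤ} (h : i + s = j) :
    N.Coh i →ₗ[A.H0.deg 0] N'.Coh j where
  toFun := hg.map.H h
  map_add' := map_add (hg.map.H h)
  map_smul' a x := by
    obtain ⟨a, rfl⟩ := A.mkH0_surjective a
    obtain ⟨x, rfl⟩ := N.cls_surjective x
    refine congrArg N'.cls (Subtype.ext ((g.app_act (zero_add i) h h (zero_add j) a x.1).trans ?_))
    rw [mul_zero, Int.negOnePow_zero, one_smul]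
    rfl

theorem GHom.Closed.cohMap_cls {s : ℤ} {g : GHom s N N'} (hg : g.Closed) {i j : ℤ} (h : i + s = j)
    (x : N.cpx.Z i) : hg.cohMap h (N.cls x) = N'.cls ⟨g.app h x, hg.map.mem_Z h x.2⟩ := rfl

end DGMod

/-- The module `H^0(Q)` over `H^0(A)`. -/
def H0Mod (_ : Hom (RingHom.id R) A Q) : Type u := Q.H0.deg 0

instance (f : Hom (RingHom.id R) A Q) : AddCommGroup (H0Mod f) :=
  inferInstanceAs (AddCommGroup (Q.H0.deg 0))

instance (f : Hom (RingHom.id R) A Q) : Module (A.H0.deg 0) (H0Mod f) :=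
  Module.compHom (Q.H0.deg 0) f.H0Map.ringHom

section Comparison

variable (f : Hom (RingHom.id R) A Q) (N : DGMod A)

/-- The class of an element of `Q^0`. -/
def H0Mod.mk (q : Q.deg 0) : H0Mod f := (Submodule.Quotient.mk q : Q.H0.deg 0)

theorem H0Mod.mk_surjective (t : H0Mod f) : ∃ q, H0Mod.mk f q = t :=
  Submodule.Quotient.mk_surjective _ t

theorem H0Mod.smul_mk (a : A.deg 0) (q : Q.deg 0) :
    A.mkH0 a • H0Mod.mk f q =
      H0Mod.mk f (Q.mul (zero_add 0) (f.app 0 a) q) := rfl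

theorem d_zero_tmk {j l : ℤ} (h : j + 1 = l) (q : Q.deg 0) (x : N.deg j) :
    tensorD f N h (tmk f N (zero_add j) q x) = tmk f N (zero_add l) q (N.d h x) := by
  have := Q.subsingleton_of_pos (0 + 1) (by omega)
  have hq : Q.d (rfl : (0 : ℤ) + 1 = 0 + 1) q = 0 := Subsingleton.elim _ _
  rw [tensorD_tmk f N (zero_add j) h rfl h (by omega) (zero_add l), hq]
  simp

theorem zero_tmk_mem {j : ℤ} (q : Q.deg 0) (x : N.cpx.Z j) :
    tmk f N (zero_add j) q x.1 ∈ (tensorCpx f N).Z j := by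
  rw [Cpx.mem_Z _ rfl]
  refine (d_zero_tmk f N rfl q x.1).trans ?_
  rw [(N.cpx.mem_Z rfl).1 x.2, map_zero]

/-- The map `H^j(N) → H^j(Q ⊗_A N)`, `[x] ↦ [q ⊗ x]`. -/
def tmkCoh (j : ℤ) (q : Q.deg 0) : N.cpx.H j →ₗ[R] (tensorCpx f N).H j :=
  Submodule.mapQ _ _ ((tmk f N (zero_add j) q).restrict (p := N.cpx.Z j)
      (q := (tensorCpx f N).Z j) fun x hx => zero_tmk_mem f N q ⟨x, hx⟩) (by
    rintro ⟨x, hx⟩ ⟨y, rfl⟩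
    exact ⟨tmk f N (zero_add _) q y, d_zero_tmk f N _ q y⟩)

theorem tmkCoh_cls (j : ℤ) (q : Q.deg 0) (x : N.cpx.Z j) :
    tmkCoh f N j q (N.cpx.cls x) = (tensorCpx f N).cls ⟨_, zero_tmk_mem f N q x⟩ := rfl

/-- If `q = d b` and `x` is a cocycle, then `q ⊗ x = d (b ⊗ x)`. So the class of `q ⊗ x` depends
only on the class of `q` in `H^0(Q)`. -/
theorem tmkCoh_eq_zero (j : ℤ) {q : Q.deg 0} (hq : q ∈ Q.trunc.sub 0) : tmkCoh f N j q = 0 := by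
  obtain ⟨b, rfl⟩ := DGMod.mem_trunc_zero hq
  refine LinearMap.ext fun z => ?_
  obtain ⟨x, rfl⟩ := N.cpx.cls_surjective z
  rw [tmkCoh_cls]
  refine (Cpx.cls_eq_zero _ (sub_add_cancel j 1)).2 ⟨tmk f N (by omega) b x.1, ?_⟩
  refine (tensorD_tmk f N _ _ (sub_add_cancel 0 1) (rfl : j + 1 = j + 1) (zero_add j) (by omega)
    b x.1).trans ?_
  rw [(N.cpx.mem_Z rfl).1 x.2]
  simp

/-- The bilinear map underlying the comparison map. -/
def compBilin (j : ℤ) : H0Mod f →+ N.Coh j →+ (tensorCpx f N).H j :=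
  QuotientAddGroup.lift (Q.trunc.sub 0).toAddSubgroup
    { toFun := fun q => (tmkCoh f N j q).toAddMonoidHom
      map_zero' := by
        refine AddMonoidHom.ext fun z => ?_
        obtain ⟨x, rfl⟩ := N.cpx.cls_surjective z
        refine congrArg (tensorCpx f N).cls (Subtype.ext ?_)
        simp
      map_add' := fun p q => by
        refine AddMonoidHom.ext fun z => ?_
        obtain ⟨x, rfl⟩ := N.cpx.cls_surjective z
        refine congrArg (tensorCpx f N).cls (Subtype.ext ?_)
        simp }
    (fun q hq => by
      refine AddMonoidHom.ext fun z => ?_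
      exact LinearMap.congr_fun (tmkCoh_eq_zero f N j hq) z)

theorem compBilin_mk (j : ℤ) (q : Q.deg 0) (x : N.cpx.Z j) :
    compBilin f N j (H0Mod.mk f q) (N.cls x) = (tensorCpx f N).cls ⟨_, zero_tmk_mem f N q x⟩ := rfl

/-- The comparison map `H^0(Q) ⊗ H^j(N) → H^j(Q ⊗_A N)`. -/
def comparison (j : ℤ) : H0Mod f ⊗[A.H0.deg 0] N.Coh j →+ (tensorCpx f N).H j :=
  TensorProduct.liftAddHom (compBilin f N j) (by
    intro a t x
    obtain ⟨a, rfl⟩ := A.mkH0_surjective a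
    obtain ⟨q, rfl⟩ := H0Mod.mk_surjective f t
    obtain ⟨x, rfl⟩ := N.cls_surjective x
    rw [DGMod.mk_smul_cls, H0Mod.smul_mk, compBilin_mk, compBilin_mk]
    refine congrArg (tensorCpx f N).cls (Subtype.ext ?_)
    dsimp only
    -- The scalar action on `H^0(Q)` multiplies by `f a` on the left, and the tensor relation on the
    -- right. In degree zero they agree, with no sign.
    rw [← tmk_mul f N (zero_add 0) (zero_add j), Q.mul_comm _ (zero_add 0)]
    simp)

theorem comparison_tmul (j : ℤ) (q : Q.deg 0) (x : N.cpx.Z j) :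
    comparison f N j (H0Mod.mk f q ⊗ₜ N.cls x) =
      (tensorCpx f N).cls ⟨_, zero_tmk_mem f N q x⟩ := rfl

variable {N} {N' : DGMod A}

/-- The comparison map is natural. -/
theorem comparison_natural {s : ℤ} {g : DGMod.GHom s N N'} (hg : g.Closed) {i j : ℤ}
    (h : i + s = j) (t : H0Mod f ⊗[A.H0.deg 0] N.Coh i) :
    comparison f N' j ((hg.cohMap h).lTensor (H0Mod f) t) =
      (hg.tensor f).H h (comparison f N i t) := by
  induction t using TensorProduct.induction_on with
  | zero => simp only [map_zero]
  | add x y hx hy => simp only [map_add, hx, hy]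
  | tmul q x =>
    obtain ⟨q, rfl⟩ := H0Mod.mk_surjective f q
    obtain ⟨x, rfl⟩ := N.cls_surjective x
    rw [LinearMap.lTensor_tmul, DGMod.GHom.Closed.cohMap_cls, comparison_tmul, comparison_tmul,
      Cpx.Map.H_cls]
    refine congrArg (tensorCpx f N').cls (Subtype.ext ?_)
    refine ((tmap_tmk f g h (zero_add i) h (zero_add j) q x.1).trans ?_).symm
    rw [mul_zero, Int.negOnePow_zero, one_smul]

/-! ### Four- and five-lemma arguments for the comparison map along a cone. -/

variable [Module.Flat (A.H0.deg 0) (H0Mod f)] {g : DGMod.GHom 0 N N'} (hg : g.Closed)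

/-- In this and the next two lemmas the long exact sequence of a cone stays exact after applying
`H^0(Q) ⊗ -`. Flatness of `H^0(Q)` enters the dévissage only here. -/
theorem lTensor_exact_Y (n : ℤ) :
    Function.Exact ((hg.cohMap (add_zero n)).lTensor (H0Mod f))
      (((DGMod.coneInl_closed hg).cohMap (add_zero n)).lTensor (H0Mod f)) :=
  Module.Flat.lTensor_exact (H0Mod f) ((DGMod.coneTriangle hg).exact_Y n)

theorem lTensor_exact_C {n m : ℤ} (h : n + 1 = m) :
    Function.Exact (((DGMod.coneInl_closed hg).cohMap (add_zero n)).lTensor (H0Mod f))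
      (((DGMod.coneSnd_closed hg).cohMap h).lTensor (H0Mod f)) :=
  Module.Flat.lTensor_exact (H0Mod f) ((DGMod.coneTriangle hg).exact_C h)

theorem lTensor_exact_X {n m : ℤ} (h : n + 1 = m) :
    Function.Exact (((DGMod.coneSnd_closed hg).cohMap h).lTensor (H0Mod f))
      ((hg.cohMap (add_zero m)).lTensor (H0Mod f)) :=
  Module.Flat.lTensor_exact (H0Mod f) ((DGMod.coneTriangle hg).exact_X h)

/-- Surjectivity of the comparison map for the target of `g`, from its source and cone. -/
theorem comparison_surjective_Y {n m : ℤ} (h : n + 1 = m)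
    (hX : Function.Surjective (comparison f N n))
    (hC : Function.Surjective (comparison f (DGMod.cone hg) n))
    (hX' : Function.Injective (comparison f N m)) :
    Function.Surjective (comparison f N' n) :=
  AddMonoidHom.surjective_of_surjective_of_surjective_of_injective
    ((hg.cohMap (add_zero n)).lTensor (H0Mod f)).toAddMonoidHom
    (((DGMod.coneInl_closed hg).cohMap (add_zero n)).lTensor (H0Mod f)).toAddMonoidHom
    (((DGMod.coneSnd_closed hg).cohMap h).lTensor (H0Mod f)).toAddMonoidHom
    ((hg.tensor f).H (add_zero n)).toAddMonoidHom
    (((DGMod.coneInl_closed hg).tensor f).H (add_zero n)).toAddMonoidHom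
    (((DGMod.coneSnd_closed hg).tensor f).H h).toAddMonoidHom
    (comparison f N n) (comparison f N' n) (comparison f (DGMod.cone hg) n) (comparison f N m)
    (AddMonoidHom.ext fun t => (comparison_natural f _ _ t).symm)
    (AddMonoidHom.ext fun t => (comparison_natural f _ _ t).symm)
    (AddMonoidHom.ext fun t => (comparison_natural f _ _ t).symm)
    (lTensor_exact_C f hg h) ((coneTensorTriangle f hg).exact_Y n)
    ((coneTensorTriangle f hg).exact_C h) hX hC hX'

/-- Injectivity of the comparison map for the target of `g`, from its source and cone. -/
theorem comparison_injective_Y {n m : ℤ} (h : n + 1 = m)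
    (hC : Function.Surjective (comparison f (DGMod.cone hg) n))
    (hX : Function.Injective (comparison f N m))
    (hC' : Function.Injective (comparison f (DGMod.cone hg) m)) :
    Function.Injective (comparison f N' m) :=
  AddMonoidHom.injective_of_surjective_of_injective_of_injective
    (((DGMod.coneSnd_closed hg).cohMap h).lTensor (H0Mod f)).toAddMonoidHom
    ((hg.cohMap (add_zero m)).lTensor (H0Mod f)).toAddMonoidHom
    (((DGMod.coneInl_closed hg).cohMap (add_zero m)).lTensor (H0Mod f)).toAddMonoidHom
    (((DGMod.coneSnd_closed hg).tensor f).H h).toAddMonoidHom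
    ((hg.tensor f).H (add_zero m)).toAddMonoidHom
    (((DGMod.coneInl_closed hg).tensor f).H (add_zero m)).toAddMonoidHom
    (comparison f (DGMod.cone hg) n) (comparison f N m) (comparison f N' m)
    (comparison f (DGMod.cone hg) m)
    (AddMonoidHom.ext fun t => (comparison_natural f _ _ t).symm)
    (AddMonoidHom.ext fun t => (comparison_natural f _ _ t).symm)
    (AddMonoidHom.ext fun t => (comparison_natural f _ _ t).symm)
    (lTensor_exact_X f hg h) (lTensor_exact_Y f hg m)
    ((coneTensorTriangle f hg).exact_X h) hC hX hC'

/-- The comparison map for the source of `g`, from its target and cone. -/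
theorem comparison_bijective_X {n m : ℤ} (h : n + 1 = m)
    (hY : Function.Surjective (comparison f N' n))
    (hC : Function.Bijective (comparison f (DGMod.cone hg) n))
    (hY' : Function.Bijective (comparison f N' m))
    (hC' : Function.Injective (comparison f (DGMod.cone hg) m)) :
    Function.Bijective (comparison f N m) :=
  AddMonoidHom.bijective_of_surjective_of_bijective_of_bijective_of_injective
    (((DGMod.coneInl_closed hg).cohMap (add_zero n)).lTensor (H0Mod f)).toAddMonoidHom
    (((DGMod.coneSnd_closed hg).cohMap h).lTensor (H0Mod f)).toAddMonoidHom
    ((hg.cohMap (add_zero m)).lTensor (H0Mod f)).toAddMonoidHom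
    (((DGMod.coneInl_closed hg).cohMap (add_zero m)).lTensor (H0Mod f)).toAddMonoidHom
    (((DGMod.coneInl_closed hg).tensor f).H (add_zero n)).toAddMonoidHom
    (((DGMod.coneSnd_closed hg).tensor f).H h).toAddMonoidHom
    ((hg.tensor f).H (add_zero m)).toAddMonoidHom
    (((DGMod.coneInl_closed hg).tensor f).H (add_zero m)).toAddMonoidHom
    (comparison f N' n) (comparison f (DGMod.cone hg) n) (comparison f N m) (comparison f N' m)
    (comparison f (DGMod.cone hg) m)
    (AddMonoidHom.ext fun t => (comparison_natural f _ _ t).symm)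
    (AddMonoidHom.ext fun t => (comparison_natural f _ _ t).symm)
    (AddMonoidHom.ext fun t => (comparison_natural f _ _ t).symm)
    (AddMonoidHom.ext fun t => (comparison_natural f _ _ t).symm)
    (lTensor_exact_C f hg h) (lTensor_exact_X f hg h) (lTensor_exact_Y f hg m)
    ((coneTensorTriangle f hg).exact_C h) ((coneTensorTriangle f hg).exact_X h)
    ((coneTensorTriangle f hg).exact_Y m) hY hC hY' hC'

end Comparison

end DAlg

namespace DAlg

variable {k R : Type u} [CommRing k] [CommRing R] [Algebra k R] {A Q : DAlg k R}

/-! ## Dévissage for the comparison map -/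

/-- The condition that `x` is the sum of almost all its components `e v x` is additive. -/
theorem exists_sum_eq_add {M V : Type*} [DecidableEq V] [AddCommMonoid M] (e : V → M →+ M) {x y : M}
    (hx : ∃ s : Finset V, ∀ s', s ⊆ s' → ∑ v ∈ s', e v x = x)
    (hy : ∃ s : Finset V, ∀ s', s ⊆ s' → ∑ v ∈ s', e v y = y) :
    ∃ s : Finset V, ∀ s', s ⊆ s' → ∑ v ∈ s', e v (x + y) = x + y := by
  obtain ⟨s, hs⟩ := hx
  obtain ⟨t, ht⟩ := hy
  -- Requiring the sum formula for every larger finite set is what allows one index set to serve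
  -- both `x` and `y`.
  refine ⟨s ∪ t, fun s' h => ?_⟩
  simp only [map_add, Finset.sum_add_distrib]
  rw [hs _ (Finset.subset_union_left.trans h), ht _ (Finset.subset_union_right.trans h)]

namespace DGMod

variable (E : DGMod A) (V : Type u) (m : ℤ)

/-- An element of a direct sum is the sum of its finitely many components. Written with closed
inclusions and projections, the formula survives both functors compared below, and so replaces the
assertion that they commute with direct sums. -/
theorem cell_exists_sum_eq {i j : ℤ} (h : i + m = j) (h' : j + -m = i) (x : (cell E V m).deg j) :
    ∃ s : Finset V, ∀ s', s ⊆ s' →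
      ∑ v ∈ s', (cellIncl E V m v).app h ((cellProj E V m v).app h' x) = x := by
  classical
  let e (v : V) : (cell E V m).deg j →+ (cell E V m).deg j :=
    (((cellIncl E V m v).app h).comp ((cellProj E V m v).app h')).toAddMonoidHom
  change ∃ s : Finset V, ∀ s', s ⊆ s' → ∑ v ∈ s', e v x = x
  induction x using cell_induction with
  | h0 => exact ⟨∅, fun s' _ => by simp⟩
  | hadd x y hx hy => exact exists_sum_eq_add e hx hy
  | hincl w h₁ x =>
    obtain rfl := (add_right_cancel (h₁.trans h.symm))
    refine ⟨{w}, fun s' hs => ?_⟩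
    rw [Finset.sum_eq_single_of_mem w (hs (Finset.mem_singleton_self w))]
    · exact congrArg ((cellIncl E V m w).app h) (cellProj_cellIncl E V m w h h' x)
    · intro v _ hv
      refine (congrArg ((cellIncl E V m v).app h)
        (cellProj_cellIncl_of_ne E V m hv.symm h h' x)).trans (map_zero _)

end DGMod

/-! ### The comparison map for direct sums of shifted copies of a module. -/

section Cell

variable (f : Hom (RingHom.id R) A Q) (E : DGMod A) (V : Type u) (m : ℤ)

open DGMod

theorem lTensor_cell_exists_sum_eq {i j : ℤ} (h : i + m = j) (h' : j + -m = i)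
    (t : H0Mod f ⊗[A.H0.deg 0] (cell E V m).Coh j) :
    ∃ s : Finset V, ∀ s', s ⊆ s' →
      ∑ v ∈ s', ((cellIncl_closed E V m v).cohMap h).lTensor (H0Mod f)
        (((cellProj_closed E V m v).cohMap h').lTensor (H0Mod f) t) = t := by
  classical
  let e (v : V) : H0Mod f ⊗[A.H0.deg 0] (cell E V m).Coh j →+
      H0Mod f ⊗[A.H0.deg 0] (cell E V m).Coh j :=
    ((((cellIncl_closed E V m v).cohMap h).lTensor (H0Mod f)).comp
        (((cellProj_closed E V m v).cohMap h').lTensor (H0Mod f))).toAddMonoidHom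
  change ∃ s : Finset V, ∀ s', s ⊆ s' → ∑ v ∈ s', e v t = t
  induction t using TensorProduct.induction_on with
  | zero => exact ⟨∅, fun s' _ => by simp⟩
  | add x y hx hy => exact exists_sum_eq_add e hx hy
  | tmul q x =>
    obtain ⟨x, rfl⟩ := DGMod.cls_surjective _ x
    obtain ⟨s, hs⟩ := cell_exists_sum_eq E V m h h' x.1
    refine ⟨s, fun s' hs' => ?_⟩
    have e₁ (v : V) : e v (q ⊗ₜ DGMod.cls _ x) = q ⊗ₜ ((cellIncl_closed E V m v).cohMap h)
        (((cellProj_closed E V m v).cohMap h') (DGMod.cls _ x)) := rfl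
    rw [Finset.sum_congr rfl fun v _ => e₁ v, ← TensorProduct.tmul_sum]
    congr 1
    have e₂ (v : V) : ((cellIncl_closed E V m v).cohMap h)
        (((cellProj_closed E V m v).cohMap h') (DGMod.cls _ x)) =
        DGMod.cls _ ⟨_, (cellIncl_closed E V m v).map.mem_Z h
          ((cellProj_closed E V m v).map.mem_Z h' x.2)⟩ := rfl
    rw [Finset.sum_congr rfl fun v _ => e₂ v]
    refine (map_sum ((Submodule.mkQ _ : (cell E V m).cpx.Z j →ₗ[R] (cell E V m).cpx.H j)) _ _
      ).symm.trans (congrArg (Cpx.cls _) (Subtype.ext ?_))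
    rw [AddSubmonoidClass.coe_finsetSum]
    exact hs s' hs'

theorem tensor_cell_exists_sum_eq {i j : ℤ} (h : i + m = j) (h' : j + -m = i)
    (t : (tensorCpx f (cell E V m)).H j) :
    ∃ s : Finset V, ∀ s', s ⊆ s' → ∑ v ∈ s', ((cellIncl_closed E V m v).tensor f).H h
      (((cellProj_closed E V m v).tensor f).H h' t) = t := by
  classical
  let e (v : V) : Tensor f (cell E V m) j →+ Tensor f (cell E V m) j :=
    ((tmap f (cellIncl E V m v) h).comp (tmap f (cellProj E V m v) h')).toAddMonoidHom
  have key (z : Tensor f (cell E V m) j) :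
      ∃ s : Finset V, ∀ s', s ⊆ s' → ∑ v ∈ s', e v z = z := by
    induction z using tensor_induction with
    | h0 => exact ⟨∅, fun s' _ => by simp⟩
    | hadd x y hx hy => exact exists_sum_eq_add e hx hy
    | htmk h₁ q x =>
      rename_i a b
      obtain ⟨s, hs⟩ := cell_exists_sum_eq E V m (i := b - m) (by omega) (by omega) x
      refine ⟨s, fun s' hs' => ?_⟩
      have e₁ (v : V) : e v (tmk f _ h₁ q x) = tmk f _ h₁ q ((cellIncl E V m v).app (by omega)
          ((cellProj E V m v).app (j := b - m) (by omega) x)) := by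
        change tmap f _ h (tmap f _ h' _) = _
        rw [tmap_tmk f _ h' h₁ (j' := b - m) (by omega) (by omega), map_negOnePow_smul,
          tmap_tmk f _ h _ (j' := b) (by omega) h₁, smul_smul, neg_mul, Int.negOnePow_neg,
          Int.units_mul_self, one_smul]
      rw [Finset.sum_congr rfl fun v _ => e₁ v, ← map_sum, hs s' hs']
  obtain ⟨z, rfl⟩ := Cpx.cls_surjective _ t
  obtain ⟨s, hs⟩ := key z.1
  refine ⟨s, fun s' hs' => ?_⟩
  have e₂ (v : V) : ((cellIncl_closed E V m v).tensor f).H h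
        (((cellProj_closed E V m v).tensor f).H h' (Cpx.cls _ z)) =
        Cpx.cls _ ⟨_, ((cellIncl_closed E V m v).tensor f).mem_Z h
          (((cellProj_closed E V m v).tensor f).mem_Z h' z.2)⟩ := rfl
  rw [Finset.sum_congr rfl fun v _ => e₂ v]
  refine (map_sum ((Submodule.mkQ _ : (tensorCpx f (cell E V m)).Z j →ₗ[R]
    (tensorCpx f (cell E V m)).H j)) _ _).symm.trans (congrArg (Cpx.cls _) (Subtype.ext ?_))
  rw [AddSubmonoidClass.coe_finsetSum]
  exact hs s' hs'

/-- The comparison map commutes with direct sums and shifts. -/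
theorem comparison_cell {i j : ℤ} (h : i + m = j) (hE : Function.Bijective (comparison f E i)) :
    Function.Bijective (comparison f (cell E V m) j) := by
  have h' : j + -m = i := by omega
  constructor
  · refine (injective_iff_map_eq_zero _).2 fun t ht => ?_
    obtain ⟨s, hs⟩ := lTensor_cell_exists_sum_eq f E V m h h' t
    rw [← hs s subset_rfl]
    refine Finset.sum_eq_zero fun v _ => ?_
    -- By naturality each component of `t` is killed by the comparison map of `E`, which is
    -- injective.
    have : ((cellProj_closed E V m v).cohMap h').lTensor (H0Mod f) t = 0 := hE.1 (by
      rw [comparison_natural, ht, map_zero, map_zero])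
    rw [this, map_zero]
  · intro z
    obtain ⟨s, hs⟩ := tensor_cell_exists_sum_eq f E V m h h' z
    choose t ht using fun v => hE.2 (((cellProj_closed E V m v).tensor f).H h' z)
    refine ⟨∑ v ∈ s, ((cellIncl_closed E V m v).cohMap h).lTensor (H0Mod f) (t v), ?_⟩
    rw [map_sum]
    conv_rhs => rw [← hs s subset_rfl]
    refine Finset.sum_congr rfl fun v _ => ?_
    rw [comparison_natural, ht]

end Cell

/-! ### The two dévissages: from a generator, and from modules over `H^0(A)`. -/

section Devissage

variable (f : Hom (RingHom.id R) A Q)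

theorem comparison_bijective_of_subsingleton {N : DGMod A} {j : ℤ} (hN : Subsingleton (N.cpx.H j))
    (hT : Subsingleton ((tensorCpx f N).H j)) : Function.Bijective (comparison f N j) := by
  have : Subsingleton (N.Coh j) := hN
  have : Subsingleton (H0Mod f ⊗[A.H0.deg 0] N.Coh j) := inferInstance
  exact ⟨fun _ _ _ => Subsingleton.elim _ _, fun _ => ⟨0, Subsingleton.elim _ _⟩⟩

variable {f} [Module.Flat (A.H0.deg 0) (H0Mod f)]

open DGMod

/-- If `E` generates a class of dg modules stable under cones and the comparison map of `E` is
bijective, then the comparison map is bijective for all bounded above dg modules of the class. -/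
theorem comparison_bijective_of_generator (hf : IsKFlat f) (E : DGMod A)
    (hE₀ : ∀ i, 0 < i → Subsingleton (E.deg i))
    (hE : ∀ i, Function.Bijective (comparison f E i)) (P : DGMod A → Prop)
    (hcone : ∀ {V : Type u} {m : ℤ} {N : DGMod A} {g : GHom 0 (cell E V m) N} (hg : g.Closed),
      P N → P (cone hg))
    (hgen : ∀ N, P N → ∀ {m : ℤ} (x : N.cpx.Z m), ∃ φ : GHom m E N, φ.Closed ∧
      ∃ e ∈ E.cpx.Z 0, φ.app (zero_add m) e = x.1)
    {N : DGMod A} (hN : P N) {m : ℤ} (hm : ∀ i, m < i → Subsingleton (N.cpx.H i)) (j : ℤ) :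
    Function.Bijective (comparison f N j) := by
  -- The induction is on the distance `n` below the bound `m`, for all `N` and `m` at once, since it
  -- is applied to cones having a smaller bound. For `n = 0` both sides vanish.
  suffices H : ∀ (n : ℕ) (N : DGMod A) (m : ℤ), P N → (∀ i, m < i → Subsingleton (N.cpx.H i)) →
      ∀ j, m - n < j → Function.Bijective (comparison f N j) from
    H (m - j + 1).toNat N m hN hm j (by omega)
  intro n
  induction n with
  | zero =>
    intro N m hN hm j hj
    exact comparison_bijective_of_subsingleton f (hm j (by omega))
      (hf.subsingleton_H_of_lt hm (by omega))
  | succ n ih =>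
    -- One copy of `E` is attached for each cocycle of degree `m`. The resulting map is onto
    -- `H^m(N)` and its source vanishes above `m`, so the cone has no cohomology above `m - 1`.
    have key (N : DGMod A) (m : ℤ) (hN : P N) (hm : ∀ i, m < i → Subsingleton (N.cpx.H i)) :
        ∃ (V : Type u) (g : GHom 0 (cell E V m) N) (hg : g.Closed), P (cone hg) ∧
          ∀ i, m - 1 < i → Subsingleton ((cone hg).cpx.H i) := by
      choose φ hφ e he h using fun x : N.cpx.Z m => hgen N hN x
      refine ⟨N.cpx.Z m, cellDesc φ, cellDesc_closed hφ, hcone _ hN, fun i hi => ?_⟩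
      refine (coneTriangle (cellDesc_closed hφ)).subsingleton_C rfl ?_ ?_
      · rcases (by omega : m < i ∨ m = i) with hi | rfl
        · exact fun x => ⟨0, (hm i hi).elim _ _⟩
        · intro x
          obtain ⟨x, rfl⟩ := Cpx.cls_surjective _ x
          refine ⟨Cpx.cls _ ⟨_, (cellIncl_closed E _ m x).map.mem_Z (zero_add m) (he x)⟩, ?_⟩
          rw [Cpx.Map.H_cls]
          exact congrArg (Cpx.cls _) (Subtype.ext ((cellDesc_cellIncl φ x _ _).trans (h x)))
      · have := Cpx.subsingleton_H_of_deg (cell E (N.cpx.Z m) m).cpx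
          (subsingleton_cell E _ m hE₀ (i := i + 1) (by omega))
        exact fun _ _ _ => Subsingleton.elim _ _
    -- Surjectivity comes first and for all modules: injectivity for `N` in degree `j` uses
    -- surjectivity for the cone in degree `j - 1`, just outside the range of the induction
    -- hypothesis.
    have surj (N : DGMod A) (m : ℤ) (hN : P N) (hm : ∀ i, m < i → Subsingleton (N.cpx.H i))
        (j : ℤ) (hj : m - n ≤ j) : Function.Surjective (comparison f N j) := by
      obtain ⟨V, g, hg, hP, hC⟩ := key N m hN hm
      exact comparison_surjective_Y f hg rfl
        (comparison_cell f E V m (sub_add_cancel j m) (hE _)).2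
        (ih _ _ hP hC j (by omega)).2 (comparison_cell f E V m (sub_add_cancel _ m) (hE _)).1
    intro N m hN hm j hj
    refine ⟨?_, surj N m hN hm j (by push_cast at hj; omega)⟩
    obtain ⟨V, g, hg, hP, hC⟩ := key N m hN hm
    push_cast at hj
    exact comparison_injective_Y f hg (sub_add_cancel j 1)
        (surj _ _ hP hC _ (by omega))
        (comparison_cell f E V m (sub_add_cancel j m) (hE _)).1
        (ih _ _ hP hC j (by omega)).1

/-- The part of degrees different from `m` and the boundaries of degree `m`, in a dg module
concentrated in degrees at most `m`. -/
def DGMod.belowTop (N : DGMod A) (m : ℤ) (hN : ∀ i, m < i → Subsingleton (N.deg i)) : N.Sub where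
  sub i := if i = m then N.cpx.boundaries i else ⊤
  act_mem {i j n} h a x hx := by
    rcases lt_or_ge 0 i with hi | hi
    · have := A.subsingleton_of_pos i hi
      rw [Subsingleton.elim a 0]
      simp
    · split_ifs with hn
      · rcases hi.lt_or_eq with hi | rfl
        · have := hN j (by omega)
          rw [Subsingleton.elim x 0, map_zero]
          exact zero_mem _
        · obtain rfl : j = n := by omega
          rw [if_pos hn] at hx
          obtain ⟨y, rfl⟩ := hx
          exact ⟨N.act (zero_add _) a y, N.d_zero_act _ a y⟩
      · trivial
  d_mem {i j} h x _ := by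
    split_ifs with hj
    · exact (N.cpx.mem_boundaries h).2 ⟨x, rfl⟩
    · trivial

theorem DGMod.mem_belowTop_of_ne {N : DGMod A} {m : ℤ} (hN : ∀ i, m < i → Subsingleton (N.deg i))
    {i : ℤ} (hi : i ≠ m) (x : N.deg i) : x ∈ (N.belowTop m hN).sub i := by
  change x ∈ (if i = m then N.cpx.boundaries i else ⊤ : Submodule R _)
  rw [if_neg hi]
  trivial

theorem DGMod.mem_belowTop {N : DGMod A} {m : ℤ} (hN : ∀ i, m < i → Subsingleton (N.deg i))
    {x : N.deg m} : x ∈ (N.belowTop m hN).sub m ↔ x ∈ N.cpx.boundaries m := by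
  change x ∈ (if m = m then N.cpx.boundaries m else ⊤ : Submodule R _) ↔ _
  rw [if_pos rfl]

/-- A dg module annihilated by the kernel of `A → H^0(A)`. -/
def DGMod.IsTruncated (N : DGMod A) : Prop :=
  ∀ {i j n : ℤ} (h : i + j = n) (a : A.deg i) (x : N.deg j), a ∈ A.trunc.sub i → N.act h a x = 0

/-- As `N` vanishes above `m`, every element of degree `m` is a cocycle. The quotient is therefore
`H^m(N)` placed in degree `m`. -/
theorem DGMod.subsingleton_quot_belowTop {N : DGMod A} {m : ℤ}
    (hN : ∀ i, m < i → Subsingleton (N.deg i)) {i : ℤ} (hi : i ≠ m) :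
    Subsingleton ((N.quot (N.belowTop m hN)).deg i) := by
  refine subsingleton_of_forall_eq 0 fun x => ?_
  obtain ⟨x, rfl⟩ := Submodule.Quotient.mk_surjective _ x
  exact (Submodule.Quotient.mk_eq_zero _).2 (mem_belowTop_of_ne hN hi x)

/-- Elements of negative degree can reach degree `m` only from above it, where `N` is zero. A
boundary `d b` of degree zero sends `x` of degree `m` to `d (b x)`, because `d x = 0`. -/
theorem DGMod.isTruncated_quot_belowTop {N : DGMod A} {m : ℤ}
    (hN : ∀ i, m < i → Subsingleton (N.deg i)) : (N.quot (N.belowTop m hN)).IsTruncated := by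
  intro i j n h a x ha
  rcases eq_or_ne n m with rfl | hn
  · obtain ⟨x, rfl⟩ := Submodule.Quotient.mk_surjective _ x
    refine (Submodule.Quotient.mk_eq_zero _).2 ((mem_belowTop hN).2 ?_)
    rcases lt_trichotomy i 0 with hi | rfl | hi
    · have := hN j (by omega)
      rw [Subsingleton.elim x 0, map_zero]
      exact zero_mem _
    · obtain rfl : j = n := by omega
      obtain ⟨b, rfl⟩ := mem_trunc_zero ha
      have := hN (j + 1) (by omega)
      refine (N.cpx.mem_boundaries (sub_add_cancel j 1)).2 ⟨N.act (by omega) b x, ?_⟩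
      rw [N.leibniz _ _ (sub_add_cancel 0 1) (rfl : j + 1 = j + 1) h (by omega) b x,
        Subsingleton.elim (N.d rfl x) 0]
      simp
    · have := A.subsingleton_of_pos i hi
      rw [Subsingleton.elim a 0, LinearMap.map_zero₂]
      exact zero_mem _
  · have := subsingleton_quot_belowTop hN hn
    exact Subsingleton.elim _ _

/-- The comparison map is bijective for all bounded above dg modules if it is so for those
over `H^0(A)`. -/
theorem comparison_bijective_of_isTruncated (hf : IsKFlat f)
    (hD : ∀ (N : DGMod A), N.IsTruncated → ∀ m, (∀ i, m < i → Subsingleton (N.cpx.H i)) →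
      ∀ j, Function.Bijective (comparison f N j))
    {N : DGMod A} {m : ℤ} (hm : ∀ i, m < i → Subsingleton (N.cpx.H i)) (j : ℤ) :
    Function.Bijective (comparison f N j) := by
  suffices H : ∀ (n : ℕ) (N : DGMod A) (m : ℤ), (∀ i, m < i → Subsingleton (N.cpx.H i)) →
      ∀ j, m - n < j → Function.Bijective (comparison f N j) from
    H (m - j + 1).toNat N m hm j (by omega)
  intro n
  induction n with
  | zero =>
    intro N m hm j hj
    exact comparison_bijective_of_subsingleton f (hm j (by omega))
      (hf.subsingleton_H_of_lt hm (by omega))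
  | succ n ih =>
    intro N m hm j hj
    push_cast at hj
    have hτ : ∀ i, m < i → Subsingleton ((N.ofSub (N.tau m)).deg i) :=
      fun i hi => N.subsingleton_tau hi
    -- For the truncation `T`, the comparison map is deduced from those of its top cohomology `D`,
    -- covered by `hD`, and of the cone of `T → D`, covered by induction.
    have key (j : ℤ) (hj : m - n ≤ j) :
        Function.Bijective (comparison f (N.ofSub (N.tau m)) j) := by
      let T := N.ofSub (N.tau m)
      let D := T.quot (T.belowTop m hτ)
      let hc := T.proj_closed (T.belowTop m hτ)
      have hD' := hD D (isTruncated_quot_belowTop hτ) m fun i hi =>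
        Cpx.subsingleton_H_of_deg _ (subsingleton_quot_belowTop hτ (by omega))
      -- The cone removes `H^m(T)` and shifts the remaining cohomology down by one, so its bound
      -- drops by two. The induction hypothesis then covers both degrees `j - 1` and `j` needed by
      -- the five lemma.
      have hC : ∀ i, m - 2 < i → Subsingleton ((cone hc).cpx.H i) := by
        intro i hi
        refine (coneTriangle hc).subsingleton_C rfl ?_ ?_
        · rcases eq_or_ne i m with rfl | hi
          · intro x
            obtain ⟨⟨x, hx⟩, rfl⟩ := Cpx.cls_surjective _ x
            obtain ⟨x, rfl⟩ := Submodule.Quotient.mk_surjective _ x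
            have := hτ (i + 1) (by omega)
            exact ⟨Cpx.cls _ ⟨x, (T.cpx.mem_Z rfl).2 (Subsingleton.elim _ _)⟩, rfl⟩
          · have := Cpx.subsingleton_H_of_deg D.cpx (subsingleton_quot_belowTop hτ hi)
            exact fun x => ⟨0, Subsingleton.elim _ _⟩
        · rcases (by omega : m < i + 1 ∨ i + 1 = m) with hi | rfl
          · have := Cpx.subsingleton_H_of_deg T.cpx (hτ (i + 1) hi)
            exact fun _ _ _ => Subsingleton.elim _ _
          · refine (injective_iff_map_eq_zero _).2 fun x hx => ?_
            obtain ⟨x, rfl⟩ := Cpx.cls_surjective _ x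
            obtain ⟨y, hy⟩ := (Cpx.cls_eq_zero _ rfl).1 hx
            have := subsingleton_quot_belowTop hτ (i := i) (by omega)
            rw [Subsingleton.elim y 0, map_zero] at hy
            have := (Submodule.Quotient.mk_eq_zero _).1 hy.symm
            exact (Cpx.cls_eq_zero _ rfl).2
              ((T.cpx.mem_boundaries rfl).1 ((mem_belowTop hτ).1 this))
      exact comparison_bijective_X f hc (sub_add_cancel j 1) (hD' _).2
        (ih _ _ hC _ (by omega)) (hD' _) (ih _ _ hC _ (by omega)).1
    -- Passage from `τ N` back to `N`: the cone of the inclusion is acyclic, also after tensoring,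
    -- so its comparison map is trivially bijective.
    let hc := N.incl_closed (N.tau m)
    have h := N.tau_bijective' hm
    have hC : ∀ i, Subsingleton ((cone hc).cpx.H i) :=
      fun i => (coneTriangle hc).subsingleton_C rfl (h _).2 (h _).1
    have hC' (i : ℤ) : Function.Bijective (comparison f (cone hc) i) :=
      comparison_bijective_of_subsingleton f (hC i) (hf.subsingleton_H hC i)
    exact ⟨comparison_injective_Y f hc (sub_add_cancel j 1) (hC' _).2 (key j (by omega)).1
        (hC' _).1,
      comparison_surjective_Y f hc rfl (key j (by omega)).2 (hC' _).2 (key _ (by omega)).1⟩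

end Devissage

end DAlg

/-- A degreewise bijective map of complexes induces bijections on cohomology. -/
theorem Cpx.Map.bijective_H {R : Type u} [CommRing R] {C D : Cpx R} (g : Cpx.Map 0 C D)
    (hg : ∀ i, Function.Bijective (g.app (add_zero i))) (i : ℤ) :
    Function.Bijective (g.H (add_zero i)) := by
  have comm {i j : ℤ} (h : i + 1 = j) (x : C.deg i) :
      D.d h (g.app (add_zero i) x) = g.app (add_zero j) (C.d h x) := by
    simpa using g.comm h (add_zero i) (add_zero j) h x
  constructor
  · refine (injective_iff_map_eq_zero _).2 fun x hx => ?_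
    obtain ⟨x, rfl⟩ := C.cls_surjective x
    obtain ⟨y, hy⟩ := (D.cls_eq_zero (sub_add_cancel i 1)).1 hx
    obtain ⟨y, rfl⟩ := (hg _).2 y
    exact (C.cls_eq_zero (sub_add_cancel i 1)).2 ⟨y, (hg i).1 ((comm _ y).symm.trans hy)⟩
  · intro y
    obtain ⟨⟨y, hy⟩, rfl⟩ := D.cls_surjective y
    obtain ⟨x, rfl⟩ := (hg _).2 y
    refine ⟨C.cls ⟨x, (C.mem_Z rfl).2 ((hg _).1 ?_)⟩, rfl⟩
    rw [← comm, (D.mem_Z rfl).1 hy, map_zero]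

open DGDAlgebra in
/-- A recognition principle for base change along a ring homomorphism. -/
theorem isBaseChangeAlong_iff {S T M N : Type u} [CommRing S] [CommRing T] (φ : S →+* T)
    [AddCommGroup M] [Module S M] [AddCommGroup N] [Module T N] (g : M →ₛₗ[φ] N)
    {T' M' W : Type u} [AddCommGroup T'] [Module S T'] [AddCommGroup M'] [Module S M']
    [AddCommGroup W] (e : T' ≃+ T) (he : ∀ s t, e (s • t) = φ s * e t) (m : M' ≃ₗ[S] M)
    (w : N →+ W) (hw : Function.Bijective w) (c : T' ⊗[S] M' →+ W)
    (hc : ∀ t x, c (t ⊗ₜ x) = w (e t • g (m x))) :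
    IsBaseChangeAlong φ g ↔ Function.Bijective c := by
  let _ : Algebra S T := φ.toAlgebra
  let _ : Module S N := Module.compHom N φ
  have : IsScalarTower S T N := ⟨fun s t n => mul_smul (φ s) t n⟩
  let g' : M →ₗ[S] N := { toFun := g, map_add' := map_add g, map_smul' := g.map_smulₛₗ }
  let e' : T' ≃ₗ[S] T := { e with map_smul' := he }
  let l := TensorProduct.lift
    (((Algebra.linearMap T <| Module.End T (M →ₗ[S] N)).flip g').restrictScalars S)
  have key : (c : T' ⊗[S] M' → W) = w ∘ l ∘ TensorProduct.congr e' m := by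
    funext z
    induction z using TensorProduct.induction_on with
    | zero => simp
    | add x y hx hy =>
      simp only [Function.comp_apply, map_add] at hx hy ⊢
      rw [hx, hy]
    | tmul t x => exact hc t x
  -- By definition, base change means that the linear map `l` induced by `g'` is bijective. By
  -- `key`, `c` differs from it only by bijections.
  change Function.Bijective l ↔ _
  rw [key, hw.of_comp_iff', Function.Bijective.of_comp_iff _ (LinearEquiv.bijective _)]

namespace DAlg

variable {k R : Type u} [CommRing k] [CommRing R] [Algebra k R] {A Q : DAlg k R}

/-! ## Base change to `H^0(A)` -/

section Cyclic

variable (f : Hom (RingHom.id R) A Q)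

/-- When `e` generates `N`, every tensor is of the form `q ⊗ e`. The lemmas below treat `A` and
`H^0(A)` in this way, with `e` the class of `1`. -/
theorem tmk_eq_of_cyclic (N : DGMod A) (e : N.deg 0) {i j n : ℤ} (h : i + j = n) (q : Q.deg i)
    (a : A.deg j) :
    tmk f N h q (N.act (add_zero j) a e) =
      tmk f N (add_zero n) (Q.mul h q (f.app j a)) e :=
  (tmk_mul f N h (add_zero n) (add_zero j) h q a e).symm

/-- The map `q ↦ q ⊗ e` for a cocycle `e` of degree zero. -/
def tmkMap (N : DGMod A) (e : N.cpx.Z 0) : Cpx.Map 0 Q.asMod.cpx (tensorCpx f N) where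
  app {i j} h := (tmk f N h).flip e.1
  comm {i j i' j'} hi h h' hj q := by
    refine (tensorD_tmk f N h hj hi rfl h' (by omega) q e.1).trans ?_
    rw [(N.cpx.mem_Z rfl).1 e.2, map_zero, smul_zero, add_zero, Int.negOnePow_zero, one_smul]
    rfl

theorem tmkMap_surjective (N : DGMod A) (e : N.cpx.Z 0)
    (he : ∀ {j : ℤ} (x : N.deg j), ∃ a, N.act (add_zero j) a e.1 = x) (n : ℤ) :
    Function.Surjective ((tmkMap f N e).app (add_zero n)) := by
  intro z
  induction z using tensor_induction with
  | h0 => exact ⟨0, map_zero _⟩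
  | hadd x y hx hy =>
    obtain ⟨x, rfl⟩ := hx
    obtain ⟨y, rfl⟩ := hy
    exact ⟨x + y, map_add _ _ _⟩
  | htmk h q x =>
    obtain ⟨a, rfl⟩ := he x
    exact ⟨_, (tmk_eq_of_cyclic f N e.1 h q a).symm⟩

theorem mem_trunc_zero (A : DAlg k R) {a : A.deg 0} :
    a ∈ A.trunc.sub 0 ↔ a ∈ A.boundaries 0 := by
  simp [trunc]

theorem one_mem_Z (A : DAlg k R) : A.one ∈ A.asMod.cpx.Z 0 := by
  have := A.subsingleton_of_pos (0 + 1) (by omega)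
  exact (Cpx.mem_Z _ rfl).2 (Subsingleton.elim _ _)

theorem mul_one' (A : DAlg k R) {i : ℤ} (a : A.deg i) : A.mul (add_zero i) a A.one = a := by
  rw [A.mul_comm _ (zero_add i), A.one_mul]
  simp

/-- The isomorphism `Q ≃ Q ⊗_A A`. -/
def unitMap : Cpx.Map 0 Q.asMod.cpx (tensorCpx f A.asMod) :=
  tmkMap f A.asMod ⟨A.one, A.one_mem_Z⟩

/-- The inverse is `q ⊗ a ↦ q f(a)`. -/
theorem unitMap_bijective (i : ℤ) : Function.Bijective ((unitMap f).app (add_zero i)) := by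
  refine ⟨?_, tmkMap_surjective f _ _ (fun x => ⟨x, A.mul_one' x⟩) i⟩
  refine Function.LeftInverse.injective (g := tlift f A.asMod (n := i)
    (fun {a b} h => (Q.mul h).compl₂ (f.app b)) ?_) fun q => ?_
  · intro i m j l l' h₁ h₂ h₃ h₄ q a x
    change Q.mul h₂ (Q.mul h₁ q (f.app m a)) (f.app j x) = Q.mul h₄ q (f.app l' (A.mul h₃ a x))
    rw [f.map_mul, Q.mul_assoc]
  · refine (tlift_tmk f A.asMod _ _ (add_zero i) q A.one).trans ?_
    change Q.mul _ q (f.app 0 A.one) = q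
    rw [f.map_one, Q.mul_one']

/-- The class of `1` in the dg module `H^0(A)`. -/
def oneH0 (A : DAlg k R) : (A.asMod.quot A.trunc.toSub).cpx.Z 0 :=
  ⟨Submodule.Quotient.mk A.one, by
    have := A.H0.subsingleton_of_pos (0 + 1) (by omega)
    exact (Cpx.mem_Z _ rfl).2 (Subsingleton.elim (α := A.H0.deg (0 + 1)) _ _)⟩

/-- The map `Q → Q ⊗_A H^0(A)`. -/
def toTensorH0 : Cpx.Map 0 Q.asMod.cpx (tensorCpx f (A.asMod.quot A.trunc.toSub)) :=
  tmkMap f _ A.oneH0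

theorem toTensorH0_surjective (i : ℤ) :
    Function.Surjective ((toTensorH0 f).app (add_zero i)) := by
  refine tmkMap_surjective f _ _ (fun {j} x => ?_) i
  obtain ⟨x, rfl⟩ := Submodule.Quotient.mk_surjective _ x
  exact ⟨x, congrArg (Submodule.Quotient.mk (p := A.trunc.sub j)) (A.mul_one' x)⟩

/-- This identifies the quotient used to define the base change with the tensor complex. The map `q
⊗ [a] ↦ [q f(a)]` into the quotient of `Q` by the ideal is well defined, so an element killed in the
tensor product lies in the ideal. Conversely, `f(c) q` goes up to sign to `q ⊗ [c] = 0`. -/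
theorem toTensorH0_eq_zero {i : ℤ} {q : Q.deg i} :
    (toTensorH0 f).app (add_zero i) q = 0 ↔ q ∈ (f.ideal A.trunc).sub i := by
  constructor
  · intro h
    let β {a b : ℤ} (h : a + b = i) : Q.deg a →ₗ[R] (A.asMod.quot A.trunc.toSub).deg b →ₗ[R]
        (Q.deg i ⧸ (f.ideal A.trunc).sub i) :=
      LinearMap.flip (Submodule.liftQ _
        ((((Q.mul h).compl₂ (f.app b)).compr₂ ((f.ideal A.trunc).sub i).mkQ).flip) (by
          intro c hc
          refine LinearMap.mem_ker.2 (LinearMap.ext fun q => (Submodule.Quotient.mk_eq_zero _).2 ?_)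
          change Q.mul h q (f.app b c) ∈ _
          refine (f.ideal A.trunc).mul_mem h q (Submodule.subset_span
            ⟨b, 0, add_zero b, c, Q.one, hc, (Q.mul_one' _).symm⟩)))
    have hβ {i' m j l l' : ℤ} (h₁ : i' + m = l) (h₂ : l + j = i) (h₃ : m + j = l')
        (h₄ : i' + l' = i) (q : Q.deg i') (a : A.deg m)
        (x : (A.asMod.quot A.trunc.toSub).deg j) :
        β h₂ (Q.mul h₁ q (f.app m a)) x =
          β h₄ q ((A.asMod.quot A.trunc.toSub).act h₃ a x) := by
      obtain ⟨x, rfl⟩ := Submodule.Quotient.mk_surjective _ x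
      change Submodule.Quotient.mk (Q.mul h₂ (Q.mul h₁ q (f.app m a)) (f.app j x)) =
        Submodule.Quotient.mk (Q.mul h₄ q (f.app l' (A.mul h₃ a x)))
      rw [f.map_mul, Q.mul_assoc h₁ h₂ h₃ h₄]
    have e := congrArg (tlift f _ β hβ) h
    rw [map_zero] at e
    have e' := (tlift_tmk f _ β hβ (add_zero i) q A.oneH0.1).symm.trans e
    have e'' : Submodule.Quotient.mk (p := (f.ideal A.trunc).sub i)
        (Q.mul (add_zero i) q (f.app 0 A.one)) = 0 := e'
    rwa [f.map_one, Q.mul_one', Submodule.Quotient.mk_eq_zero] at e''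
  · intro hq
    induction hq using Submodule.span_induction with
    | mem z hz =>
      obtain ⟨a, b, h, c, q, hc, rfl⟩ := hz
      rw [Q.mul_comm h (by omega), map_negOnePow_smul]
      have e := tmk_eq_of_cyclic f (A.asMod.quot A.trunc.toSub) A.oneH0.1 (by omega : b + a = i) q c
      have e₁ : (A.asMod.quot A.trunc.toSub).act (add_zero a) c A.oneH0.1 = 0 :=
        (Submodule.Quotient.mk_eq_zero _).2 (by
          change A.mul _ c A.one ∈ _
          rwa [A.mul_one'])
      rw [e₁, map_zero] at e
      exact (congrArg _ e.symm).trans (smul_zero _)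
    | zero => exact map_zero _
    | add z w _ _ hz hw => exact (map_add _ z w).trans (by rw [hz, hw, add_zero])
    | smul r z _ hz => exact (map_smul _ r z).trans (by rw [hz, smul_zero])

/-- The isomorphism `Q / (ker (A → H^0(A))) ≃ Q ⊗_A H^0(A)`. -/
def quotMapTensorH0 : Cpx.Map 0 (Q.quot (f.ideal A.trunc)).asMod.cpx
    (tensorCpx f (A.asMod.quot A.trunc.toSub)) where
  app {i j} h := ((f.ideal A.trunc).sub i).liftQ ((toTensorH0 f).app h) (fun q hq => by
    obtain rfl : i = j := by omega
    exact (toTensorH0_eq_zero f).2 hq)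
  comm hi h h' hj x := by
    obtain ⟨x, rfl⟩ := Submodule.Quotient.mk_surjective _ x
    exact (toTensorH0 f).comm hi h h' hj x

theorem quotMapTensorH0_bijective (i : ℤ) :
    Function.Bijective ((quotMapTensorH0 f).H (add_zero i)) := by
  refine Cpx.Map.bijective_H _ (fun i => ⟨?_, ?_⟩) i
  · refine (injective_iff_map_eq_zero _).2 fun x hx => ?_
    obtain ⟨x, rfl⟩ := Submodule.Quotient.mk_surjective _ x
    exact (Submodule.Quotient.mk_eq_zero _).2 ((toTensorH0_eq_zero f).1 hx)
  · intro z
    obtain ⟨q, rfl⟩ := toTensorH0_surjective f i z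
    exact ⟨Submodule.Quotient.mk q, rfl⟩

/-- In degree zero, the ideal generated by the kernel of `A → H^0(A)` consists of boundaries. -/
theorem ideal_trunc_zero_le : (f.ideal A.trunc).sub 0 ≤ Q.trunc.sub 0 := by
  refine Submodule.span_le.2 ?_
  rintro _ ⟨i, j, h, a, q, ha, rfl⟩
  rcases lt_or_ge 0 i with hi | hi
  · have := A.subsingleton_of_pos i hi
    rw [Subsingleton.elim a 0, map_zero, LinearMap.map_zero₂]
    exact zero_mem _
  · rcases lt_or_ge 0 j with hj | hj
    · have := Q.subsingleton_of_pos j hj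
      rw [Subsingleton.elim q 0, map_zero]
      exact zero_mem _
    -- Both degrees are nonpositive with sum zero, so `a` is a boundary of degree zero and `f a`
    -- times `q` is again a boundary.
    · obtain rfl : i = 0 := by omega
      exact Q.trunc.mul_mem' h q (f.map_trunc 0 a ha)

/-- `H^0(Q) → H^0(Q ⊗_A H^0(A))` is bijective. -/
theorem H0Map_toQuot_bijective :
    Function.Bijective (Q.toQuot (f.ideal A.trunc)).H0Map.ringHom := by
  constructor
  · refine (injective_iff_map_eq_zero _).2 fun x hx => ?_
    obtain ⟨x, rfl⟩ := Submodule.Quotient.mk_surjective _ x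
    have hx' : Submodule.Quotient.mk x ∈ (Q.quot (f.ideal A.trunc)).trunc.sub 0 :=
      (Submodule.Quotient.mk_eq_zero _).1 hx
    obtain ⟨y, hy⟩ := DGMod.mem_trunc_zero hx'
    obtain ⟨y, rfl⟩ := Submodule.Quotient.mk_surjective _ y
    have hd := ideal_trunc_zero_le f ((Submodule.Quotient.eq ((f.ideal A.trunc).sub 0)).1 hy)
    refine (Submodule.Quotient.mk_eq_zero _).2 ?_
    have hb : Q.d (sub_add_cancel 0 1) y ∈ Q.trunc.sub 0 := Q.mem_trunc_zero.2 ⟨y, rfl⟩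
    have := sub_mem hb hd
    rwa [sub_sub_cancel] at this
  · intro x
    obtain ⟨x, rfl⟩ := Submodule.Quotient.mk_surjective _ x
    obtain ⟨x, rfl⟩ := Submodule.Quotient.mk_surjective _ x
    exact ⟨Submodule.Quotient.mk x, rfl⟩

/-- A quasi-isomorphism induces an isomorphism of the rings `H^0(Q)` and `H^0(B)`. -/
theorem Hom.H0Map_bijective {B : DAlg k R} (π : Hom (RingHom.id R) Q B)
    (hπ : Function.Bijective (π.cohMap 0)) : Function.Bijective π.H0Map.ringHom := by
  -- `H^0` is built as a quotient of the whole degree zero part, while `Coh 0` is a quotient of the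
  -- cocycles. The two agree because nothing lives in degree one.
  have mem_bd {C : DAlg k R} {x : C.deg 0} (h : x ∈ C.asMod.cpx.Z 0) :
      x ∈ C.trunc.sub 0 ↔ C.asMod.cpx.cls ⟨x, h⟩ = 0 := by
    exact C.mem_trunc_zero.trans (C.asMod.cpx.cls_eq_zero (x := ⟨x, h⟩) (sub_add_cancel 0 1)).symm
  have mem_Z {C : DAlg k R} (x : C.deg 0) : x ∈ C.asMod.cpx.Z 0 := by
    have := C.subsingleton_of_pos (0 + 1) (by omega)
    exact (Cpx.mem_Z _ rfl).2 (Subsingleton.elim _ _)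
  constructor
  · refine (injective_iff_map_eq_zero _).2 fun x hx => ?_
    obtain ⟨x, rfl⟩ := Submodule.Quotient.mk_surjective _ x
    have hx' : π.app 0 x ∈ B.trunc.sub 0 := (Submodule.Quotient.mk_eq_zero _).1 hx
    refine (Submodule.Quotient.mk_eq_zero _).2 ((mem_bd (mem_Z x)).2 (hπ.1 ?_))
    exact ((mem_bd (mem_Z _)).1 hx').trans (map_zero _).symm
  · intro y
    obtain ⟨y, rfl⟩ := Submodule.Quotient.mk_surjective _ y
    obtain ⟨x, hx⟩ := hπ.2 (B.asMod.cpx.cls ⟨y, mem_Z y⟩)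
    obtain ⟨x, rfl⟩ := Q.asMod.cpx.cls_surjective x
    refine ⟨Submodule.Quotient.mk x.1, ?_⟩
    refine (Submodule.Quotient.eq _).2 ((mem_bd (mem_Z _)).2 ?_)
    exact sub_eq_zero.2 hx

theorem flat_H0Mod_iff : Module.Flat (A.H0.deg 0) (H0Mod f) ↔ f.H0Map.ringHom.Flat := Iff.rfl

/-- The base change condition in the definition of `D`-flatness, for a resolved morphism. -/
theorem isBaseChangeAlong_comp_iff {B : DAlg k R} (π : Hom (RingHom.id R) Q B)
    (hπ : ∀ i, Function.Bijective (π.cohMap i)) (j : ℤ) :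
    DGDAlgebra.IsBaseChangeAlong (f.comp π).H0Map.ringHom ((f.comp π).cohMapH0 j) ↔
      Function.Bijective (comparison f A.asMod j) := by
  -- The identifications used are `H^0(Q) ≃ H^0(B)` through `π`, and `H^j(B) ≃ H^j(Q) ≃ H^j(Q ⊗_A
  -- A)` through `π` and `unitMap`.
  let e : H0Mod f ≃+ B.H0.deg 0 :=
    (RingEquiv.ofBijective π.H0Map.ringHom (π.H0Map_bijective (hπ 0))).toAddEquiv
  let p : Q.Coh j ≃+ B.Coh j := AddEquiv.ofBijective (π.cohMap j) (hπ j)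
  have hu := (unitMap f).bijective_H (unitMap_bijective f) j
  let w : B.Coh j →+ (tensorCpx f A.asMod).H j :=
    ((unitMap f).H (add_zero j)).toAddMonoidHom.comp p.symm.toAddMonoidHom
  let m : A.asMod.Coh j ≃ₗ[A.H0.deg 0] A.Coh j :=
    { AddEquiv.refl (A.Coh j) with
      map_smul' := fun a x => by
        obtain ⟨a, rfl⟩ := A.mkH0_surjective a
        obtain ⟨x, rfl⟩ := DGMod.cls_surjective _ x
        rfl }
  refine isBaseChangeAlong_iff _ _ e (fun s t => ?_) m w (hu.comp p.symm.bijective) _ fun t x => ?_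
  · obtain ⟨s, rfl⟩ := A.mkH0_surjective s
    obtain ⟨t, rfl⟩ := H0Mod.mk_surjective f t
    exact congrArg (Submodule.Quotient.mk (p := B.trunc.sub 0)) (π.map_mul _ (f.app 0 s) t)
  · obtain ⟨q, rfl⟩ := H0Mod.mk_surjective f t
    obtain ⟨x, rfl⟩ := DGMod.cls_surjective _ x
    have hz : Q.mul (zero_add j) q (f.app j x.1) ∈ Q.cocycles j :=
      Q.mul_mem_cocycles q (f.cocyclesMap j x).2
    have e₁ : e (H0Mod.mk f q) • (f.comp π).cohMapH0 j (m (A.asMod.cls x)) =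
        p (Submodule.Quotient.mk ⟨_, hz⟩) :=
      congrArg (Submodule.Quotient.mk (p := (B.boundaries j).comap (B.cocycles j).subtype))
        (Subtype.ext (π.map_mul (zero_add j) q (f.app j x.1)).symm)
    rw [e₁]
    change _ = (unitMap f).H (add_zero j) (p.symm (p _))
    rw [p.symm_apply_apply, comparison_tmul]
    refine congrArg (Cpx.cls _) (Subtype.ext ?_)
    refine Eq.trans ?_ (tmk_eq_of_cyclic f A.asMod A.one (zero_add j) q x.1)
    exact congrArg (fun a => tmk f A.asMod (zero_add j) q a) (A.mul_one' x.1).symm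

end Cyclic

end DAlg

namespace DAlg

variable {k R : Type u} [CommRing k] [CommRing R] [Algebra k R] {A Q : DAlg k R}

/-! ## The affine criterion for `D`-flatness -/

section Affine

open DGMod

theorem isTruncated_asMod_quot (A : DAlg k R) : (A.asMod.quot A.trunc.toSub).IsTruncated := by
  intro i j n h a x ha
  obtain ⟨x, rfl⟩ := Submodule.Quotient.mk_surjective _ x
  exact (Submodule.Quotient.mk_eq_zero _).2 (A.trunc.mul_mem' h x ha)

/-- With `E = H^0(A)`, this keeps the dévissage by cells inside the dg modules over `H^0(A)`. -/
theorem isTruncated_cone_cell {E N : DGMod A} {V : Type u} {m : ℤ} {g : GHom 0 (cell E V m) N}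
    (hg : g.Closed) (hE : E.IsTruncated) (hN : N.IsTruncated) : (cone hg).IsTruncated := by
  intro i j n h a x ha
  obtain ⟨y, x⟩ := x
  refine (cone_act hg h a y x).trans (Prod.ext (hN h a y ha) ?_)
  have hx : (cell E V m).act (by omega : i + (j + 1) = n + 1) a x = 0 := by
    refine Finsupp.ext fun v => ?_
    change ((m * i).negOnePow : ℤ) • E.act (j := j + 1 - m) (n := n + 1 - m) (by omega) a
      ((id x : V →₀ E.deg (j + 1 - m)) v) = 0
    rw [hE _ _ _ ha, smul_zero]
  dsimp only
  rw [hx]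
  exact smul_zero i.negOnePow

theorem subsingleton_H0_deg (A : DAlg k R) {j : ℤ} (hj : j ≠ 0) : Subsingleton (A.H0.deg j) := by
  rcases lt_or_gt_of_ne hj with hj | hj
  · refine subsingleton_of_forall_eq 0 fun x => ?_
    obtain ⟨x, rfl⟩ := Submodule.Quotient.mk_surjective _ x
    refine (Submodule.Quotient.mk_eq_zero _).2 ?_
    simp [trunc, hj]
  · exact A.H0.subsingleton_of_pos j hj

variable (f : Hom (RingHom.id R) A Q)

theorem H0Mod.mk_zero : H0Mod.mk f 0 = 0 := rfl

theorem H0Mod.mk_add (p q : Q.deg 0) :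
    H0Mod.mk f (p + q) = H0Mod.mk f p + H0Mod.mk f q := rfl

/-- The module `H^0(A)` is generated over itself by `1`, so scalars can be moved into the left
factor. -/
theorem exists_eq_tmul_one (t : H0Mod f ⊗[A.H0.deg 0] (A.asMod.quot A.trunc.toSub).Coh 0) :
    ∃ q, H0Mod.mk f q ⊗ₜ DGMod.cls _ A.oneH0 = t := by
  induction t using TensorProduct.induction_on with
  | zero => exact ⟨0, by rw [H0Mod.mk_zero, TensorProduct.zero_tmul]⟩
  | add x y hx hy =>
    obtain ⟨p, rfl⟩ := hx
    obtain ⟨q, rfl⟩ := hy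
    exact ⟨p + q, by rw [H0Mod.mk_add, TensorProduct.add_tmul]⟩
  | tmul q x =>
    obtain ⟨q, rfl⟩ := H0Mod.mk_surjective f q
    obtain ⟨⟨x, hx⟩, rfl⟩ := DGMod.cls_surjective _ x
    obtain ⟨a, rfl⟩ := Submodule.Quotient.mk_surjective _ x
    have e : A.mkH0 a • DGMod.cls _ A.oneH0 =
        DGMod.cls (A.asMod.quot A.trunc.toSub) ⟨Submodule.Quotient.mk a, hx⟩ :=
      congrArg (DGMod.cls _) (Subtype.ext
        (congrArg (Submodule.Quotient.mk (p := A.trunc.sub 0)) (A.mul_one' a)))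
    exact ⟨_, by rw [← e, ← TensorProduct.smul_tmul, H0Mod.smul_mk]⟩

/-- The comparison map of `H^0(A)` is bijective in degree zero. -/
theorem comparison_H0_zero :
    Function.Bijective (comparison f (A.asMod.quot A.trunc.toSub) 0) := by
  constructor
  · refine (injective_iff_map_eq_zero _).2 fun t ht => ?_
    obtain ⟨q, rfl⟩ := exists_eq_tmul_one f t
    rw [comparison_tmul, Cpx.cls_eq_zero _ (sub_add_cancel 0 1)] at ht
    obtain ⟨z, hz⟩ := ht
    obtain ⟨b, rfl⟩ := toTensorH0_surjective f _ z
    have e := (toTensorH0 f).comm (sub_add_cancel 0 1) (add_zero _) (add_zero 0)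
      (sub_add_cancel 0 1) b
    rw [Int.negOnePow_zero, one_smul] at e
    -- If `q ⊗ 1` is a boundary, lift its primitive to some `b` in `Q`. Then `q - d b` lies in the
    -- ideal, which in degree zero consists of boundaries, so `q` is itself a boundary.
    have h : (toTensorH0 f).app (add_zero 0) (q - Q.d (sub_add_cancel 0 1) b) = 0 := by
      refine (map_sub ((toTensorH0 f).app (add_zero 0)) q _).trans (sub_eq_zero.2 ?_)
      exact hz.symm.trans e
    have h₁ := ideal_trunc_zero_le f ((toTensorH0_eq_zero f).1 h)
    have h₂ : Q.d (sub_add_cancel 0 1) b ∈ Q.trunc.sub 0 := Q.mem_trunc_zero.2 ⟨b, rfl⟩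
    have h₃ := add_mem h₁ h₂
    rw [sub_add_cancel] at h₃
    have : H0Mod.mk f q = 0 := (Submodule.Quotient.mk_eq_zero _).2 h₃
    rw [this, TensorProduct.zero_tmul]
  · intro z
    obtain ⟨z, rfl⟩ := Cpx.cls_surjective _ z
    obtain ⟨q, hq⟩ := toTensorH0_surjective f 0 z.1
    exact ⟨H0Mod.mk f q ⊗ₜ DGMod.cls _ A.oneH0, congrArg (Cpx.cls _) (Subtype.ext hq)⟩

variable {f}

/-- For a K-flat resolution `A → Q → B`, the morphism `A → B` is `D`-flat if and only if `H^0(Q)`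
is flat over `H^0(A)` and `Q ⊗_A H^0(A)` has cohomology in degree zero only. -/
theorem flat_and_isBaseChangeAlong_iff (hf : IsKFlat f) {B : DAlg k R}
    (π : Hom (RingHom.id R) Q B) (hπ : ∀ i, Function.Bijective (π.cohMap i)) :
    ((f.comp π).H0Map.ringHom.Flat ∧ ∀ j, DGDAlgebra.IsBaseChangeAlong
      (f.comp π).H0Map.ringHom ((f.comp π).cohMapH0 j)) ↔
    (f.H0Map.ringHom.Flat ∧ ∀ j, j ≠ 0 → Subsingleton ((Q.quot (f.ideal A.trunc)).Coh j)) := by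
  have e : (f.comp π).H0Map.ringHom = π.H0Map.ringHom.comp f.H0Map.ringHom := by
    refine RingHom.ext fun x => ?_
    obtain ⟨x, rfl⟩ := A.mkH0_surjective x
    rfl
  have hflat : (f.comp π).H0Map.ringHom.Flat ↔ f.H0Map.ringHom.Flat := by
    rw [e]
    exact RingHom.Flat.comp_iff_of_bijective_left (π.H0Map_bijective (hπ 0))
  have hT (j : ℤ) : Subsingleton ((Q.quot (f.ideal A.trunc)).Coh j) ↔
      Subsingleton ((tensorCpx f (A.asMod.quot A.trunc.toSub)).H j) :=
    (Equiv.ofBijective _ (quotMapTensorH0_bijective f j)).subsingleton_congr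
  have hH {j : ℤ} (hj : j ≠ 0) : Subsingleton ((A.asMod.quot A.trunc.toSub).Coh j) :=
    Cpx.subsingleton_H_of_deg _ (A.subsingleton_H0_deg hj)
  rw [hflat]
  refine and_congr_right fun h => ?_
  have : Module.Flat (A.H0.deg 0) (H0Mod f) := (flat_H0Mod_iff f).2 h
  simp only [isBaseChangeAlong_comp_iff f π hπ]
  constructor
  · intro hA j hj
    rw [hT]
    -- `A` generates all dg modules: a cocycle `x` is the image of `1` under its orbit map. The
    -- dévissage is applied to `H^0(A)`, where the source of the comparison map vanishes for `j ≠
    -- 0`.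
    have hb := comparison_bijective_of_generator hf A.asMod A.subsingleton_of_pos hA
      (fun _ => True) (fun _ _ => trivial)
      (fun N _ m x => ⟨N.orbit x.1, N.orbit_closed x.1 x.2, A.one, A.one_mem_Z, N.orbit_one x.1⟩)
      (N := A.asMod.quot A.trunc.toSub) trivial (m := 0) (fun i hi => hH hi.ne') j
    have := hH hj
    exact hb.2.subsingleton
  · intro hP j
    have hS (i : ℤ) : Function.Bijective (comparison f (A.asMod.quot A.trunc.toSub) i) := by
      rcases eq_or_ne i 0 with rfl | hi
      · exact comparison_H0_zero f
      · exact comparison_bijective_of_subsingleton f (hH hi) ((hT i).1 (hP i hi))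
    -- In the other direction, `A` is reduced to modules over `H^0(A)`, and these to the generator
    -- `H^0(A)`, to which `hS` applies.
    refine comparison_bijective_of_isTruncated hf (fun N hN m hm j => ?_) (m := 0)
      (fun i hi => Cpx.subsingleton_H_of_deg _ (A.subsingleton_of_pos i hi)) j
    refine comparison_bijective_of_generator hf (A.asMod.quot A.trunc.toSub)
      A.H0.subsingleton_of_pos hS IsTruncated
      (fun hg hN => isTruncated_cone_cell hg A.isTruncated_asMod_quot hN)
      (fun N hN m x => ?_) hN hm j
    -- On a module over `H^0(A)` the orbit map of a cocycle kills the kernel of `A → H^0(A)`, so it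
    -- descends to a closed map out of `H^0(A)`.
    have h₀ {i j : ℤ} (h : i + m = j) (a : A.deg i) (ha : a ∈ A.trunc.sub i) :
        (N.orbit x.1).app h a = 0 := by
      rw [orbit_app, hN h a x.1 ha, smul_zero]
    exact ⟨(N.orbit x.1).desc A.trunc.toSub h₀, GHom.desc_closed (N.orbit_closed x.1 x.2) _ h₀,
      A.oneH0.1, A.oneH0.2, N.orbit_one x.1⟩

/-- This supplies the weak equivalence with a discrete algebra: the projection to `H^0` always
identifies cohomology in degree zero, and elsewhere both sides vanish. -/
theorem toQuot_trunc_bijective (A : DAlg k R) (hA : ∀ j, j ≠ 0 → Subsingleton (A.Coh j)) (i : ℤ) :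
    Function.Bijective ((A.toQuot A.trunc).cohMap i) := by
  rcases eq_or_ne i 0 with rfl | hi
  · constructor
    · refine (injective_iff_map_eq_zero _).2 fun x hx => ?_
      obtain ⟨x, rfl⟩ := A.asMod.cpx.cls_surjective x
      obtain ⟨y, hy⟩ := (A.H0.asMod.cpx.cls_eq_zero (sub_add_cancel 0 1)).1 hx
      have := A.subsingleton_H0_deg (j := 0 - 1) (by omega)
      rw [Subsingleton.elim y 0, map_zero] at hy
      exact (A.asMod.cpx.cls_eq_zero (sub_add_cancel 0 1)).2
        (A.mem_trunc_zero.1 ((Submodule.Quotient.mk_eq_zero _).1 hy.symm))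
    · intro y
      obtain ⟨⟨y, hy⟩, rfl⟩ := A.H0.asMod.cpx.cls_surjective y
      obtain ⟨x, rfl⟩ := A.mkH0_surjective y
      have := A.subsingleton_of_pos (0 + 1) (by omega)
      exact ⟨A.asMod.cpx.cls ⟨x, (Cpx.mem_Z _ rfl).2 (Subsingleton.elim _ _)⟩, rfl⟩
  · have := hA i hi
    have := A.H0.asMod.cpx.subsingleton_H_of_deg (A.subsingleton_H0_deg hi)
    exact ⟨fun _ _ _ => Subsingleton.elim _ _, fun _ => ⟨0, this.elim _ _⟩⟩

theorem toQuot_trunc_ringHom_bijective (A : DAlg k R) (hA : ∀ j, j ≠ 0 → Subsingleton (A.deg j)) :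
    Function.Bijective (A.toQuot A.trunc).ringHom := by
  refine ⟨(injective_iff_map_eq_zero _).2 fun x hx => ?_, A.mkH0_surjective⟩
  obtain ⟨y, rfl⟩ := DGMod.mem_trunc_zero ((Submodule.Quotient.mk_eq_zero _).1 hx)
  have := hA (0 - 1) (by omega)
  rw [Subsingleton.elim y 0, map_zero]

end Affine

end DAlg

/-! ## Flatness up to weak equivalence -/

namespace DGDAlgebra

variable {k : Type u} [Field k] {X : Scheme.{u}} [X.Over (Spec (.of k))]

/-- An `S`-algebra whose cohomology is concentrated in degree zero and flat. -/
def HasFlatCohomology {S : DGDAlgebra k X} (C : Under S) : Prop :=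
  ∀ U : X.affineOpens, (∀ j, j ≠ 0 → Subsingleton ((C.right.obj U).Coh j)) ∧
    (((C.right.obj U).toQuot (C.right.obj U).trunc).ringHom.comp (Hom.app C.hom U).ringHom).Flat

/-- Both conditions depend only on cohomology, and `g` is compatible with the structure maps from
`S`. This makes the property constant along zigzags. -/
theorem hasFlatCohomology_iff_of_isQuasiIso {S : DGDAlgebra k X} {C C' : Under S} (g : C ⟶ C')
    (hg : IsQuasiIso g.right) : HasFlatCohomology C ↔ HasFlatCohomology C' := by
  refine forall_congr' fun U => and_congr ?_ ?_
  · exact forall_congr' fun j => imp_congr_right fun _ =>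
      (Equiv.ofBijective _ (hg U j)).subsingleton_congr
  · have e : ((C'.right.obj U).toQuot (C'.right.obj U).trunc).ringHom.comp
          (Hom.app C'.hom U).ringHom =
        (Hom.app g.right U).H0Map.ringHom.comp
          (((C.right.obj U).toQuot (C.right.obj U).trunc).ringHom.comp
            (Hom.app C.hom U).ringHom) := by
      rw [← Under.w g]
      rfl
    rw [e]
    exact (RingHom.Flat.comp_iff_of_bijective_left (DAlg.Hom.H0Map_bijective _ (hg U 0))).symm

theorem WeaklyEquivalent.hasFlatCohomology_iff {S : DGDAlgebra k X} {C C' : Under S}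
    (h : WeaklyEquivalent C C') : HasFlatCohomology C ↔ HasFlatCohomology C' := by
  induction h with
  | rel C C' h => exact h.elim fun g hg => hasFlatCohomology_iff_of_isQuasiIso g hg
  | refl => exact Iff.rfl
  | symm _ _ _ ih => exact ih.symm
  | trans _ _ _ _ _ ih ih' => exact ih.trans ih'

theorem hasFlatCohomology_iff_of_isDiscrete {S : DGDAlgebra k X} {C : Under S}
    (hC : IsDiscrete C) : HasFlatCohomology C ↔ IsFlat C := by
  refine forall_congr' fun U => ?_
  rw [RingHom.Flat.comp_iff_of_bijective_left
    (DAlg.toQuot_trunc_ringHom_bijective _ (hC U))]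
  exact and_iff_right fun j hj =>
    Cpx.subsingleton_H_of_deg (C.right.obj U).asMod.cpx (hC U j hj)

/-- An algebra is weakly equivalent to a discrete flat one if and only if its cohomology is
concentrated in degree zero and flat. -/
theorem hasFlatCohomology_iff_exists {S : DGDAlgebra k X} {C : Under S} :
    HasFlatCohomology C ↔ ∃ D : Under S, IsDiscrete D ∧ IsFlat D ∧ WeaklyEquivalent C D := by
  constructor
  · intro hC
    -- The discrete model is `H^0(C)`, an `S`-algebra through `C`.
    let D : Under S := Under.mk (C.hom ≫ C.right.toH0)
    have hD : IsDiscrete D := fun U i hi => (C.right.obj U).subsingleton_H0_deg hi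
    have hw : WeaklyEquivalent C D := .rel _ _ ⟨Under.homMk C.right.toH0 rfl,
      fun U i => (C.right.obj U).toQuot_trunc_bijective (hC U).1 i⟩
    exact ⟨D, hD, (hasFlatCohomology_iff_of_isDiscrete hD).1 (hw.hasFlatCohomology_iff.1 hC), hw⟩
  · rintro ⟨D, hD, hf, hw⟩
    exact hw.hasFlatCohomology_iff.2 ((hasFlatCohomology_iff_of_isDiscrete hD).2 hf)

/-- The affine criterion is applied on each affine open. It speaks of flatness of `H^0(Q)`, and
`H0Map_toQuot_bijective` carries this over to `H^0` of the derived base change. -/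
theorem isDFlat_iff_hasFlatCohomology {A B : DGDAlgebra k X} (f : A ⟶ B) (Q : FlatResolution f) :
    IsDFlat f ↔ HasFlatCohomology Q.derivedBaseChange := by
  obtain ⟨Q, ι, π, rfl, hπ, hι⟩ := Q
  refine forall_congr' fun U =>
    (DAlg.flat_and_isBaseChangeAlong_iff (hι U) (Hom.app π U) (hπ U)).trans ?_
  rw [and_comm]
  refine and_congr Iff.rfl ?_
  rw [← RingHom.Flat.comp_iff_of_bijective_left (DAlg.H0Map_toQuot_bijective (Hom.app ι U))]
  refine iff_of_eq (congrArg RingHom.Flat (RingHom.ext fun x => ?_))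
  obtain ⟨x, rfl⟩ := DAlg.mkH0_surjective _ x
  rfl

end DGDAlgebra

end

end DGeom

theorem mainTheorem8 {k : Type u} [Field k] [CharZero k] (X : Scheme.{u})
    [X.Over (Spec (.of k))] [Smooth (X ↘ Spec (.of k))]
    {A B : DGeom.DGDAlgebra k X} (f : A ⟶ B) (Q : DGeom.DGDAlgebra.FlatResolution f) :
    DGeom.DGDAlgebra.IsDFlat f ↔
      ∃ C : Under A.H0, DGeom.DGDAlgebra.IsDiscrete C ∧ DGeom.DGDAlgebra.IsFlat C ∧
        DGeom.DGDAlgebra.WeaklyEquivalent Q.derivedBaseChange C := by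
  exact (DGeom.DGDAlgebra.isDFlat_iff_hasFlatCohomology f Q).trans
    DGeom.DGDAlgebra.hasFlatCohomology_iff_exists
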